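/- **Setting.** Let $\Omega$ be the real vector space with basis the words in three letters $a,b,c$ (including the empty word $e$). A word of length $k-1$ has order $k$, and degree $l=-\#\{\text{letters }b\}$; $\Omega^k(l)$ is the span of the words of order $k$ and degree $l$. Put $u\circ v=u\,c\,v$; let $d_i:\Omega^k(l)\to\Omega^{k+1}(l)$ $(1\le i\le k)$ be the insertion of the letter $a$ between the letters $i-1$ and $i$; and let $\partial$ be the graded derivation of the concatenation product with $\partial a=\partial c=0$, $\partial b=c-a$. For $m>0$ let $\Omega_m=\Omega^{\boxtimes m}$, where $\Omega_m^k(l)=\bigoplus_{l_1+\dots+l_m=l}\Omega^k(l_1)\otimes\dots\otimes\Omega^k(l_m)$, with $d_i(x_1\boxtimes\dots\boxtimes x_m)=d_ix_1\boxtimes\dots\boxtimes d_ix_m$ and with $\circ$, $\partial$ and the action $\sigma\mapsto\hat\sigma$ of the symmetric group $S_m$ defined factorwise with the Koszul signs for the degree $l$. The completion $\bar\Omega_m$ is the complete DGA $\bar\Omega_m^n=\prod_{k}\Omega_m^k(n-k)$ with product $x\star y=(-1)^{k(x)(k(y)+l(y))}x\circ y$, differential $d_{\rm tot}=\partial+(-1)^n\sum_{i=1}^k(-1)^id_i$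 (on elements of order $k$ and total degree $n$), and filtration $F_p$ by order $\ge p$. A *universal Maurer–Cartan element of length $m$* is an $\omega\in\bar\Omega_m^1$ with $d_{\rm tot}\omega+\omega\star\omega=0$ whose component of order $1$ is $e^{\boxtimes m}$; it is *symmetric* if $\hat\sigma(\omega)=\omega$ for all $\sigma\in S_m$. A *strong gauge equivalence* between $\omega$ and $\theta$ is an invertible element $u\equiv 1$ mod $F_1$ of degree $0$ of the algebra obtained from $\bar\Omega_m$ by adding a unit, with $u\omega u^{-1}-\theta=(d_{\rm tot}u)u^{-1}$. Two of them, $u$ and $v$, are *homotopic* if $u-v=d_{\rm tot}h+h\omega+\theta h$ for some $h$ of degree $-1$. A *representation up to homotopy* $(E,R_k)_{k\ge0}$ of a Lie groupoid $G$ is a $\mathbb Z$-graded smooth vector bundle $E$ of finite rank over the units with smooth operations $R_k(g_1,\dots,g_k):E_{s(g_k)}\to E_{t(g_1)}$ of degree $1-k$ on strings of $k$ composable arrows, such that for all $k\ge 0$ $$\sum_{j=1}^{k-1}(-1)^jR_{k-1}(g_1,\dots,g_jg_{j+1},\dots,g_k)=\sum_{j=0}^k(-1)^jR_j(g_1,\dots,g_j)\circ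 R_{k-j}(g_{j+1},\dots,g_k);$$ in particular $\partial=R_0$ is a differential. $(E,R_k)$ and $(E,R'_k)$ are *strongly isomorphic* if $R_0=R_0'$ and there are smooth operations $\Phi_k(g_1,\dots,g_k):E_{s(g_k)}\to E_{t(g_1)}$ of degree $-k$ with $\Phi_0=\mathrm{Id}$ and, for all $k$, $$\sum_{j=0}^k(-1)^j\Phi_j(g_1,\dots,g_j)\circ R_{k-j}(g_{j+1},\dots,g_k)=\sum_{j=0}^kR'_j(g_1,\dots,g_j)\circ\Phi_{k-j}(g_{j+1},\dots,g_k)+\sum_{j=1}^{k-1}(-1)^j\Phi_{k-1}(g_1,\dots,g_jg_{j+1},\dots,g_k).$$ A representation up to homotopy has a characteristic map $k_E$, which sends $b^{k-1}$ to $R_k$, $u\circ v$ to $k_E(u)(g_1,\dots,g_p)\circ k_E(v)(g_{p+1},\dots,g_k)$ ($p$ the order of $u$), and $d_iu$ to $k_E(u)(\dots,g_ig_{i+1},\dots)$. For representations up to homotopy $E_1,\dots,E_m$ of $G$ and a universal Maurer–Cartan element $\omega=\omega_1+\omega_2+\cdots$ of length $m$, $\otimes_\omega(E_1,\dots,E_m)$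 is the tensor product complex $E_1\otimes\dots\otimes E_m$ with the operations obtained, for $k\ge1$, by applying $k_{E_1}\otimes\dots\otimes k_{E_m}$ (Koszul signs) to $\omega_k$. **Theorem.** Let $m>0$. 1. Symmetric universal Maurer–Cartan elements of length $m$ exist. 2. Any two universal Maurer–Cartan elements of length $m$ (symmetric or not) are strongly gauge equivalent, and any two strong gauge equivalences between them are homotopic. 3. Hence, for all representations up to homotopy $E_1,\dots,E_m$ of a Lie groupoid and all universal Maurer–Cartan elements $\omega,\theta$ of length $m$, $\otimes_\omega(E_1,\dots,E_m)$ and $\otimes_\theta(E_1,\dots,E_m)$ are representations up to homotopy, and they are strongly isomorphic. If $\omega$ and $\theta$ are symmetric and $E$ is a representation up to homotopy, then the operations of $\otimes_\omega(E,\dots,E)$ descend to the graded symmetric power $S^mE$, the quotient of $E^{\otimes m}$ by the relations $\cdots\otimes v\otimes w\otimes\cdots=(-1)^{|v||w|}\cdots\otimes w\otimes v\otimes\cdots$, and make it a representation up to homotopy; those obtained from $\omega$ and from $\theta$ are strongly isomorphic. -/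

import Mathlib

open scoped Manifold ContDiff TensorProduct Topology

noncomputable section

namespace RuthTensor

/-! ## The Maurer-Cartan DB-algebra and its tensor powers -/

/-- The three letters: two consecutive leaves of a short forest lie on the same branch (`a`), on
different branches of the same tree (`b`), or on different trees (`c`). -/
inductive Letter where
  | a : Letter
  | b : Letter
  | c : Letter
  deriving DecidableEq

/-- A short forest with `k` leaves is a word of length `k - 1` in the letters `a`, `b`, `c`.
A basis tensor `w₁ ⊠ ... ⊠ wₘ` of the `m`-fold tensor power consists of `m` words of the same
length; it is stored as the list of its columns, so that `W.map (fun q => q i)` is the word `wᵢ`.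
The empty list is `e ⊠ ... ⊠ e`. -/
abbrev Word (m : ℕ) : Type := List (Fin m → Letter)

namespace Word

variable {m : ℕ}

/-- The `i`-th tensor factor. -/
def factor (W : Word m) (i : Fin m) : List Letter := W.map (fun q => q i)

/-- The number of letters `b` in the `i`-th factor; the degree `l(wᵢ)` is minus this number. -/
def bCount (W : Word m) (i : Fin m) : ℕ := (W.factor i).count Letter.b

/-- The order `k`, the number of leaves. -/
def order (W : Word m) : ℕ := W.length + 1

/-- The degree `l = l(w₁) + ... + l(wₘ)`. -/
def degree (W : Word m) : ℤ := -∑ i, (W.bCount i : ℤ)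

/-- The total degree `|W| = k + l`. -/
def totalDegree (W : Word m) : ℤ := (W.order : ℤ) + W.degree

end Word

/-- The tensor power `Ωₘ = Ω ⊠ ... ⊠ Ω` (`m` factors): the real vector space on the basis tensors. -/
abbrev Omega (m : ℕ) : Type := Word m →₀ ℝ

namespace Omega

variable {m : ℕ}

/-- The bihomogeneous piece `Ωₘᵏ(l)`. -/
def piece (m k : ℕ) (l : ℤ) : Submodule ℝ (Omega m) :=
  Finsupp.supported ℝ ℝ {W : Word m | W.order = k ∧ W.degree = l}

/-- The Koszul sign `∏_{j < i} (-1)^{l(uᵢ) l(vⱼ)}` of the product of two basis tensors. -/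
def koszulSign (U V : Word m) : ℝ :=
  (-1) ^ (∑ i, ∑ j ∈ Finset.univ.filter (fun j => j < i), U.bCount i * V.bCount j)

/-- The product `∘` on basis tensors: `(⊠ uᵢ) ∘ (⊠ vᵢ) = ± ⊠ (uᵢ ∘ vᵢ)`, where `u ∘ v = u c v`. -/
def circWord (U V : Word m) : Omega m :=
  Finsupp.single (U ++ (fun _ => Letter.c) :: V) (koszulSign U V)

/-- The signed product `x ⋆ y = (-1)^{k(x) |y|} x ∘ y`. -/
def star : Omega m →ₗ[ℝ] Omega m →ₗ[ℝ] Omega m :=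
  Finsupp.linearCombination ℝ fun U : Word m =>
    Finsupp.linearCombination ℝ fun V : Word m =>
      ((-1 : ℝ) ^ ((U.order : ℤ) * V.totalDegree)) • circWord U V

/-- The differential `∂` on basis tensors: the derivation with Koszul signs with `∂ b = c - a`,
`∂ a = ∂ c = 0`. The letter `b` in position `p` of the `i`-th factor contributes with the sign given
by the letters `b` in the factors before the `i`-th one and those before `p` in the `i`-th one. -/
def delWord (W : Word m) : Omega m :=
  ∑ i : Fin m, ∑ p : Fin W.length,
    if W.get p i = Letter.b then
      ((-1 : ℝ) ^ (∑ j ∈ Finset.univ.filter (fun j => j < i), W.bCount j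
          + Word.bCount (W.take p) i)) •
        (Finsupp.single (W.set p (Function.update (W.get p) i Letter.c)) (1 : ℝ)
          - Finsupp.single (W.set p (Function.update (W.get p) i Letter.a)) (1 : ℝ))
    else 0

/-- The differential `∂ : Ωₘᵏ(l) → Ωₘᵏ(l + 1)`. -/
def del : Omega m →ₗ[ℝ] Omega m := Finsupp.linearCombination ℝ delWord

/-- The operator `d_{i+1}` on basis tensors doubles the leaf number `i + 1` in each factor, that is,
it inserts the letter `a` there. -/
def faceWord (i : ℕ) (W : Word m) : Word m := W.insertIdx i (fun _ => Letter.a)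

/-- The operator `(-1)^n d` on elements of total degree `n`, where `d = ∑_{i=1}^k (-1)^i d_i`. -/
def signedFace : Omega m →ₗ[ℝ] Omega m :=
  Finsupp.linearCombination ℝ fun W : Word m =>
    ((-1 : ℝ) ^ W.totalDegree) •
      ∑ i ∈ Finset.range W.order, Finsupp.single (faceWord i W) ((-1 : ℝ) ^ (i + 1))

/-- The automorphism `σ̂` on basis tensors: it moves the factor `wᵢ` to the place `σ i`, with the
Koszul sign. -/
def permWord (σ : Equiv.Perm (Fin m)) (W : Word m) : Omega m :=
  Finsupp.single (W.map fun q i => q (σ.symm i))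
    ((-1 : ℝ) ^ (∑ i, ∑ j ∈ Finset.univ.filter (fun j => i < j ∧ σ j < σ i),
      W.bCount i * W.bCount j))

/-- The action of a permutation on `Ωₘ`. -/
def perm (σ : Equiv.Perm (Fin m)) : Omega m →ₗ[ℝ] Omega m := Finsupp.linearCombination ℝ (permWord σ)

end Omega

/-! ## The complete DGA, Maurer-Cartan elements, gauge equivalences, homotopies -/

/-- Formal sums `x₀ + x₁ + x₂ + ...` of elements of `Ωₘ`. The elements of degree `n` of the
completion of `Ωₘ` are those with `xₖ ∈ Ωₘᵏ(n - k)`, see `HasDegree`. -/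
abbrev Completion (m : ℕ) : Type := ℕ → Omega m

namespace Completion

variable {m : ℕ}

/-- `x` lies in the degree `n` part `∏ₖ Ωₘᵏ(n - k)` of the completion. -/
def HasDegree (n : ℤ) (x : Completion m) : Prop := ∀ k : ℕ, x k ∈ Omega.piece m k (n - k)

/-- The product of the completion. -/
def star (x y : Completion m) : Completion m := fun k =>
  ∑ ij ∈ Finset.HasAntidiagonal.antidiagonal k, Omega.star (x ij.1) (y ij.2)

/-- The total differential `∂ + (-1)^n d` of the completion. -/
def dTot (x : Completion m) : Completion m
  | 0 => Omega.del (x 0)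
  | k + 1 => Omega.del (x (k + 1)) + Omega.signedFace (x k)

/-- Maurer-Cartan elements: degree one and `d η + η ⋆ η = 0`. -/
def IsMaurerCartan (η : Completion m) : Prop := HasDegree 1 η ∧ dTot η + star η η = 0

/-- Universal Maurer-Cartan elements of length `m`: the first component is `e ⊠ ... ⊠ e`. -/
def IsUniversalMC (η : Completion m) : Prop :=
  IsMaurerCartan η ∧ η 1 = Finsupp.single ([] : Word m) 1

/-- Symmetric elements: `σ̂ η = η` for all permutations `σ`. -/
def IsSymmetric (η : Completion m) : Prop :=
  ∀ (σ : Equiv.Perm (Fin m)) (k : ℕ), Omega.perm σ (η k) = η k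

end Completion

/-- The complete DGA obtained by adding a unit to the completion of `Ωₘ` (which has none);
`(r, x)` stands for `r 1 + x`. -/
abbrev UnitalCompletion (m : ℕ) : Type := ℝ × Completion m

namespace UnitalCompletion

variable {m : ℕ}

/-- The inclusion of the completion of `Ωₘ`. -/
def incl (x : Completion m) : UnitalCompletion m := (0, x)

/-- The unit. -/
def unit (m : ℕ) : UnitalCompletion m := (1, 0)

/-- The product `(r + x) (s + y) = r s + r y + s x + x ⋆ y`. -/
def mul (u v : UnitalCompletion m) : UnitalCompletion m :=
  (u.1 * v.1, u.1 • v.2 + v.1 • u.2 + Completion.star u.2 v.2)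

/-- The differential, zero on the unit. -/
def dTot (u : UnitalCompletion m) : UnitalCompletion m := (0, Completion.dTot u.2)

/-- Homogeneous elements of degree `n`; the unit has degree zero. -/
def HasDegree (n : ℤ) (u : UnitalCompletion m) : Prop := (n ≠ 0 → u.1 = 0) ∧ Completion.HasDegree n u.2

/-- A gauge equivalence between `η` and `θ`: an invertible element `u` of degree zero with
`u η u⁻¹ - θ = (d u) u⁻¹`. -/
def IsGaugeEquivalence (η θ : Completion m) (u : UnitalCompletion m) : Prop :=
  HasDegree 0 u ∧ ∃ v : UnitalCompletion m, HasDegree 0 v ∧ mul u v = unit m ∧ mul v u = unit m ∧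
    mul (mul u (incl η)) v - incl θ = mul (dTot u) v

/-- The gauge equivalence `u` is strong if `u` is congruent to `1` modulo the first step of the
filtration of the completion, that is, `u = 1 + x` where `x` has no component of order zero. -/
def IsStrongGaugeEquivalence (η θ : Completion m) (u : UnitalCompletion m) : Prop :=
  IsGaugeEquivalence η θ u ∧ u.1 = 1 ∧ u.2 0 = 0

/-- A homotopy between two gauge equivalences `u`, `v` from `η` to `θ`: an element `h` of degree `-1`
with `u - v = d h + h η + θ h`. -/
def Homotopic (η θ : Completion m) (u v : UnitalCompletion m) : Prop :=
  ∃ h : UnitalCompletion m, HasDegree (-1) h ∧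
    u - v = dTot h + mul h (incl η) + mul (incl θ) h

end UnitalCompletion

/-! ## Lie groupoids -/

/-- A Lie groupoid with space of arrows `G` and space of units `M`. The product `mul g h` of two
arrows is meaningful if `src g = tgt h`. -/
structure LieGroupoid (dM dG : ℕ)
    (M : Type*) [TopologicalSpace M] [ChartedSpace (EuclideanSpace ℝ (Fin dM)) M]
    [IsManifold (𝓡 dM) ∞ M]
    (G : Type*) [TopologicalSpace G] [ChartedSpace (EuclideanSpace ℝ (Fin dG)) G]
    [IsManifold (𝓡 dG) ∞ G] where
  src : G → M
  tgt : G → M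
  unit : M → G
  inv : G → G
  mul : G → G → G
  src_mul : ∀ g h, src g = tgt h → src (mul g h) = src h
  tgt_mul : ∀ g h, src g = tgt h → tgt (mul g h) = tgt g
  mul_assoc : ∀ g h k, src g = tgt h → src h = tgt k → mul (mul g h) k = mul g (mul h k)
  src_unit : ∀ x, src (unit x) = x
  tgt_unit : ∀ x, tgt (unit x) = x
  unit_mul : ∀ g, mul (unit (tgt g)) g = g
  mul_unit : ∀ g, mul g (unit (src g)) = g
  src_inv : ∀ g, src (inv g) = tgt g
  tgt_inv : ∀ g, tgt (inv g) = src g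
  inv_mul : ∀ g, mul (inv g) g = unit (src g)
  mul_inv : ∀ g, mul g (inv g) = unit (tgt g)
  -- source and target are smooth submersions
  submersion_src : Manifold.IsSubmersion (𝓡 dG) (𝓡 dM) ∞ src
  submersion_tgt : Manifold.IsSubmersion (𝓡 dG) (𝓡 dM) ∞ tgt
  smooth_unit : ContMDiff (𝓡 dM) (𝓡 dG) ∞ unit
  smooth_inv : ContMDiff (𝓡 dG) (𝓡 dG) ∞ inv
  /-- Smoothness on the embedded submanifold of composable pairs. -/
  smooth_mul : ContMDiffOn ((𝓡 dG).prod (𝓡 dG)) (𝓡 dG) ∞ (fun p : G × G => mul p.1 p.2)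
    {p | src p.1 = tgt p.2}

section Strings

variable {dM dG : ℕ}
  {M : Type*} [TopologicalSpace M] [ChartedSpace (EuclideanSpace ℝ (Fin dM)) M]
  [IsManifold (𝓡 dM) ∞ M]
  {G : Type*} [TopologicalSpace G] [ChartedSpace (EuclideanSpace ℝ (Fin dG)) G]
  [IsManifold (𝓡 dG) ∞ G]

namespace LieGroupoid

/-- `Γ.IsString l y x`: the list `l = [g₁, ..., gₖ]` is a string of composable arrows
`s(gᵢ) = t(gᵢ₊₁)` from `x = s(gₖ)` to `y = t(g₁)`. A string of length zero is a point `x = y`. -/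
def IsString (Γ : LieGroupoid dM dG M G) : List G → M → M → Prop
  | [], y, x => y = x
  | g :: l, y, x => Γ.tgt g = y ∧ Γ.IsString l (Γ.src g) x

/-- The point between the first `j` arrows and the others: `s(gⱼ)`, and `y` for `j = 0`. -/
def vertex (Γ : LieGroupoid dM dG M G) (y : M) : List G → ℕ → M
  | [], _ => y
  | _ :: _, 0 => y
  | g :: l, j + 1 => Γ.vertex (Γ.src g) l j

/-- `Γ.merge j [g₁, ..., gₖ] = [g₁, ..., gⱼ gⱼ₊₁, ..., gₖ]` for `1 ≤ j < k`. -/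
def merge (Γ : LieGroupoid dM dG M G) : ℕ → List G → List G
  | 1, g :: h :: l => Γ.mul g h :: l
  | j + 1, g :: l => g :: Γ.merge j l
  | _, l => l

end LieGroupoid

end Strings

/-! ## Graded vector bundles -/

/-- The data of a graded vector bundle over `M`: the fibres, their grading, and which sections are
smooth (at a point). The axioms are in `IsVectorBundle`. -/
structure GradedBundle (M : Type*) where
  Fiber : M → Type*
  [addCommGroup : ∀ x, AddCommGroup (Fiber x)]
  [module : ∀ x, Module ℝ (Fiber x)]
  grading : ∀ x, ℤ → Submodule ℝ (Fiber x)
  SmoothAt : (∀ x, Fiber x) → M → Prop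

attribute [instance] GradedBundle.addCommGroup GradedBundle.module

namespace GradedBundle

section Basic

variable {d : ℕ} {M : Type*} [TopologicalSpace M] [ChartedSpace (EuclideanSpace ℝ (Fin d)) M]

/-- `E` is a (smooth, finite rank) graded vector bundle: every point has an open neighbourhood with
a finite frame of homogeneous sections, such that the smooth sections are those with smooth
coefficients. -/
def IsVectorBundle (E : GradedBundle M) : Prop :=
  ∀ x₀ : M, ∃ U : Set M, IsOpen U ∧ x₀ ∈ U ∧
    ∃ (r : ℕ) (deg : Fin r → ℤ) (e : Fin r → ∀ x, E.Fiber x),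
      (∀ x ∈ U, LinearIndependent ℝ (fun i => e i x) ∧
        Submodule.span ℝ (Set.range fun i => e i x) = ⊤ ∧
        ∀ n : ℤ, E.grading x n = Submodule.span ℝ ((fun i => e i x) '' {i | deg i = n})) ∧
      ∀ (σ : ∀ x, E.Fiber x), ∀ x ∈ U, E.SmoothAt σ x ↔
        ∃ c : Fin r → M → ℝ, (∀ i, ContMDiffAt (𝓡 d) 𝓘(ℝ) ∞ (c i) x) ∧
          ∀ᶠ z in 𝓝 x, σ z = ∑ i, c i z • e i z

/-- Smoothness at `p` of a section `ξ` of the pull-back of `E` along `f : ℝⁿ → M`: near `p`, it is a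
finite combination of pull-backs of smooth sections with smooth coefficients. -/
def SmoothAlongAt (E : GradedBundle M) {n : ℕ} (f : EuclideanSpace ℝ (Fin n) → M)
    (ξ : ∀ q, E.Fiber (f q)) (p : EuclideanSpace ℝ (Fin n)) : Prop :=
  ∃ (N : ℕ) (c : Fin N → EuclideanSpace ℝ (Fin n) → ℝ) (σ : Fin N → ∀ x, E.Fiber x),
    (∀ i, ContDiffAt ℝ ∞ (c i) p) ∧ (∀ i, E.SmoothAt (σ i) (f p)) ∧
      ∀ᶠ q in 𝓝 p, ξ q = ∑ i, c i q • σ i (f q)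

/-- The operator of the fibre over `x` that is `(-1)^n` on the part of degree `n`. -/
def parity (E : GradedBundle M) (x : M) : Module.End ℝ (E.Fiber x) :=
  Classical.epsilon fun T : Module.End ℝ (E.Fiber x) =>
    ∀ n : ℤ, ∀ v ∈ E.grading x n, T v = ((-1 : ℝ) ^ n) • v

/-- A family of endomorphisms `D x` of the fibres, as a family of maps between all pairs of fibres
that vanish between the fibres over different points. -/
def diagonal (E : GradedBundle M) (D : ∀ x, E.Fiber x →ₗ[ℝ] E.Fiber x) (y x : M) :
    E.Fiber x →ₗ[ℝ] E.Fiber y :=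
  open scoped Classical in if h : x = y then h ▸ D x else 0

/-- The tensor product `E₁ ⊗ ... ⊗ Eₘ` of graded vector bundles. -/
def tensor {m : ℕ} (E : Fin m → GradedBundle M) : GradedBundle M where
  Fiber x := ⨂[ℝ] i, (E i).Fiber x
  grading x n := Submodule.span ℝ
    {t | ∃ (p : Fin m → ℤ) (v : ∀ i, (E i).Fiber x), ∑ i, p i = n ∧
      (∀ i, v i ∈ (E i).grading x (p i)) ∧ t = PiTensorProduct.tprod ℝ v}
  SmoothAt σ x := ∃ (N : ℕ) (c : Fin N → M → ℝ) (s : Fin N → ∀ i, ∀ z, (E i).Fiber z),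
    (∀ a, ContMDiffAt (𝓡 d) 𝓘(ℝ) ∞ (c a) x) ∧ (∀ a i, (E i).SmoothAt (s a i) x) ∧
      ∀ᶠ z in 𝓝 x, σ z = ∑ a, c a z • PiTensorProduct.tprod ℝ (fun i => s a i z)

/-- The relations `... ⊗ v ⊗ w ⊗ ... = (-1)^{|v| |w|} ... ⊗ w ⊗ v ⊗ ...` that define the `m`-th graded
symmetric power of a graded vector space. -/
def symRelations (E : GradedBundle M) (m : ℕ) (x : M) :
    Submodule ℝ (⨂[ℝ] _ : Fin m, E.Fiber x) :=
  Submodule.span ℝ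
    {t | ∃ (i j : Fin m) (p q : ℤ) (v : Fin m → E.Fiber x), (i : ℕ) + 1 = j ∧
      v i ∈ E.grading x p ∧ v j ∈ E.grading x q ∧
      t = PiTensorProduct.tprod ℝ v
        - ((-1 : ℝ) ^ (p * q)) • PiTensorProduct.tprod ℝ (fun a => v (Equiv.swap i j a))}

/-- The symmetric power `SᵐE` of a graded vector bundle, a quotient of `E ⊗ ... ⊗ E`. -/
def sym (E : GradedBundle M) (m : ℕ) : GradedBundle M where
  Fiber x := (⨂[ℝ] _ : Fin m, E.Fiber x) ⧸ E.symRelations m x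
  grading x n := ((tensor (d := d) fun _ : Fin m => E).grading x n).map (E.symRelations m x).mkQ
  SmoothAt σ x := ∃ τ : ∀ z, ⨂[ℝ] _ : Fin m, E.Fiber z,
    (tensor (d := d) fun _ : Fin m => E).SmoothAt τ x ∧
      ∀ᶠ z in 𝓝 x, σ z = (E.symRelations m z).mkQ (τ z)

end Basic

end GradedBundle

/-! ## Representations up to homotopy -/

/-- A family of operations `A(g₁, ..., gₖ) : E_{s(gₖ)} → E'_{t(g₁)}`, `k ≥ 0`. Here `A l y x` is
meaningful if `l` is a string of composable arrows from `x` to `y`; for `k = 0` this is an operation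
`A [] x x : E_x → E'_x`. -/
abbrev Operations {M : Type*} (G : Type*) (E E' : GradedBundle M) :=
  (l : List G) → (y x : M) → E.Fiber x →ₗ[ℝ] E'.Fiber y

section Representations

variable {dM dG : ℕ}
  {M : Type*} [TopologicalSpace M] [ChartedSpace (EuclideanSpace ℝ (Fin dM)) M]
  [IsManifold (𝓡 dM) ∞ M]
  {G : Type*} [TopologicalSpace G] [ChartedSpace (EuclideanSpace ℝ (Fin dG)) G]
  [IsManifold (𝓡 dG) ∞ G]

namespace Operations

/-- The operations on strings of length `k` have degree `n - k`. -/
def HasDegree (Γ : LieGroupoid dM dG M G) {E E' : GradedBundle M} (n : ℤ) (A : Operations G E E') : Prop :=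
  ∀ (l : List G) (y x : M), Γ.IsString l y x →
    ∀ (p : ℤ), ∀ v ∈ E.grading x p, A l y x v ∈ E'.grading y (p + n - l.length)

/-- The operations depend smoothly on the arguments, that is, they define smooth sections of the
bundles `Hom(s^*E, t^*E')` on the manifolds of strings of length `k`. This is tested on smooth
families of strings parametrized by the spaces `ℝⁿ`, which include the parametrizations of the
(embedded) manifold of strings: smooth sections are mapped to smooth sections. -/
def IsSmooth (Γ : LieGroupoid dM dG M G) {E E' : GradedBundle M} (A : Operations G E E') : Prop :=
  ∀ (k n : ℕ) (g : Fin k → EuclideanSpace ℝ (Fin n) → G) (y x : EuclideanSpace ℝ (Fin n) → M),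
    (∀ i, ContMDiff (𝓡 n) (𝓡 dG) ∞ (g i)) →
    ContMDiff (𝓡 n) (𝓡 dM) ∞ y → ContMDiff (𝓡 n) (𝓡 dM) ∞ x →
    (∀ q, Γ.IsString (List.ofFn fun i => g i q) (y q) (x q)) →
    ∀ (p : EuclideanSpace ℝ (Fin n)) (ξ : ∀ q, E.Fiber (x q)),
      E.SmoothAlongAt x ξ p →
      E'.SmoothAlongAt y (fun q => A (List.ofFn fun i => g i q) (y q) (x q) (ξ q)) p

/-- The composition `A(g₁, ..., gⱼ) ∘ B(gⱼ₊₁, ..., gₖ)`. -/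
def comp (Γ : LieGroupoid dM dG M G) {E E' E'' : GradedBundle M} (A : Operations G E' E'')
    (B : Operations G E E') (j : ℕ) (l : List G) (y x : M) : E.Fiber x →ₗ[ℝ] E''.Fiber y :=
  A (l.take j) y (Γ.vertex y l j) ∘ₗ B (l.drop j) (Γ.vertex y l j) x

/-- The sum `∑_{j=1}^{k-1} (-1)^j A(g₁, ..., gⱼ gⱼ₊₁, ..., gₖ)`. -/
def mergeSum (Γ : LieGroupoid dM dG M G) {E E' : GradedBundle M} (A : Operations G E E')
    (l : List G) (y x : M) : E.Fiber x →ₗ[ℝ] E'.Fiber y :=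
  ∑ j ∈ Finset.Ico 1 l.length, ((-1 : ℝ) ^ j) • A (Γ.merge j l) y x

end Operations

/-- `(E, Rₖ)`, `k ≥ 0`, is a representation up to homotopy of the Lie groupoid `Γ`. The operation
`R₀` is the differential `∂` of `E`. -/
structure IsRepUpToHomotopy (Γ : LieGroupoid dM dG M G) (E : GradedBundle M) (R : Operations G E E) :
    Prop where
  isVectorBundle : E.IsVectorBundle (d := dM)
  hasDegree : R.HasDegree Γ 1
  isSmooth : R.IsSmooth Γ
  equation : ∀ (l : List G) (y x : M), Γ.IsString l y x →
    R.mergeSum Γ l y x =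
      ∑ j ∈ Finset.range (l.length + 1), ((-1 : ℝ) ^ j) • Operations.comp Γ R R j l y x

/-- `Φ` is a morphism of representations up to homotopy from `(E, R)` to `(E', R')`. -/
structure IsMorphism (Γ : LieGroupoid dM dG M G) {E E' : GradedBundle M} (R : Operations G E E)
    (R' : Operations G E' E') (Φ : Operations G E E') : Prop where
  hasDegree : Φ.HasDegree Γ 0
  isSmooth : Φ.IsSmooth Γ
  equation : ∀ (l : List G) (y x : M), Γ.IsString l y x →
    ∑ j ∈ Finset.range (l.length + 1), ((-1 : ℝ) ^ j) • Operations.comp Γ Φ R j l y x =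
      ∑ j ∈ Finset.range (l.length + 1), Operations.comp Γ R' Φ j l y x + Φ.mergeSum Γ l y x

/-- `(E, R)` and `(E, R')` are strongly isomorphic: the differentials agree and there is a morphism
`Φ` with `Φ₀ = Id`. -/
def StronglyIsomorphic (Γ : LieGroupoid dM dG M G) {E : GradedBundle M} (R R' : Operations G E E) : Prop :=
  (∀ x, R [] x x = R' [] x x) ∧
    ∃ Φ : Operations G E E, IsMorphism Γ R R' Φ ∧ ∀ x, Φ [] x x = LinearMap.id

/-! ## Tensor products and symmetric powers of representations up to homotopy -/

/-- Auxiliary recursion for `wordOperation`: `acc` contains the arguments of the operation for the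
tree that is being read, except for the last one, which is (so far) `p`. -/
def wordOperationAux (Γ : LieGroupoid dM dG M G) {E : GradedBundle M} (R : Operations G E E) :
    List Letter → List G → G → List G → (y x : M) → E.Fiber x →ₗ[ℝ] E.Fiber y
  | [], acc, p, _, y, x => R (acc ++ [p]) y x
  | Letter.a :: w, acc, p, g :: l, y, x => wordOperationAux Γ R w acc (Γ.mul p g) l y x
  | Letter.b :: w, acc, p, g :: l, y, x => wordOperationAux Γ R w (acc ++ [p]) g l y x
  | Letter.c :: w, acc, p, g :: l, y, x =>
      R (acc ++ [p]) y (Γ.src p) ∘ₗ wordOperationAux Γ R w [] g l (Γ.src p) x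
  | _, _, _, [], _, _ => 0

/-- The characteristic map of `(E, R)`, `k_E : Ω → A_E`: the operation `k_E(w)(g₁, ..., gₖ)` of a
word `w` of length `k - 1`. The leaves of the forest are labelled by `g₁, ..., gₖ`; the labels on a
branch are multiplied, a tree with `n` branches is the operation `Rₙ` applied to them, and the
operations of the trees are composed. For instance `b a c c` gives
`R₂(g₁, g₂ g₃) ∘ R₁(g₄) ∘ R₁(g₅)`. -/
def wordOperation (Γ : LieGroupoid dM dG M G) {E : GradedBundle M} (R : Operations G E E)
    (w : List Letter) : Operations G E E
  | [], _, _ => 0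
  | g :: l, y, x => wordOperationAux Γ R w [] g l y x

/-- The operation `k_{E₁}(w₁) ⊗ ... ⊗ k_{Eₘ}(wₘ)` of a basis tensor `w₁ ⊠ ... ⊠ wₘ`. The tensor
product of graded maps has the Koszul sign
`(φ₁ ⊗ ... ⊗ φₘ)(v₁ ⊗ ... ⊗ vₘ) = ∏_{i < j} (-1)^{|φⱼ| |vᵢ|} φ₁(v₁) ⊗ ... ⊗ φₘ(vₘ)`. -/
def tensorWordOperation (Γ : LieGroupoid dM dG M G) {m : ℕ} {E : Fin m → GradedBundle M}
    (R : ∀ i, Operations G (E i) (E i)) (W : Word m) :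
    Operations G (GradedBundle.tensor (d := dM) E) (GradedBundle.tensor (d := dM) E) :=
  fun l y x => PiTensorProduct.map fun i =>
    wordOperation Γ (R i) (W.factor i) l y x ∘ₗ
      (((E i).parity x) ^ (∑ j ∈ Finset.univ.filter (fun j => i < j), W.bCount j))

/-- The differential of the tensor product of complexes,
`∂(v₁ ⊗ ... ⊗ vₘ) = ∑ᵢ (-1)^{|v₁| + ... + |vᵢ₋₁|} v₁ ⊗ ... ⊗ ∂ vᵢ ⊗ ... ⊗ vₘ`. -/
def tensorDifferential {m : ℕ} {E : Fin m → GradedBundle M}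
    (R : ∀ i, Operations G (E i) (E i)) (x : M) :
    (GradedBundle.tensor (d := dM) E).Fiber x →ₗ[ℝ] (GradedBundle.tensor (d := dM) E).Fiber x :=
  ∑ i : Fin m, PiTensorProduct.map fun j =>
    if j < i then (E j).parity x else if j = i then R j [] x x else LinearMap.id

/-- The tensor product `⊗_η(E₁, ..., Eₘ)` of representations up to homotopy: the complex
`E₁ ⊗ ... ⊗ Eₘ` with the operations `Rₖ = (k_{E₁} ⊗ ... ⊗ k_{Eₘ})(ηₖ)`, `k ≥ 1`. -/
def tensorOperations (Γ : LieGroupoid dM dG M G) {m : ℕ} (η : Completion m) {E : Fin m → GradedBundle M}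
    (R : ∀ i, Operations G (E i) (E i)) :
    Operations G (GradedBundle.tensor (d := dM) E) (GradedBundle.tensor (d := dM) E)
  | [], y, x => (GradedBundle.tensor (d := dM) E).diagonal (tensorDifferential R) y x
  | g :: l, y, x =>
      (η (l.length + 1)).sum fun W r => r • tensorWordOperation Γ R W (g :: l) y x

/-- The operation `A` on `E ⊗ ... ⊗ E` is compatible with the relations of the symmetric power. -/
def Descends {m : ℕ} {E : GradedBundle M}
    (A : Operations G (GradedBundle.tensor (d := dM) fun _ : Fin m => E)
      (GradedBundle.tensor (d := dM) fun _ : Fin m => E)) (l : List G) (y x : M) : Prop :=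
  E.symRelations m x ≤ (E.symRelations m y).comap (A l y x)

/-- The operations on `SᵐE` induced by operations on `E ⊗ ... ⊗ E` that descend to the quotient. -/
def symOperations {m : ℕ} {E : GradedBundle M}
    (A : Operations G (GradedBundle.tensor (d := dM) fun _ : Fin m => E)
      (GradedBundle.tensor (d := dM) fun _ : Fin m => E)) :
    Operations G (E.sym (d := dM) m) (E.sym (d := dM) m) :=
  fun l y x => open scoped Classical in
    if h : Descends A l y x then (E.symRelations m x).mapQ (E.symRelations m y) (A l y x) h else 0

end Representations

end RuthTensor

end

open RuthTensor
open scoped Manifold ContDiff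

open scoped Manifold ContDiff TensorProduct Topology

set_option linter.unusedSectionVars false

noncomputable section

namespace RuthTensor

/-! ## Signs -/

/-- The character `n ↦ (-1)^n` of `ℤ/2`. -/
def signChar (a : ZMod 2) : ℝ := if a = 0 then 1 else -1

theorem signChar_zero : signChar 0 = 1 := by simp [signChar]

theorem signChar_one : signChar 1 = -1 := by simp [signChar]

theorem signChar_add (a b : ZMod 2) : signChar (a + b) = signChar a * signChar b := by
  have h2 : (1 + 1 : ZMod 2) = 0 := by decide
  have h : ∀ a : ZMod 2, a = 0 ∨ a = 1 := by decide
  rcases h a with rfl | rfl <;> rcases h b with rfl | rfl <;> simp [signChar, h2]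

theorem signChar_mul_self (a : ZMod 2) : signChar a * signChar a = 1 := by
  have h : ∀ a : ZMod 2, a = 0 ∨ a = 1 := by decide
  rcases h a with rfl | rfl <;> simp [signChar]

theorem neg_one_pow_eq_signChar (n : ℕ) : (-1 : ℝ) ^ n = signChar n := by
  induction n with
  | zero => simp [signChar]
  | succ n ih => rw [pow_succ, ih, Nat.cast_succ, signChar_add, signChar_one]

theorem neg_one_zpow_eq_signChar (n : ℤ) : (-1 : ℝ) ^ n = signChar n := by
  rcases Int.even_or_odd n with h | h
  · rw [h.neg_one_zpow, (ZMod.intCast_zmod_eq_zero_iff_dvd n 2).2 (by exact_mod_cast h.two_dvd), signChar_zero]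
  · obtain ⟨k, rfl⟩ := h
    have : ((2 * k + 1 : ℤ) : ZMod 2) = 1 := by
      push_cast
      rw [show (2 : ZMod 2) = 0 by decide]; simp
    rw [this, signChar_one, Odd.neg_one_zpow ⟨k, rfl⟩]

theorem zmod_two_add_self (a : ZMod 2) : a + a = 0 := by
  revert a; decide

theorem zmod_two_neg (a : ZMod 2) : -a = a := by
  revert a; decide

namespace Word

variable {m : ℕ}

/-- The number of letters `b`, modulo two. -/
def bParity (W : Word m) : ZMod 2 := ∑ i, (W.bCount i : ZMod 2)

theorem cast_degree (W : Word m) : ((W.degree : ℤ) : ZMod 2) = W.bParity := by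
  simp [degree, bParity]

theorem cast_totalDegree (W : Word m) :
    ((W.totalDegree : ℤ) : ZMod 2) = (W.order : ZMod 2) + W.bParity := by
  rw [totalDegree]; push_cast; rw [cast_degree]

@[simp] theorem bCount_nil (i : Fin m) : bCount ([] : Word m) i = 0 := rfl

theorem bCount_cons (q : Fin m → Letter) (W : Word m) (i : Fin m) :
    bCount (q :: W) i = bCount W i + if q i = Letter.b then 1 else 0 := by
  simp [bCount, factor, List.count_cons]

theorem bCount_append (U V : Word m) (i : Fin m) :
    bCount (U ++ V) i = bCount U i + bCount V i := by
  simp [bCount, factor]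

theorem bCount_circ (U V : Word m) (i : Fin m) :
    bCount (U ++ (fun _ => Letter.c) :: V) i = bCount U i + bCount V i := by
  rw [bCount_append, bCount_cons]; simp

theorem order_circ (U V : Word m) :
    order (U ++ (fun _ => Letter.c) :: V) = order U + order V := by
  simp [order]; omega

theorem degree_circ (U V : Word m) :
    degree (U ++ (fun _ => Letter.c) :: V) = degree U + degree V := by
  simp [degree, bCount_circ, Finset.sum_add_distrib]; ring

theorem bParity_circ (U V : Word m) :
    bParity (U ++ (fun _ => Letter.c) :: V) = bParity U + bParity V := by
  simp [bParity, bCount_circ, Finset.sum_add_distrib]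

theorem bCount_faceWord (i : ℕ) (W : Word m) (j : Fin m) :
    bCount (Omega.faceWord i W) j = bCount W j := by
  unfold Omega.faceWord
  induction W generalizing i with
  | nil => cases i <;> simp [bCount_cons]
  | cons q W ih =>
    cases i with
    | zero => simp [bCount_cons]
    | succ i => simp [bCount_cons, ih]

theorem order_faceWord {i : ℕ} {W : Word m} (h : i < W.order) :
    order (Omega.faceWord i W) = W.order + 1 := by
  simp only [order, Omega.faceWord] at *
  rw [List.length_insertIdx_of_le_length (by omega)]

theorem bParity_faceWord (i : ℕ) (W : Word m) :
    bParity (Omega.faceWord i W) = bParity W := by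
  simp [bParity, bCount_faceWord]

theorem degree_faceWord (i : ℕ) (W : Word m) : degree (Omega.faceWord i W) = degree W := by
  simp [degree, bCount_faceWord]

end Word

namespace Omega

variable {m : ℕ}

theorem linearMap_ext {V : Type*} [AddCommGroup V] [Module ℝ V] {f g : Omega m →ₗ[ℝ] V}
    (h : ∀ W, f (Finsupp.single W 1) = g (Finsupp.single W 1)) : f = g :=
  Finsupp.lhom_ext' fun W => LinearMap.ext_ring (h W)

/-- Two linear maps that agree on a set of words agree on its span. -/
theorem eq_of_mem_supported {V : Type*} [AddCommGroup V] [Module ℝ V] {f g : Omega m →ₗ[ℝ] V}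
    {T : Set (Word m)} {x : Omega m} (hx : x ∈ Finsupp.supported ℝ ℝ T)
    (h : ∀ W ∈ T, f (Finsupp.single W 1) = g (Finsupp.single W 1)) : f x = g x := by
  rw [Finsupp.supported_eq_span_single] at hx
  exact LinearMap.eqOn_span (by rintro _ ⟨W, hW, rfl⟩; exact h W hW) hx

/-- A linear map that takes a set of words into a submodule takes its span there. -/
theorem map_mem_of_mem_supported {V : Type*} [AddCommGroup V] [Module ℝ V] {f : Omega m →ₗ[ℝ] V}
    {T : Set (Word m)} {P : Submodule ℝ V} {x : Omega m} (hx : x ∈ Finsupp.supported ℝ ℝ T)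
    (h : ∀ W ∈ T, f (Finsupp.single W 1) ∈ P) : f x ∈ P := by
  rw [Finsupp.supported_eq_span_single] at hx
  have : Submodule.span ℝ ((fun i => Finsupp.single i (1 : ℝ)) '' T) ≤ P.comap f := by
    rw [Submodule.span_le]; rintro _ ⟨W, hW, rfl⟩; exact h W hW
  exact this hx

theorem single_mem_supported {T : Set (Word m)} {W : Word m} (h : W ∈ T) (r : ℝ) :
    Finsupp.single W r ∈ Finsupp.supported ℝ ℝ T :=
  Finsupp.single_mem_supported ℝ r h

/-! ### Operators on a row -/

/-- The diagonal operator with eigenvalues `s W`. -/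
def diag (s : Word m → ℝ) : Omega m →ₗ[ℝ] Omega m :=
  Finsupp.linearCombination ℝ fun W => s W • Finsupp.single W (1 : ℝ)

@[simp] theorem diag_single (s : Word m → ℝ) (W : Word m) :
    diag s (Finsupp.single W 1) = s W • Finsupp.single W (1 : ℝ) := by
  simp [diag]

theorem diag_of_mem_supported {s : Word m → ℝ} {T : Set (Word m)} {x : Omega m} {r : ℝ}
    (hx : x ∈ Finsupp.supported ℝ ℝ T) (h : ∀ W ∈ T, s W = r) : diag s x = r • x :=
  eq_of_mem_supported (g := r • LinearMap.id) hx fun W hW => by simp [h W hW]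

/-- The words obtained from `W` by a change of the letters in row `i` that raises the number of
letters `b` there by `n`. -/
def rowShift (i : Fin m) (n : ℤ) (W : Word m) : Set (Word m) :=
  {W' | W'.length = W.length ∧ (∀ j, j ≠ i → W'.bCount j = W.bCount j) ∧
    (W'.bCount i : ℤ) = W.bCount i + n}

/-- `X` changes the letters of row `i` only and raises the number of letters `b` there by `n`. -/
def ShiftsRow (i : Fin m) (n : ℤ) (X : Omega m →ₗ[ℝ] Omega m) : Prop :=
  ∀ W, X (Finsupp.single W 1) ∈ Finsupp.supported ℝ ℝ (rowShift i n W)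

theorem rowShift_cons {i : Fin m} {n : ℤ} {W W' : Word m} (q : Fin m → Letter)
    (h : W' ∈ rowShift i n W) : q :: W' ∈ rowShift i n (q :: W) := by
  obtain ⟨h1, h2, h3⟩ := h
  refine ⟨by simp [h1], fun j hj => by simp [Word.bCount_cons, h2 j hj], ?_⟩
  simp only [Word.bCount_cons]; push_cast; rw [h3]; ring

theorem sum_bCount_of_mem_rowShift {i : Fin m} {n : ℤ} {W W' : Word m} (h : W' ∈ rowShift i n W)
    (s : Finset (Fin m)) :
    (∑ j ∈ s, (W'.bCount j : ℤ)) = ∑ j ∈ s, (W.bCount j : ℤ) + if i ∈ s then n else 0 := by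
  obtain ⟨-, h2, h3⟩ := h
  rw [← sub_eq_iff_eq_add', ← Finset.sum_sub_distrib]
  rw [← Finset.sum_ite_eq s i fun _ => n]
  refine Finset.sum_congr rfl fun j _ => ?_
  split_ifs with hj
  · subst hj; rw [h3]; ring
  · rw [h2 j (Ne.symm hj)]; ring

theorem sum_bCount_zmod_of_mem_rowShift {i : Fin m} {n : ℤ} {W W' : Word m}
    (h : W' ∈ rowShift i n W) (s : Finset (Fin m)) :
    (∑ j ∈ s, (W'.bCount j : ZMod 2)) =
      ∑ j ∈ s, (W.bCount j : ZMod 2) + if i ∈ s then (n : ZMod 2) else 0 := by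
  have := congrArg (Int.cast : ℤ → ZMod 2) (sum_bCount_of_mem_rowShift h s)
  push_cast at this
  rw [this]

theorem mem_piece_of_mem_rowShift {i : Fin m} {n : ℤ} {W W' : Word m} (h : W' ∈ rowShift i n W) :
    W'.order = W.order ∧ W'.degree = W.degree - n := by
  refine ⟨by simp [Word.order, h.1], ?_⟩
  have := sum_bCount_of_mem_rowShift h Finset.univ
  simp only [Finset.mem_univ, if_true] at this
  simp only [Word.degree, this]; ring

/-- The sign of the letters `b` in the rows before row `i`. -/
def rowSign (i : Fin m) (W : Word m) : ℝ :=
  signChar (∑ j ∈ Finset.univ.filter (fun j => j < i), (W.bCount j : ZMod 2))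

theorem rowSign_mul_self (i : Fin m) (W : Word m) : rowSign i W * rowSign i W = 1 :=
  signChar_mul_self _

theorem rowSign_of_mem_rowShift {i j : Fin m} {n : ℤ} {W W' : Word m} (h : W' ∈ rowShift i n W) :
    rowSign j W' = rowSign j W * if i < j then signChar n else 1 := by
  rw [rowSign, sum_bCount_zmod_of_mem_rowShift h, signChar_add]
  simp only [Finset.mem_filter, Finset.mem_univ, true_and, rowSign]
  split_ifs <;> simp [signChar_zero]

/-- The operator `X` on row `i` with the Koszul sign. -/
def signed (i : Fin m) (X : Omega m →ₗ[ℝ] Omega m) : Omega m →ₗ[ℝ] Omega m := X ∘ₗ diag (rowSign i)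

@[simp] theorem signed_single (i : Fin m) (X : Omega m →ₗ[ℝ] Omega m) (W : Word m) :
    signed i X (Finsupp.single W 1) = rowSign i W • X (Finsupp.single W 1) := by
  rw [signed, LinearMap.comp_apply, diag_single, map_smul]

theorem signed_apply_of_mem_rowShift {i j : Fin m} {n : ℤ} {X : Omega m →ₗ[ℝ] Omega m} {x : Omega m}
    {W : Word m} (hx : x ∈ Finsupp.supported ℝ ℝ (rowShift i n W)) :
    signed j X x = (rowSign j W * if i < j then signChar n else 1) • X x := by
  rw [signed, LinearMap.comp_apply, diag_of_mem_supported hx fun W' hW' =>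
    rowSign_of_mem_rowShift hW', map_smul]

theorem signed_anticomm {i j : Fin m} (hij : i ≠ j) {n n' : ℤ} (hn : (n : ZMod 2) = 1)
    (hn' : (n' : ZMod 2) = 1)
    {X Y : Omega m →ₗ[ℝ] Omega m} (hX : ShiftsRow i n X) (hY : ShiftsRow j n' Y)
    (h : ∀ W, X (Y (Finsupp.single W 1)) = Y (X (Finsupp.single W 1))) (x : Omega m) :
    signed i X (signed j Y x) + signed j Y (signed i X x) = 0 := by
  suffices hh : signed i X ∘ₗ signed j Y + signed j Y ∘ₗ signed i X = 0 from
    LinearMap.congr_fun hh x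
  refine linearMap_ext fun W => ?_
  simp only [LinearMap.add_apply, LinearMap.comp_apply, signed_single, map_smul,
    LinearMap.zero_apply]
  rw [signed_apply_of_mem_rowShift (hX W), signed_apply_of_mem_rowShift (hY W), h, hn, hn',
    smul_smul, smul_smul, ← add_smul, signChar_one]
  rcases lt_or_gt_of_ne hij with h | h
  · rw [if_neg h.not_gt, if_pos h]; ring_nf; simp
  · rw [if_neg h.not_gt, if_pos h]; ring_nf; simp

theorem signed_signed_self {i : Fin m} {n : ℤ}
    {X Y : Omega m →ₗ[ℝ] Omega m} (hX : ShiftsRow i n X) (W : Word m) :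
    signed i Y (signed i X (Finsupp.single W 1)) = Y (X (Finsupp.single W 1)) := by
  rw [signed_single, map_smul, signed_apply_of_mem_rowShift (hX W)]
  simp [smul_smul, rowSign_mul_self]

/-! ### The differential -/

/-- The letter sign: `-1` for `b`, and `1` otherwise. -/
def letterSign (x : Letter) : ℝ := if x = Letter.b then -1 else 1

/-- Concatenation with a column in front. -/
def consMap (q : Fin m → Letter) : Omega m →ₗ[ℝ] Omega m := Finsupp.lmapDomain ℝ ℝ (q :: ·)

@[simp] theorem consMap_single (q : Fin m → Letter) (W : Word m) (r : ℝ) :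
    consMap q (Finsupp.single W r) = Finsupp.single (q :: W) r := by
  simp [consMap]

theorem consMap_mem_supported {q : Fin m → Letter} {i : Fin m} {n : ℤ} {W : Word m} {x : Omega m}
    (hx : x ∈ Finsupp.supported ℝ ℝ (rowShift i n W)) :
    consMap q x ∈ Finsupp.supported ℝ ℝ (rowShift i n (q :: W)) :=
  map_mem_of_mem_supported hx fun W' hW' => by
    rw [consMap_single]; exact single_mem_supported (rowShift_cons q hW') 1

/-- The differential of row `i`, without the sign from the other rows. -/
def delRowWord (i : Fin m) : Word m → Omega m
  | [] => 0
  | q :: W => (if q i = Letter.b then Finsupp.single (Function.update q i Letter.c :: W) 1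
      - Finsupp.single (Function.update q i Letter.a :: W) 1 else 0)
      + letterSign (q i) • consMap q (delRowWord i W)

/-- The differential of row `i`, without the sign from the other rows. -/
def delRow (i : Fin m) : Omega m →ₗ[ℝ] Omega m := Finsupp.linearCombination ℝ (delRowWord i)

@[simp] theorem delRow_single (i : Fin m) (W : Word m) :
    delRow i (Finsupp.single W 1) = delRowWord i W := by simp [delRow]

theorem delRow_cons (i : Fin m) (q : Fin m → Letter) (x : Omega m) :
    delRow i (consMap q x) = (if q i = Letter.b then consMap (Function.update q i Letter.c) x
      - consMap (Function.update q i Letter.a) x else 0) + letterSign (q i) • consMap q (delRow i x) := by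
  let f : Omega m →ₗ[ℝ] Omega m := (if q i = Letter.b then consMap (Function.update q i Letter.c)
      - consMap (Function.update q i Letter.a) else 0) + letterSign (q i) • consMap q ∘ₗ delRow i
  have : delRow i ∘ₗ consMap q = f := linearMap_ext fun W => by
    simp only [LinearMap.comp_apply, consMap_single, delRow_single, delRowWord, f]
    split_ifs <;> simp
  have h := LinearMap.congr_fun this x
  simp only [LinearMap.comp_apply, f] at h
  rw [h]
  split_ifs <;> simp

theorem update_mem_rowShift (i : Fin m) {q : Fin m → Letter} {x : Letter} (W : Word m) (n : ℤ)
    (h : (if x = Letter.b then 1 else 0 : ℤ) = (if q i = Letter.b then 1 else 0) + n) :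
    Function.update q i x :: W ∈ rowShift i n (q :: W) := by
  refine ⟨rfl, fun j hj => by simp [Word.bCount_cons, hj], ?_⟩
  simp only [Word.bCount_cons, Function.update_self]; push_cast; rw [h]; ring

theorem shiftsRow_delRow (i : Fin m) : ShiftsRow i (-1) (delRow i) := by
  intro W
  rw [delRow_single]
  induction W with
  | nil => exact zero_mem _
  | cons q W ih =>
    refine add_mem ?_ (Submodule.smul_mem _ _ (consMap_mem_supported ih))
    split_ifs with h
    · exact sub_mem (single_mem_supported (update_mem_rowShift i W _ (by simp [h])) 1)
        (single_mem_supported (update_mem_rowShift i W _ (by simp [h])) 1)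
    · exact zero_mem _

theorem delWord_eq (W : Word m) : delWord W = ∑ i, rowSign i W • delRowWord i W := by
  have key : ∀ (i : Fin m) (W : Word m), delRowWord i W = ∑ p : Fin W.length,
      if W.get p i = Letter.b then ((-1 : ℝ) ^ Word.bCount (W.take p) i) •
        (Finsupp.single (W.set p (Function.update (W.get p) i Letter.c)) (1 : ℝ)
          - Finsupp.single (W.set p (Function.update (W.get p) i Letter.a)) (1 : ℝ))
      else 0 := by
    intro i W
    induction W with
    | nil => simp [delRowWord]
    | cons q W ih =>
      rw [delRowWord, ih]
      change _ = ∑ p : Fin (W.length + 1), _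
      rw [Fin.sum_univ_succ]
      congr 1
      · change _ = if q i = Letter.b then _ else _
        simp
      · rw [map_sum, Finset.smul_sum]
        refine Finset.sum_congr rfl fun p _ => ?_
        have e1 : (q :: W).get p.succ = W.get p := rfl
        have e2 : ∀ x, (q :: W).set (p.succ : Fin _) x = q :: W.set p x := fun x => rfl
        have e3 : (q :: W).take (p.succ : Fin _) = q :: W.take p := rfl
        rw [e1, e2, e2, e3]
        split_ifs with h
        · rw [map_smul, map_sub, consMap_single, consMap_single, smul_smul, Word.bCount_cons,
            letterSign]
          congr 1
          split_ifs <;> simp [pow_succ]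
        · simp
  rw [delWord]
  refine Finset.sum_congr rfl fun i _ => ?_
  rw [key, Finset.smul_sum]
  refine Finset.sum_congr rfl fun p _ => ?_
  split_ifs with h
  · rw [smul_smul, pow_add, rowSign, ← Nat.cast_sum, ← neg_one_pow_eq_signChar]
  · simp

theorem del_eq : (del : Omega m →ₗ[ℝ] Omega m) = ∑ i, signed i (delRow i) :=
  linearMap_ext fun W => by
    simp [del, delWord_eq]

@[simp] theorem del_single (W : Word m) : del (Finsupp.single W 1) = delWord W := by simp [del]

theorem delRow_delRow_self (i : Fin m) (x : Omega m) : delRow i (delRow i x) = 0 := by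
  suffices h : delRow i ∘ₗ delRow i = 0 from LinearMap.congr_fun h x
  refine linearMap_ext fun W => ?_
  simp only [LinearMap.comp_apply, delRow_single, LinearMap.zero_apply]
  induction W with
  | nil => simp [delRowWord]
  | cons q W ih =>
    simp only [delRowWord, map_add, map_smul, delRow_cons, ih, map_zero]
    split_ifs with h
    · simp only [map_sub, delRow_single, delRowWord, letterSign]
      simp [h]
    · simp

theorem consMap_update_comm_aux {i j : Fin m} (hij : i ≠ j) (q : Fin m → Letter) (x : Omega m) :
    (if q j = Letter.b then delRow i (consMap (Function.update q j Letter.c) x)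
      - delRow i (consMap (Function.update q j Letter.a) x) else 0)
      + letterSign (q j) • delRow i (consMap q (delRow j x)) =
    (if q i = Letter.b then delRow j (consMap (Function.update q i Letter.c) x)
      - delRow j (consMap (Function.update q i Letter.a) x) else 0)
      + letterSign (q i) • delRow j (consMap q (delRow i x)) +
      (letterSign (q j) * letterSign (q i)) •
        (consMap q (delRow i (delRow j x)) - consMap q (delRow j (delRow i x))) := by
  simp only [delRow_cons, Function.update_of_ne hij, Function.update_of_ne hij.symm]
  rw [Function.update_comm hij, Function.update_comm hij, Function.update_comm hij,
    Function.update_comm hij]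
  by_cases hi : q i = Letter.b <;> by_cases hj : q j = Letter.b <;> simp [hi, hj, letterSign] <;> abel

theorem delRow_comm {i j : Fin m} (hij : i ≠ j) (x : Omega m) :
    delRow i (delRow j x) = delRow j (delRow i x) := by
  suffices h : delRow i ∘ₗ delRow j = delRow j ∘ₗ delRow i from LinearMap.congr_fun h x
  refine linearMap_ext fun W => ?_
  simp only [LinearMap.comp_apply]
  induction W with
  | nil => simp [delRowWord]
  | cons q W ih =>
    have := consMap_update_comm_aux hij q (Finsupp.single W 1)
    rw [ih, sub_self, smul_zero, add_zero] at this
    have e : ∀ k : Fin m, delRow k (Finsupp.single (q :: W) 1) =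
      (if q k = Letter.b then consMap (Function.update q k Letter.c) (Finsupp.single W 1)
      - consMap (Function.update q k Letter.a) (Finsupp.single W 1) else 0) +
        letterSign (q k) • consMap q (delRow k (Finsupp.single W 1)) := fun k => by
      rw [← consMap_single, delRow_cons]
    rw [e, e, map_add, map_add, map_smul, map_smul]
    simpa only [apply_ite (delRow i), apply_ite (delRow j), map_sub, map_zero] using this

theorem sum_sum_eq_zero_of_anticomm {ι V : Type*} [Fintype ι] [AddCommGroup V] [Module ℝ V]
    (a : ι → ι → V) (h : ∀ i j, a i j + a j i = 0) : ∑ i, ∑ j, a i j = 0 := by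
  have h1 : ∑ i, ∑ j, a i j + ∑ i, ∑ j, a i j = 0 := by
    nth_rewrite 2 [Finset.sum_comm]
    simp only [← Finset.sum_add_distrib, h, Finset.sum_const_zero]
  rw [← two_smul ℝ] at h1
  exact (smul_eq_zero.1 h1).resolve_left (by norm_num)

theorem del_del (x : Omega m) : del (del x) = 0 := by
  rw [del_eq]
  simp only [LinearMap.sum_apply, map_sum]
  refine sum_sum_eq_zero_of_anticomm _ fun i j => ?_
  by_cases hij : i = j
  · subst hij
    have : signed i (delRow i) ∘ₗ signed i (delRow i) = 0 := linearMap_ext fun W => by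
      rw [LinearMap.comp_apply, signed_signed_self (shiftsRow_delRow i), delRow_delRow_self]; rfl
    have := LinearMap.congr_fun this x
    simp only [LinearMap.comp_apply, LinearMap.zero_apply] at this
    rw [this, add_zero]
  · exact signed_anticomm (Ne.symm hij) (by decide) (by decide) (shiftsRow_delRow j) (shiftsRow_delRow i)
      (fun W => delRow_comm (Ne.symm hij) _) x

end Omega
end RuthTensor

namespace RuthTensor

/-! ## Bilinear forms modulo two that control Koszul signs -/

section Pairing

variable {m : ℕ}

/-- The bilinear form `∑ uᵢ vⱼ` over the pairs `(i, j)` with `c i j`. -/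
def pairing (c : Fin m → Fin m → Prop) [∀ i j, Decidable (c i j)] (u v : Fin m → ZMod 2) : ZMod 2 :=
  ∑ i, ∑ j, if c i j then u i * v j else 0

variable (c : Fin m → Fin m → Prop) [∀ i j, Decidable (c i j)]

theorem pairing_add_left (u u' v : Fin m → ZMod 2) :
    pairing c (u + u') v = pairing c u v + pairing c u' v := by
  simp only [pairing, ← Finset.sum_add_distrib]
  refine Finset.sum_congr rfl fun i _ => Finset.sum_congr rfl fun j _ => ?_
  split_ifs <;> simp [add_mul]

theorem pairing_add_right (u v v' : Fin m → ZMod 2) :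
    pairing c u (v + v') = pairing c u v + pairing c u v' := by
  simp only [pairing, ← Finset.sum_add_distrib]
  refine Finset.sum_congr rfl fun i _ => Finset.sum_congr rfl fun j _ => ?_
  split_ifs <;> simp [mul_add]

theorem pairing_single_left (i : Fin m) (n : ZMod 2) (v : Fin m → ZMod 2) :
    pairing c (Pi.single i n) v = ∑ j, if c i j then n * v j else 0 := by
  rw [pairing, Finset.sum_eq_single i]
  · simp
  · intro k _ hk; simp [hk]
  · simp

theorem pairing_single_right (i : Fin m) (n : ZMod 2) (u : Fin m → ZMod 2) :
    pairing c u (Pi.single i n) = ∑ j, if c j i then n * u j else 0 := by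
  rw [pairing]
  refine Finset.sum_congr rfl fun k _ => ?_
  rw [Finset.sum_eq_single i]
  · simp [mul_comm]
  · intro j _ hj; simp [hj]
  · simp

end Pairing

namespace Word

variable {m : ℕ}

/-- The numbers of letters `b` of the factors, modulo two. -/
def parities (W : Word m) (i : Fin m) : ZMod 2 := W.bCount i

theorem parities_circ (U V : Word m) :
    parities (U ++ (fun _ => Letter.c) :: V) = parities U + parities V := by
  funext i; simp [parities, bCount_circ]

theorem parities_faceWord (i : ℕ) (W : Word m) :
    parities (Omega.faceWord i W) = parities W := by
  funext j; simp [parities, bCount_faceWord]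

theorem bParity_eq (W : Word m) : bParity W = ∑ i, parities W i := rfl

end Word

namespace Omega

variable {m : ℕ}

theorem parities_of_mem_rowShift {i : Fin m} {n : ℤ} {W W' : Word m} (h : W' ∈ rowShift i n W) :
    W'.parities = W.parities + Pi.single i (n : ZMod 2) := by
  funext j
  by_cases hj : j = i
  · subst hj
    have := congrArg (Int.cast : ℤ → ZMod 2) h.2.2
    push_cast at this
    simp [Word.parities, this]
  · simp [Word.parities, h.2.1 j hj, hj]

theorem rowSign_eq (i : Fin m) (W : Word m) :
    rowSign i W = signChar (∑ j, if j < i then W.parities j else 0) := by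
  rw [rowSign, Finset.sum_filter]; rfl

theorem koszulSign_eq (U V : Word m) :
    koszulSign U V = signChar (pairing (fun i j => j < i) U.parities V.parities) := by
  rw [koszulSign, neg_one_pow_eq_signChar, pairing]
  push_cast
  simp only [Finset.sum_filter]; rfl

theorem bParity_of_mem_rowShift {i : Fin m} {n : ℤ} {W W' : Word m} (h : W' ∈ rowShift i n W) :
    W'.bParity = W.bParity + n := by
  rw [Word.bParity_eq, parities_of_mem_rowShift h]
  simp [Finset.sum_add_distrib, Word.bParity_eq]

/-! ## The product -/

theorem star_single_single (U V : Word m) :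
    star (Finsupp.single U 1) (Finsupp.single V 1) =
      signChar (U.order * (V.order + V.bParity) +
        pairing (fun i j => j < i) U.parities V.parities) •
        Finsupp.single (U ++ (fun _ => Letter.c) :: V) (1 : ℝ) := by
  rw [star, Finsupp.linearCombination_single, one_smul, Finsupp.linearCombination_single, one_smul,
    neg_one_zpow_eq_signChar, circWord, koszulSign_eq, Finsupp.smul_single, Finsupp.smul_single,
    signChar_add]
  push_cast
  rw [Word.cast_totalDegree]; simp

theorem bilin_ext {V : Type*} [AddCommGroup V] [Module ℝ V] {f g : Omega m →ₗ[ℝ] Omega m →ₗ[ℝ] V}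
    (h : ∀ U W, f (Finsupp.single U 1) (Finsupp.single W 1)
      = g (Finsupp.single U 1) (Finsupp.single W 1)) : f = g :=
  linearMap_ext fun U => linearMap_ext fun W => h U W

theorem star_assoc (x y z : Omega m) : star (star x y) z = star x (star y z) := by
  suffices h : ∀ (z : Omega m), LinearMap.compr₂ star (star.flip z) = star.compl₂ (star.flip z) by
    simpa using LinearMap.congr_fun (LinearMap.congr_fun (h z) x) y
  intro z
  refine bilin_ext fun U V => ?_
  simp only [LinearMap.compr₂_apply, LinearMap.compl₂_apply, LinearMap.flip_apply]
  suffices h : star (star (Finsupp.single U 1) (Finsupp.single V 1)) =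
      star (Finsupp.single U 1) ∘ₗ star (Finsupp.single V 1) from LinearMap.congr_fun h z
  refine linearMap_ext fun W => ?_
  rw [LinearMap.comp_apply]
  rw [star_single_single, star_single_single, map_smul, map_smul, LinearMap.smul_apply,
    star_single_single, star_single_single, smul_smul, smul_smul, ← signChar_add, ← signChar_add,
    Word.parities_circ, Word.parities_circ, pairing_add_left, pairing_add_right, Word.order_circ,
    Word.order_circ, Word.bParity_circ, List.append_assoc, List.cons_append]
  congr 2
  push_cast
  ring

/-- The product with a fixed word on the right, without sign. -/
def appMap (V : Word m) : Omega m →ₗ[ℝ] Omega m := Finsupp.lmapDomain ℝ ℝ (· ++ V)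

/-- The product with a fixed word on the left, without sign. -/
def preMap (U : Word m) : Omega m →ₗ[ℝ] Omega m := Finsupp.lmapDomain ℝ ℝ (U ++ ·)

@[simp] theorem appMap_single (U V : Word m) (r : ℝ) :
    appMap V (Finsupp.single U r) = Finsupp.single (U ++ V) r := by simp [appMap]

@[simp] theorem preMap_single (U V : Word m) (r : ℝ) :
    preMap U (Finsupp.single V r) = Finsupp.single (U ++ V) r := by simp [preMap]

theorem delRowWord_append (i : Fin m) (U V : Word m) :
    delRowWord i (U ++ V) = appMap V (delRowWord i U) +
      signChar (U.parities i) • preMap U (delRowWord i V) := by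
  induction U with
  | nil =>
    have : preMap ([] : Word m) = LinearMap.id := linearMap_ext fun W => by simp
    simp [delRowWord, Word.parities, signChar_zero, this]
  | cons q U ih =>
    have e1 : ∀ x, consMap q (appMap V x) = appMap V (consMap q x) := fun x =>
      LinearMap.congr_fun (linearMap_ext (f := consMap q ∘ₗ appMap V) (g := appMap V ∘ₗ consMap q)
        fun W => by simp) x
    have e2 : ∀ x, consMap q (preMap U x) = preMap (q :: U) x := fun x =>
      LinearMap.congr_fun (linearMap_ext (f := consMap q ∘ₗ preMap U) (g := preMap (q :: U))
        fun W => by simp) x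
    rw [List.cons_append, delRowWord, delRowWord, ih, map_add, map_add, map_smul, map_smul, e1, e2,
      smul_add, smul_smul, ← add_assoc]
    have e3 : signChar (Word.parities (q :: U) i) = letterSign (q i) * signChar (Word.parities U i) := by
      rw [Word.parities, Word.bCount_cons, Nat.cast_add, signChar_add, Word.parities, mul_comm]
      split_ifs with h <;> simp [letterSign, h, signChar_zero, signChar_one]
    rw [e3]
    congr 2
    split_ifs with h <;> simp

theorem star_of_mem_rowShift_left {i : Fin m} {n : ℤ} {U : Word m} {x : Omega m} (V : Word m)
    (hx : x ∈ Finsupp.supported ℝ ℝ (rowShift i n U)) :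
    star x (Finsupp.single V 1) = signChar (U.order * (V.order + V.bParity) +
        pairing (fun i j => j < i) U.parities V.parities +
        ∑ j, if j < i then n * V.parities j else 0) • appMap ((fun _ => Letter.c) :: V) x := by
  refine eq_of_mem_supported (f := star.flip (Finsupp.single V 1))
    (g := signChar _ • appMap ((fun _ => Letter.c) :: V)) hx fun W hW => ?_
  rw [LinearMap.flip_apply, star_single_single, LinearMap.smul_apply, appMap_single,
    parities_of_mem_rowShift hW, pairing_add_left, pairing_single_left,
    (mem_piece_of_mem_rowShift hW).1, add_assoc]

theorem star_of_mem_rowShift_right {i : Fin m} {n : ℤ} {V : Word m} {x : Omega m} (U : Word m)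
    (hx : x ∈ Finsupp.supported ℝ ℝ (rowShift i n V)) :
    star (Finsupp.single U 1) x = signChar (U.order * (V.order + V.bParity + n) +
        pairing (fun i j => j < i) U.parities V.parities +
        ∑ j, if i < j then n * U.parities j else 0) •
          preMap U (consMap (fun _ => Letter.c) x) := by
  refine eq_of_mem_supported (f := star (Finsupp.single U 1))
    (g := signChar _ • preMap U ∘ₗ consMap (fun _ => Letter.c)) hx fun W hW => ?_
  rw [star_single_single, LinearMap.smul_apply, LinearMap.comp_apply, consMap_single, preMap_single,
    parities_of_mem_rowShift hW, pairing_add_right, pairing_single_right,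
    (mem_piece_of_mem_rowShift hW).1, bParity_of_mem_rowShift hW, add_assoc, add_assoc]

/-- The sign operator of the total degree. -/
def degreeSign : Omega m →ₗ[ℝ] Omega m := diag fun W => signChar (W.order + W.bParity)

@[simp] theorem degreeSign_single (W : Word m) : degreeSign (Finsupp.single W 1) =
    signChar (W.order + W.bParity) • Finsupp.single W (1 : ℝ) := diag_single _ _

theorem del_star (x y : Omega m) :
    del (star x y) = star (del x) y + star (degreeSign x) (del y) := by
  suffices h : LinearMap.compr₂ star del = star ∘ₗ del + (star ∘ₗ degreeSign).compl₂ del by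
    simpa using LinearMap.congr_fun (LinearMap.congr_fun h x) y
  refine bilin_ext fun U V => ?_
  simp only [LinearMap.compr₂_apply, LinearMap.add_apply, LinearMap.comp_apply, LinearMap.compl₂_apply,
    degreeSign_single, map_smul, LinearMap.smul_apply]
  rw [star_single_single, map_smul, del_eq]
  simp only [LinearMap.sum_apply, map_sum, signed_single, map_smul, LinearMap.smul_apply,
    delRow_single, Finset.smul_sum]
  rw [← Finset.sum_add_distrib]
  refine Finset.sum_congr rfl fun i _ => ?_
  have hU := shiftsRow_delRow i U
  have hV := shiftsRow_delRow i V
  rw [delRow_single] at hU hV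
  have hc : delRowWord i ((fun _ => Letter.c) :: V) = consMap (fun _ => Letter.c) (delRowWord i V) := by
    simp [delRowWord, letterSign]
  rw [star_of_mem_rowShift_left V hU, star_of_mem_rowShift_right U hV, delRowWord_append, hc, smul_add,
    smul_add, rowSign_eq, rowSign_eq, rowSign_eq, Word.parities_circ]
  simp only [smul_smul, ← signChar_add]
  have split : U.bParity = (∑ j, if j < i then U.parities j else 0) + U.parities i +
      ∑ j, if i < j then U.parities j else 0 := by
    have : U.parities i = ∑ j, if j = i then U.parities j else 0 := by simp
    rw [Word.bParity_eq, this, ← Finset.sum_add_distrib, ← Finset.sum_add_distrib]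
    refine Finset.sum_congr rfl fun j _ => ?_
    rcases lt_trichotomy j i with h | h | h
    · simp [h, h.ne, h.not_gt]
    · simp [h]
    · simp [h, h.ne', h.not_gt]
  have hs : ∀ u v : Fin m → ZMod 2, (∑ j, if j < i then (u + v) j else 0) =
      (∑ j, if j < i then u j else 0) + ∑ j, if j < i then v j else 0 := fun u v => by
    rw [← Finset.sum_add_distrib]
    refine Finset.sum_congr rfl fun j _ => ?_
    split_ifs <;> simp
  have hn : (((-1 : ℤ)) : ZMod 2) = 1 := by decide
  rw [hs, hn, split]
  simp only [one_mul]
  generalize (∑ j, if j < i then U.parities j else 0) = a1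
  generalize (∑ j, if i < j then U.parities j else 0) = a2
  generalize (∑ j, if j < i then V.parities j else 0) = a3
  generalize pairing (fun i j => j < i) U.parities V.parities = a4
  generalize (U.order : ZMod 2) = a5
  generalize (V.order : ZMod 2) + V.bParity = a6
  generalize U.parities i = a7
  congr 3
  · ring
  · revert a1 a2 a3 a4 a5 a6 a7; decide

/-! ## The face operators -/

/-- The operator `d_{i+1}`. -/
def face (i : ℕ) : Omega m →ₗ[ℝ] Omega m := Finsupp.lmapDomain ℝ ℝ (faceWord i)

@[simp] theorem face_single (i : ℕ) (W : Word m) (r : ℝ) :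
    face i (Finsupp.single W r) = Finsupp.single (faceWord i W) r := by simp [face]

theorem face_consMap (i : ℕ) (q : Fin m → Letter) (x : Omega m) :
    face (i + 1) (consMap q x) = consMap q (face i x) :=
  LinearMap.congr_fun (linearMap_ext (f := face (i + 1) ∘ₗ consMap q) (g := consMap q ∘ₗ face i)
    fun W => by simp [faceWord]) x

theorem face_zero (x : Omega m) : face 0 x = consMap (fun _ => Letter.a) x :=
  LinearMap.congr_fun (linearMap_ext (f := face 0) (g := consMap (fun _ => Letter.a))
    fun W => by simp [faceWord]) x

theorem delRowWord_faceWord (i : Fin m) {p : ℕ} {W : Word m} (hp : p ≤ W.length) :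
    delRowWord i (faceWord p W) = face p (delRowWord i W) := by
  induction p generalizing W with
  | zero =>
    rw [face_zero]
    simp [faceWord, delRowWord, letterSign]
  | succ p ih =>
    cases W with
    | nil => simp at hp
    | cons q W =>
      have ih := ih (W := W) (by simpa using hp)
      have e : faceWord (p + 1) (q :: W) = q :: faceWord p W := by simp [faceWord]
      rw [e, delRowWord, ih, delRowWord, map_add, map_smul, face_consMap]
      congr 1
      split_ifs <;> simp [faceWord]

theorem signedFace_single (W : Word m) : signedFace (Finsupp.single W 1) =
    ∑ i ∈ Finset.range W.order,
      signChar (W.order + W.bParity + i + 1) • Finsupp.single (faceWord i W) (1 : ℝ) := by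
  rw [signedFace, Finsupp.linearCombination_single, one_smul, Finset.smul_sum]
  refine Finset.sum_congr rfl fun i _ => ?_
  rw [neg_one_zpow_eq_signChar, Word.cast_totalDegree, neg_one_pow_eq_signChar, Finsupp.smul_single,
    Finsupp.smul_single, smul_eq_mul, ← signChar_add]
  push_cast
  simp [add_assoc]

theorem signedFace_of_mem_rowShift {i : Fin m} {n : ℤ} {W : Word m} {x : Omega m}
    (hx : x ∈ Finsupp.supported ℝ ℝ (rowShift i n W)) : signedFace x =
    ∑ p ∈ Finset.range W.order, signChar (W.order + W.bParity + p + 1 + n) • face p x := by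
  refine (eq_of_mem_supported (f := signedFace) (g := ∑ p ∈ Finset.range W.order,
    signChar (W.order + W.bParity + p + 1 + n) • face p) hx fun W' hW' => ?_).trans (by simp)
  rw [signedFace_single, (mem_piece_of_mem_rowShift hW').1, LinearMap.sum_apply]
  refine Finset.sum_congr rfl fun p _ => ?_
  rw [LinearMap.smul_apply, face_single, bParity_of_mem_rowShift hW']
  congr 2; ring

theorem del_signedFace (x : Omega m) : del (signedFace x) + signedFace (del x) = 0 := by
  suffices h : del ∘ₗ signedFace + signedFace ∘ₗ del = (0 : Omega m →ₗ[ℝ] Omega m) from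
    LinearMap.congr_fun h x
  refine linearMap_ext fun W => ?_
  simp only [LinearMap.add_apply, LinearMap.comp_apply, LinearMap.zero_apply]
  rw [signedFace_single, map_sum, del_eq]
  simp only [LinearMap.sum_apply, map_sum, signed_single, map_smul]
  simp only [Finset.smul_sum]
  rw [Finset.sum_comm, ← Finset.sum_add_distrib]
  refine Finset.sum_eq_zero fun i _ => ?_
  rw [signedFace_of_mem_rowShift (shiftsRow_delRow i W), Finset.smul_sum, ← Finset.sum_add_distrib]
  refine Finset.sum_eq_zero fun p hp => ?_
  have hp' : p ≤ W.length := by simpa [Word.order, Nat.lt_succ_iff] using hp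
  rw [delRow_single, delRow_single, delRowWord_faceWord i hp', rowSign_eq, rowSign_eq,
    Word.parities_faceWord, smul_smul, smul_smul, ← add_smul, ← signChar_add, ← signChar_add]
  have hn : (((-1 : ℤ)) : ZMod 2) = 1 := by decide
  rw [hn, add_comm (∑ j, _) (_ + 1), add_right_comm _ (1 : ZMod 2), signChar_add _ 1, signChar_one]
  rw [mul_neg_one, add_assoc (_ + _) (1 : ZMod 2) 1, zmod_two_add_self, add_zero, neg_add_cancel,
    zero_smul]

theorem faceWord_faceWord {i j : ℕ} {W : Word m} (hij : i ≤ j) (hj : j ≤ W.length) :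
    faceWord (j + 1) (faceWord i W) = faceWord i (faceWord j W) := by
  unfold faceWord
  induction i generalizing j W with
  | zero => simp
  | succ i ih =>
    cases j with
    | zero => omega
    | succ j =>
      cases W with
      | nil => simp at hj
      | cons q W => simp [ih (W := W) (j := j) (by omega) (by simpa using hj)]

theorem signedFace_signedFace (x : Omega m) : signedFace (signedFace x) = 0 := by
  suffices h : signedFace ∘ₗ signedFace = (0 : Omega m →ₗ[ℝ] Omega m) from LinearMap.congr_fun h x
  refine linearMap_ext fun W => ?_
  simp only [LinearMap.comp_apply, LinearMap.zero_apply]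
  rw [signedFace_single, map_sum]
  have e : ∀ i ∈ Finset.range W.order, signedFace (signChar (W.order + W.bParity + i + 1) •
      Finsupp.single (faceWord i W) (1 : ℝ)) = ∑ j ∈ Finset.range (W.order + 1),
        signChar (1 + i + j) • Finsupp.single (faceWord j (faceWord i W)) (1 : ℝ) := fun i hi => by
    rw [map_smul, signedFace_single, Word.order_faceWord (by simpa using hi), Finset.smul_sum]
    refine Finset.sum_congr rfl fun j _ => ?_
    rw [Word.bParity_faceWord, smul_smul, ← signChar_add]
    congr 2
    push_cast
    generalize (W.order : ZMod 2) = a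
    generalize (i : ZMod 2) = b
    generalize (j : ZMod 2) = c
    generalize W.bParity = d
    revert a b c d; decide
  rw [Finset.sum_congr rfl e]
  set n := W.order with hn
  rw [← Finset.sum_product']
  rw [← Finset.sum_filter_add_sum_filter_not _ (fun p : ℕ × ℕ => p.1 < p.2)]
  rw [add_eq_zero_iff_eq_neg, ← Finset.sum_neg_distrib]
  refine Finset.sum_nbij' (fun p => (p.2 - 1, p.1)) (fun p => (p.2, p.1 + 1)) ?_ ?_ ?_ ?_ ?_
  · intro p hp
    simp only [Finset.mem_filter, Finset.mem_product, Finset.mem_range] at hp ⊢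
    omega
  · intro p hp
    simp only [Finset.mem_filter, Finset.mem_product, Finset.mem_range] at hp ⊢
    omega
  · intro p hp
    simp only [Finset.mem_filter, Finset.mem_product, Finset.mem_range] at hp
    ext <;> simp; omega
  · intro p hp
    simp
  · rintro ⟨i, j⟩ hp
    simp only [Finset.mem_filter, Finset.mem_product, Finset.mem_range] at hp
    obtain ⟨j, rfl⟩ : ∃ k, j = k + 1 := ⟨j - 1, by omega⟩
    have hnl : n = W.length + 1 := rfl
    simp only [Nat.add_sub_cancel]
    rw [faceWord_faceWord (by omega) (by omega), ← neg_smul, ← neg_one_mul, ← signChar_one,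
      ← signChar_add]
    congr 2
    push_cast; ring

theorem faceWord_circ_left {i : ℕ} {U : Word m} (V : Word m) (h : i < U.order) :
    faceWord i (U ++ (fun _ => Letter.c) :: V) = faceWord i U ++ (fun _ => Letter.c) :: V := by
  unfold faceWord Word.order at *
  induction i generalizing U with
  | zero => simp
  | succ i ih =>
    cases U with
    | nil => simp at h
    | cons q U => simp [ih (U := U) (by simpa using h)]

theorem faceWord_circ_right (i : ℕ) (U V : Word m) :
    faceWord (U.order + i) (U ++ (fun _ => Letter.c) :: V) =
      U ++ (fun _ => Letter.c) :: faceWord i V := by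
  unfold faceWord Word.order
  induction U with
  | nil => simp [add_comm 1 i]
  | cons q U ih =>
    rw [List.length_cons, show U.length + 1 + 1 + i = (U.length + 1 + i) + 1 by ring]
    simp [ih]

theorem signedFace_star (x y : Omega m) :
    signedFace (star x y) = star (signedFace x) y + star (degreeSign x) (signedFace y) := by
  suffices h : LinearMap.compr₂ star signedFace =
      star ∘ₗ signedFace + (star ∘ₗ degreeSign).compl₂ signedFace by
    simpa using LinearMap.congr_fun (LinearMap.congr_fun h x) y
  refine bilin_ext fun U V => ?_
  simp only [LinearMap.compr₂_apply, LinearMap.add_apply, LinearMap.comp_apply, LinearMap.compl₂_apply,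
    degreeSign_single, map_smul, LinearMap.smul_apply]
  rw [star_single_single, map_smul, signedFace_single, signedFace_single, signedFace_single,
    Word.order_circ, Finset.sum_range_add, map_sum, map_sum, LinearMap.sum_apply, smul_add,
    Finset.smul_sum, Finset.smul_sum, Finset.smul_sum]
  congr 1
  · refine Finset.sum_congr rfl fun i hi => ?_
    have hi : i < U.order := by simpa using hi
    rw [faceWord_circ_left V hi, map_smul, LinearMap.smul_apply, star_single_single,
      Word.order_faceWord hi, Word.parities_faceWord, Word.bParity_circ, smul_smul, smul_smul,
      ← signChar_add, ← signChar_add]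
    congr 2
    push_cast
    ring
  · refine Finset.sum_congr rfl fun i hi => ?_
    have hi : i < V.order := by simpa using hi
    rw [faceWord_circ_right i, map_smul, star_single_single,
      Word.order_faceWord hi, Word.parities_faceWord, Word.bParity_faceWord, Word.bParity_circ]
    simp only [smul_smul, ← signChar_add]
    congr 2
    push_cast
    generalize (V.order : ZMod 2) = a
    generalize V.bParity = b
    generalize pairing (fun i j => j < i) U.parities V.parities = c
    generalize U.bParity = d
    generalize (U.order : ZMod 2) = e
    generalize (i : ZMod 2) = f
    revert a b c d e f; decide

end Omega
end RuthTensor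

namespace RuthTensor

/-! ## The action of the symmetric group -/

namespace Word

variable {m : ℕ}

/-- The permutation of the factors, without sign. -/
def permute (σ : Equiv.Perm (Fin m)) (W : Word m) : Word m := W.map fun q i => q (σ.symm i)

theorem bCount_permute (σ : Equiv.Perm (Fin m)) (W : Word m) (i : Fin m) :
    (W.permute σ).bCount i = W.bCount (σ.symm i) := by
  simp [bCount, factor, permute, Function.comp_def]

theorem factor_permute (σ : Equiv.Perm (Fin m)) (W : Word m) (i : Fin m) :
    (W.permute σ).factor i = W.factor (σ.symm i) := by
  simp [factor, permute, Function.comp_def]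

theorem order_permute (σ : Equiv.Perm (Fin m)) (W : Word m) : (W.permute σ).order = W.order := by
  simp [order, permute]

theorem degree_permute (σ : Equiv.Perm (Fin m)) (W : Word m) : (W.permute σ).degree = W.degree := by
  simp only [degree, bCount_permute]
  rw [Equiv.sum_comp σ.symm fun i => (W.bCount i : ℤ)]

theorem parities_permute (σ : Equiv.Perm (Fin m)) (W : Word m) :
    (W.permute σ).parities = fun i => W.parities (σ.symm i) := by
  funext i; simp [parities, bCount_permute]

theorem bParity_permute (σ : Equiv.Perm (Fin m)) (W : Word m) :
    (W.permute σ).bParity = W.bParity := by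
  rw [bParity_eq, parities_permute, Equiv.sum_comp σ.symm W.parities, bParity_eq]

theorem permute_circ (σ : Equiv.Perm (Fin m)) (U V : Word m) :
    permute σ (U ++ (fun _ => Letter.c) :: V) = permute σ U ++ (fun _ => Letter.c) :: permute σ V := by
  simp [permute]

theorem permute_faceWord (σ : Equiv.Perm (Fin m)) (i : ℕ) (W : Word m) :
    permute σ (Omega.faceWord i W) = Omega.faceWord i (permute σ W) := by
  simp [permute, Omega.faceWord, List.map_insertIdx]

theorem permute_mul (σ τ : Equiv.Perm (Fin m)) (W : Word m) :
    permute (σ * τ) W = permute σ (permute τ W) := by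
  simp [permute, Function.comp_def]; intros; rfl

end Word

namespace Omega

variable {m : ℕ}

/-- The Koszul exponent of a permutation. -/
def permExponent (σ : Equiv.Perm (Fin m)) (u : Fin m → ZMod 2) : ZMod 2 :=
  pairing (fun i j => i < j ∧ σ j < σ i) u u

theorem perm_single (σ : Equiv.Perm (Fin m)) (W : Word m) :
    perm σ (Finsupp.single W 1) =
      signChar (permExponent σ W.parities) • Finsupp.single (W.permute σ) (1 : ℝ) := by
  rw [perm, Finsupp.linearCombination_single, one_smul, permWord, Finsupp.smul_single, smul_eq_mul,
    mul_one, neg_one_pow_eq_signChar, permExponent, pairing]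
  push_cast
  simp only [Finset.sum_filter]
  rfl

/-- The permutation of the factors, without sign. -/
def permuteMap (σ : Equiv.Perm (Fin m)) : Omega m →ₗ[ℝ] Omega m := Finsupp.lmapDomain ℝ ℝ (Word.permute σ)

@[simp] theorem permuteMap_single (σ : Equiv.Perm (Fin m)) (W : Word m) (r : ℝ) :
    permuteMap σ (Finsupp.single W r) = Finsupp.single (W.permute σ) r := by simp [permuteMap]

theorem permuteMap_delRowWord (σ : Equiv.Perm (Fin m)) (i : Fin m) (W : Word m) :
    permuteMap σ (delRowWord i W) = delRowWord (σ i) (W.permute σ) := by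
  induction W with
  | nil => simp [delRowWord, Word.permute]
  | cons q W ih =>
    have e : ∀ (q : Fin m → Letter) (V : Word m), Word.permute σ (q :: V) =
      (fun i => q (σ.symm i)) :: Word.permute σ V := fun q V => rfl
    have ec : ∀ x, permuteMap σ (consMap q x) = consMap (fun i => q (σ.symm i)) (permuteMap σ x) :=
      fun x => LinearMap.congr_fun (linearMap_ext (f := permuteMap σ ∘ₗ consMap q)
        (g := consMap (fun i => q (σ.symm i)) ∘ₗ permuteMap σ) fun W => by simp [e]) x
    have eu : ∀ x, (fun j => Function.update q i x (σ.symm j)) =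
        Function.update (fun j => q (σ.symm j)) (σ i) x := fun x => by
      funext j
      simp only [Function.update_apply, Equiv.symm_apply_eq]
    rw [e, delRowWord, delRowWord, map_add, map_smul, ec, ih, Equiv.symm_apply_apply, ← eu, ← eu]
    congr 1
    split_ifs <;> simp [e]

theorem perm_of_mem_rowShift (σ : Equiv.Perm (Fin m)) {i : Fin m} {n : ℤ} {W : Word m} {x : Omega m}
    (hx : x ∈ Finsupp.supported ℝ ℝ (rowShift i n W)) :
    perm σ x = signChar (permExponent σ W.parities + n * ((∑ j, if i < j ∧ σ j < σ i then
      W.parities j else 0) + ∑ j, if j < i ∧ σ i < σ j then W.parities j else 0)) •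
        permuteMap σ x := by
  refine eq_of_mem_supported (g := signChar _ • permuteMap σ) hx fun W' hW' => ?_
  rw [perm_single, LinearMap.smul_apply, permuteMap_single, parities_of_mem_rowShift hW', permExponent,
    pairing_add_left, pairing_add_right, pairing_add_right, pairing_single_left, pairing_single_left,
    pairing_single_right]
  congr 2
  have h0 : (∑ j, if i < j ∧ σ j < σ i then (n : ZMod 2) * (Pi.single i (n : ZMod 2) : Fin m → ZMod 2) j
      else 0) = 0 := by
    refine Finset.sum_eq_zero fun j _ => ?_
    split_ifs with h
    · rw [Pi.single_eq_of_ne h.1.ne', mul_zero]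
    · rfl
  rw [h0, mul_add, Finset.mul_sum, Finset.mul_sum, permExponent]
  simp only [mul_ite, mul_zero]
  ring

theorem perm_del (σ : Equiv.Perm (Fin m)) (x : Omega m) : perm σ (del x) = del (perm σ x) := by
  suffices h : perm σ ∘ₗ del = del ∘ₗ perm σ from LinearMap.congr_fun h x
  refine linearMap_ext fun W => ?_
  rw [LinearMap.comp_apply, LinearMap.comp_apply, perm_single, map_smul, del_eq]
  simp only [LinearMap.sum_apply, map_sum, signed_single, map_smul, Finset.smul_sum]
  refine Eq.trans ?_ (Equiv.sum_comp σ _)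
  refine Finset.sum_congr rfl fun i _ => ?_
  rw [perm_of_mem_rowShift σ (shiftsRow_delRow i W), delRow_single, delRow_single,
    permuteMap_delRowWord, smul_smul, smul_smul, rowSign_eq, rowSign_eq, ← signChar_add,
    ← signChar_add, Word.parities_permute]
  congr 2
  have hn : (((-1 : ℤ)) : ZMod 2) = 1 := by decide
  rw [hn, one_mul, add_left_comm]
  congr 1
  refine Eq.trans ?_ (Equiv.sum_comp σ _)
  rw [← Finset.sum_add_distrib, ← Finset.sum_add_distrib]
  refine Finset.sum_congr rfl fun j _ => ?_
  beta_reduce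
  rw [Equiv.symm_apply_apply]
  by_cases hij : j = i
  · subst hij; simp
  have hσ : σ j ≠ σ i := fun h => hij (σ.injective h)
  rcases lt_or_gt_of_ne hij with h | h <;> rcases lt_or_gt_of_ne hσ with h' | h' <;>
    simp [h, h', h.not_gt, h'.not_gt, zmod_two_add_self]

theorem perm_star (σ : Equiv.Perm (Fin m)) (x y : Omega m) :
    perm σ (star x y) = star (perm σ x) (perm σ y) := by
  suffices h : LinearMap.compr₂ star (perm σ) = (star ∘ₗ perm σ).compl₂ (perm σ) by
    simpa using LinearMap.congr_fun (LinearMap.congr_fun h x) y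
  refine bilin_ext fun U V => ?_
  simp only [LinearMap.compr₂_apply, LinearMap.comp_apply, LinearMap.compl₂_apply]
  rw [star_single_single, map_smul, perm_single, perm_single, perm_single, map_smul, map_smul,
    LinearMap.smul_apply, star_single_single]
  simp only [smul_smul, ← signChar_add]
  rw [Word.permute_circ, Word.order_permute, Word.order_permute, Word.bParity_permute,
    Word.parities_circ, Word.parities_permute, Word.parities_permute]
  congr 2
  rw [permExponent, pairing_add_left, pairing_add_right, pairing_add_right]
  set P := pairing (fun i j => i < j ∧ σ j < σ i) with hP
  have key : pairing (fun i j => j < i) (fun i => U.parities (σ.symm i))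
      (fun i => V.parities (σ.symm i)) =
      pairing (fun i j => j < i) U.parities V.parities + P U.parities V.parities +
        P V.parities U.parities := by
    have e : P V.parities U.parities = ∑ i, ∑ j, if j < i ∧ σ i < σ j then
        U.parities i * V.parities j else 0 := by
      rw [hP, pairing, Finset.sum_comm]
      simp only [mul_comm]
    rw [e, hP]
    simp only [pairing]
    rw [← Equiv.sum_comp σ, ← Finset.sum_add_distrib, ← Finset.sum_add_distrib]
    refine Finset.sum_congr rfl fun i _ => ?_
    rw [← Equiv.sum_comp σ, ← Finset.sum_add_distrib, ← Finset.sum_add_distrib]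
    refine Finset.sum_congr rfl fun j _ => ?_
    rw [Equiv.symm_apply_apply, Equiv.symm_apply_apply]
    by_cases hij : j = i
    · subst hij; simp
    have hσ : σ j ≠ σ i := fun h => hij (σ.injective h)
    rcases lt_or_gt_of_ne hij with h | h <;> rcases lt_or_gt_of_ne hσ with h' | h' <;>
      simp [h, h', h.not_gt, h'.not_gt, zmod_two_add_self]
  rw [key]
  simp only [permExponent]
  ring

theorem perm_signedFace (σ : Equiv.Perm (Fin m)) (x : Omega m) :
    perm σ (signedFace x) = signedFace (perm σ x) := by
  suffices h : perm σ ∘ₗ signedFace = signedFace ∘ₗ perm σ from LinearMap.congr_fun h x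
  refine linearMap_ext fun W => ?_
  rw [LinearMap.comp_apply, LinearMap.comp_apply, perm_single, map_smul, signedFace_single,
    signedFace_single, map_sum, Finset.smul_sum, Word.order_permute]
  refine Finset.sum_congr rfl fun i _ => ?_
  rw [map_smul, perm_single, Word.parities_faceWord, Word.permute_faceWord, Word.bParity_permute,
    smul_smul, smul_smul, mul_comm]

theorem permExponent_mul (σ τ : Equiv.Perm (Fin m)) (u : Fin m → ZMod 2) :
    permExponent (σ * τ) u = permExponent τ u + permExponent σ (fun i => u (τ.symm i)) := by
  have e : permExponent σ (fun i => u (τ.symm i)) =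
      ∑ i, ∑ j, if i < j then ((if τ i < τ j ∧ σ (τ j) < σ (τ i) then u i * u j else 0) +
        (if τ j < τ i ∧ σ (τ i) < σ (τ j) then u i * u j else 0)) else 0 := by
    have h1 : permExponent σ (fun i => u (τ.symm i)) =
        ∑ i, ∑ j, if τ i < τ j ∧ σ (τ j) < σ (τ i) then u i * u j else 0 := by
      rw [permExponent, pairing, ← Equiv.sum_comp τ]
      refine Finset.sum_congr rfl fun i _ => ?_
      rw [← Equiv.sum_comp τ]
      simp
    have h2 : ∀ i j : Fin m, (if τ i < τ j ∧ σ (τ j) < σ (τ i) then u i * u j else 0) =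
        (if i < j then (if τ i < τ j ∧ σ (τ j) < σ (τ i) then u i * u j else 0) else 0) +
        (if j < i then (if τ i < τ j ∧ σ (τ j) < σ (τ i) then u i * u j else 0) else 0) := by
      intro i j
      rcases lt_trichotomy i j with h | h | h
      · simp [h, h.not_gt]
      · subst h; simp
      · simp [h, h.not_gt]
    have h3 : ∀ i j : Fin m, (if i < j then ((if τ i < τ j ∧ σ (τ j) < σ (τ i) then u i * u j else 0) +
        (if τ j < τ i ∧ σ (τ i) < σ (τ j) then u i * u j else 0)) else 0) =
        (if i < j then (if τ i < τ j ∧ σ (τ j) < σ (τ i) then u i * u j else 0) else 0) +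
        (if i < j then (if τ j < τ i ∧ σ (τ i) < σ (τ j) then u i * u j else 0) else 0) := by
      intro i j; split_ifs <;> simp
    rw [h1, Finset.sum_congr rfl fun i _ => Finset.sum_congr rfl fun j _ => h2 i j,
      Finset.sum_congr rfl fun i _ => Finset.sum_congr rfl fun j _ => h3 i j]
    simp only [Finset.sum_add_distrib]
    congr 1
    rw [Finset.sum_comm]
    simp only [mul_comm]
  rw [e, permExponent, permExponent, pairing, pairing, ← Finset.sum_add_distrib]
  refine Finset.sum_congr rfl fun i _ => ?_
  rw [← Finset.sum_add_distrib]
  refine Finset.sum_congr rfl fun j _ => ?_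
  by_cases hij : i < j
  · have h1 : τ i ≠ τ j := fun h => hij.ne (τ.injective h)
    have h2 : σ (τ i) ≠ σ (τ j) := fun h => h1 (σ.injective h)
    rcases lt_or_gt_of_ne h1 with h | h <;> rcases lt_or_gt_of_ne h2 with h' | h' <;>
      simp [hij, h, h', h.not_gt, h'.not_gt, zmod_two_add_self]
  · simp [hij]

theorem perm_mul (σ τ : Equiv.Perm (Fin m)) (x : Omega m) : perm (σ * τ) x = perm σ (perm τ x) := by
  suffices h : perm (σ * τ) = perm σ ∘ₗ perm τ from LinearMap.congr_fun h x
  refine linearMap_ext fun W => ?_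
  rw [LinearMap.comp_apply, perm_single, perm_single, map_smul, perm_single, smul_smul, ← signChar_add,
    permExponent_mul, Word.permute_mul, Word.parities_permute]

theorem perm_mem_piece (σ : Equiv.Perm (Fin m)) {k : ℕ} {l : ℤ} {x : Omega m} (hx : x ∈ piece m k l) :
    perm σ x ∈ piece m k l :=
  map_mem_of_mem_supported hx fun W hW => by
    rw [perm_single]
    refine Submodule.smul_mem _ _ (single_mem_supported ?_ 1)
    simpa [Word.order_permute, Word.degree_permute] using hW

/-- The average of an element over the symmetric group. -/
def average (x : Omega m) : Omega m := (Nat.factorial m : ℝ)⁻¹ • ∑ σ : Equiv.Perm (Fin m), perm σ x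

theorem perm_average (σ : Equiv.Perm (Fin m)) (x : Omega m) : perm σ (average x) = average x := by
  rw [average, map_smul, map_sum]
  simp only [← perm_mul]
  exact congrArg _ (Equiv.sum_comp (Equiv.mulLeft σ) fun τ => perm τ x)

theorem average_mem_piece {k : ℕ} {l : ℤ} {x : Omega m} (hx : x ∈ piece m k l) :
    average x ∈ piece m k l :=
  Submodule.smul_mem _ _ (Submodule.sum_mem _ fun σ _ => perm_mem_piece σ hx)

theorem del_average {x y : Omega m} (h : del x = y) (hy : ∀ σ, perm σ y = y) : del (average x) = y := by
  rw [average, map_smul, map_sum]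
  simp only [← perm_del, h, hy, Finset.sum_const, Finset.card_univ, Fintype.card_perm, Fintype.card_fin]
  rw [← Nat.cast_smul_eq_nsmul ℝ, smul_smul, inv_mul_cancel₀ (by positivity), one_smul]

end Omega
end RuthTensor

namespace RuthTensor
namespace Omega

variable {m : ℕ}

/-! ## Acyclicity of the differential in negative degrees -/

/-- A contraction of row `i`, without the sign from the other rows. -/
def contractRowWord (i : Fin m) : Word m → Omega m
  | [] => 0
  | q :: W => (if q i = Letter.c then Finsupp.single (Function.update q i Letter.b :: W) 1 else 0)
      + if q i = Letter.b then 0 else consMap (Function.update q i Letter.a) (contractRowWord i W)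

/-- A contraction of row `i`, without the sign from the other rows. -/
def contractRow (i : Fin m) : Omega m →ₗ[ℝ] Omega m := Finsupp.linearCombination ℝ (contractRowWord i)

/-- The projection that kills the words with a letter `b` in row `i` and replaces the letters of this
row in the other words by `a`. -/
def projRowWord (i : Fin m) : Word m → Omega m
  | [] => Finsupp.single [] 1
  | q :: W => if q i = Letter.b then 0 else consMap (Function.update q i Letter.a) (projRowWord i W)

/-- The projection that kills the words with a letter `b` in row `i` and replaces the letters of this
row in the other words by `a`. -/
def projRow (i : Fin m) : Omega m →ₗ[ℝ] Omega m := Finsupp.linearCombination ℝ (projRowWord i)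

@[simp] theorem contractRow_single (i : Fin m) (W : Word m) :
    contractRow i (Finsupp.single W 1) = contractRowWord i W := by simp [contractRow]

@[simp] theorem projRow_single (i : Fin m) (W : Word m) :
    projRow i (Finsupp.single W 1) = projRowWord i W := by simp [projRow]

theorem contractRow_cons (i : Fin m) (q : Fin m → Letter) (x : Omega m) :
    contractRow i (consMap q x) = (if q i = Letter.c then consMap (Function.update q i Letter.b) x else 0)
      + if q i = Letter.b then 0 else consMap (Function.update q i Letter.a) (contractRow i x) := by
  let f : Omega m →ₗ[ℝ] Omega m := (if q i = Letter.c then consMap (Function.update q i Letter.b) else 0)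
      + if q i = Letter.b then 0 else consMap (Function.update q i Letter.a) ∘ₗ contractRow i
  have : contractRow i ∘ₗ consMap q = f := linearMap_ext fun W => by
    simp only [LinearMap.comp_apply, consMap_single, contractRow_single, contractRowWord, f]
    split_ifs <;> simp
  have h := LinearMap.congr_fun this x
  simp only [LinearMap.comp_apply, f] at h
  rw [h]
  split_ifs <;> simp

theorem mem_supported_update_cons {i : Fin m} {n : ℤ} {q : Fin m → Letter} {x : Letter} {W : Word m}
    {y : Omega m} (hy : y ∈ Finsupp.supported ℝ ℝ (rowShift i n W)) (hq : q i ≠ Letter.b)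
    (hx : x ≠ Letter.b) :
    consMap (Function.update q i x) y ∈ Finsupp.supported ℝ ℝ (rowShift i n (q :: W)) := by
  refine map_mem_of_mem_supported hy fun W' hW' => ?_
  rw [consMap_single]
  refine single_mem_supported ?_ 1
  obtain ⟨h1, h2, h3⟩ := hW'
  refine ⟨by simp [h1], fun j hj => by simp [Word.bCount_cons, h2 j hj, hj], ?_⟩
  simp [Word.bCount_cons, h3, hq, hx]

theorem shiftsRow_contractRow (i : Fin m) : ShiftsRow i 1 (contractRow i) := by
  intro W
  rw [contractRow_single]
  induction W with
  | nil => exact zero_mem _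
  | cons q W ih =>
    refine add_mem ?_ ?_
    · split_ifs with h
      · exact single_mem_supported (update_mem_rowShift i W _ (by simp [h])) 1
      · exact zero_mem _
    · split_ifs with h
      · exact zero_mem _
      · exact mem_supported_update_cons ih h (by simp)

theorem projRowWord_mem (i : Fin m) (W : Word m) :
    projRowWord i W ∈ Finsupp.supported ℝ ℝ (rowShift i 0 W ∩ {W' | W'.bCount i = 0}) := by
  induction W with
  | nil =>
    refine single_mem_supported ?_ 1
    exact ⟨⟨rfl, fun _ _ => rfl, by simp⟩, rfl⟩
  | cons q W ih =>
    rw [projRowWord]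
    split_ifs with h
    · exact zero_mem _
    · refine map_mem_of_mem_supported ih fun W' hW' => ?_
      obtain ⟨⟨h1, h2, h3⟩, h4⟩ := hW'
      rw [consMap_single]
      refine single_mem_supported ?_ 1
      refine ⟨⟨by simp [h1], fun j hj => by simp [Word.bCount_cons, h2 j hj, hj], ?_⟩, ?_⟩
      · simp [Word.bCount_cons, h3, h]
      · simpa [Word.bCount_cons] using h4

theorem delRow_contractRow_add (i : Fin m) (W : Word m) :
    delRow i (contractRowWord i W) + contractRow i (delRowWord i W) =
      Finsupp.single W 1 - projRowWord i W := by
  induction W with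
  | nil => simp [contractRowWord, delRowWord, projRowWord]
  | cons q W ih =>
    rw [contractRowWord, delRowWord, projRowWord, map_add, map_add, map_smul, contractRow_cons]
    have hq : Function.update q i (q i) = q := Function.update_eq_self i q
    rcases h : q i with _ | _ | _
    · have ih' := congrArg (consMap q) ih
      rw [h] at hq
      simp only [map_add, map_sub, consMap_single] at ih'
      simp [delRow_cons, letterSign, hq, h]
      exact ih'
    · rw [h] at hq
      simp [letterSign, contractRowWord, hq]
    · have ih' := congrArg (consMap (Function.update q i Letter.a)) ih
      rw [h] at hq
      simp only [map_add, map_sub, consMap_single] at ih'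
      simp [delRow_cons, delRowWord, letterSign, hq]
      rw [eq_sub_of_add_eq ih']
      abel

theorem contractRow_delRow_comm {i j : Fin m} (hij : i ≠ j) (x : Omega m) :
    contractRow i (delRow j x) = delRow j (contractRow i x) := by
  suffices h : contractRow i ∘ₗ delRow j = delRow j ∘ₗ contractRow i from LinearMap.congr_fun h x
  refine linearMap_ext fun W => ?_
  simp only [LinearMap.comp_apply]
  induction W with
  | nil => simp [delRowWord, contractRowWord]
  | cons q W ih =>
    have e : Finsupp.single (q :: W) (1 : ℝ) = consMap q (Finsupp.single W 1) := by simp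
    rw [e]
    generalize Finsupp.single W (1 : ℝ) = y at ih
    rw [delRow_cons, contractRow_cons, map_add, map_add, map_smul, contractRow_cons, ih]
    have hu : ∀ x y, Function.update (Function.update q i x) j y =
        Function.update (Function.update q j y) i x := fun x y => Function.update_comm hij _ _ _
    rcases hi : q i with _ | _ | _ <;> by_cases hj : q j = Letter.b <;>
      simp [delRow_cons, contractRow_cons, hi, hj, letterSign, hij, hij.symm, hu]; all_goals abel

/-- The contraction of row `i`, with Koszul signs. -/
def contract (i : Fin m) : Omega m →ₗ[ℝ] Omega m := signed i (contractRow i)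

theorem del_contract (i : Fin m) (x : Omega m) :
    del (contract i x) + contract i (del x) = x - projRow i x := by
  have h1 : ∀ x : Omega m, signed i (delRow i) (contract i x) + contract i (signed i (delRow i) x) =
      x - projRow i x := fun x => by
    suffices h : signed i (delRow i) ∘ₗ contract i + contract i ∘ₗ signed i (delRow i) =
        LinearMap.id - projRow i from LinearMap.congr_fun h x
    refine linearMap_ext fun W => ?_
    simp only [LinearMap.add_apply, LinearMap.comp_apply, LinearMap.sub_apply, LinearMap.id_apply]
    rw [contract, signed_signed_self (shiftsRow_contractRow i), signed_signed_self (shiftsRow_delRow i),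
      contractRow_single, delRow_single, delRow_contractRow_add, projRow_single]
  rw [← h1, del_eq]
  simp only [LinearMap.sum_apply, map_sum]
  rw [← Finset.sum_add_distrib, Finset.sum_eq_single i]
  · intro j _ hj
    exact signed_anticomm hj (by decide) (by decide) (shiftsRow_delRow j) (shiftsRow_contractRow i)
      (fun W => (contractRow_delRow_comm (Ne.symm hj) _).symm) x
  · simp

theorem ShiftsRow.mem_piece {i : Fin m} {n : ℤ} {X : Omega m →ₗ[ℝ] Omega m} (hX : ShiftsRow i n X)
    {k : ℕ} {l : ℤ} {x : Omega m} (hx : x ∈ piece m k l) : signed i X x ∈ piece m k (l - n) :=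
  map_mem_of_mem_supported hx fun W hW => by
    rw [signed_single]
    refine Submodule.smul_mem _ _ (Finsupp.supported_mono ?_ (hX W))
    intro W' hW'
    obtain ⟨h1, h2⟩ := mem_piece_of_mem_rowShift hW'
    exact ⟨h1.trans hW.1, by rw [h2, hW.2]⟩

theorem contract_mem_piece (i : Fin m) {k : ℕ} {l : ℤ} {x : Omega m} (hx : x ∈ piece m k l) :
    contract i x ∈ piece m k (l - 1) := (shiftsRow_contractRow i).mem_piece hx

theorem exists_del_eq {k : ℕ} {l : ℤ} (hl : l < 0) {z : Omega m} (hz : z ∈ piece m k l)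
    (hdz : del z = 0) : ∃ y ∈ piece m k (l - 1), del y = z := by
  have key : ∀ s : Finset (Fin m), ∃ y ∈ piece m k (l - 1), z - del y ∈ Finsupp.supported ℝ ℝ
      {W : Word m | (W.order = k ∧ W.degree = l) ∧ ∀ i ∈ s, W.bCount i = 0} := by
    intro s
    induction s using Finset.induction_on with
    | empty => exact ⟨0, zero_mem _, by simpa [piece] using hz⟩
    | insert i s _ ih =>
      obtain ⟨y, hy, hzy⟩ := ih
      have hzy' : z - del y ∈ piece m k l := Finsupp.supported_mono (fun W hW => hW.1) hzy
      refine ⟨y + contract i (z - del y), add_mem hy (contract_mem_piece i hzy'), ?_⟩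
      have h := del_contract i (z - del y)
      rw [map_sub del, hdz, del_del, sub_zero, map_zero, add_zero] at h
      rw [map_add, ← sub_sub, h, sub_sub_cancel]
      refine map_mem_of_mem_supported hzy fun W hW => ?_
      rw [projRow_single]
      refine Finsupp.supported_mono ?_ (projRowWord_mem i W)
      rintro W' ⟨hW', h0⟩
      obtain ⟨h1, h2⟩ := mem_piece_of_mem_rowShift hW'
      refine ⟨⟨h1.trans hW.1.1, by rw [h2, hW.1.2, sub_zero]⟩, fun j hj => ?_⟩
      rcases Finset.mem_insert.1 hj with rfl | hj
      · exact h0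
      · by_cases hji : j = i
        · subst hji; exact h0
        · rw [hW'.2.1 j hji]; exact hW.2 j hj
  obtain ⟨y, hy, h⟩ := key Finset.univ
  refine ⟨y, hy, ?_⟩
  have he : {W : Word m | (W.order = k ∧ W.degree = l) ∧ ∀ i ∈ Finset.univ, W.bCount i = 0} = ∅ := by
    refine Set.eq_empty_of_forall_notMem fun W hW => ?_
    have : W.degree = 0 := by
      rw [Word.degree, Finset.sum_eq_zero fun i hi => by simp [hW.2 i hi]]; rfl
    have := hW.1.2
    omega
  rw [he, Finsupp.supported_empty, Submodule.mem_bot, sub_eq_zero] at h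
  exact h.symm

theorem exists_del_eq_c_sub_a :
    ∃ y ∈ piece m 2 (-1), del y = Finsupp.single ([fun _ => Letter.c] : Word m) (1 : ℝ)
      - Finsupp.single [fun _ => Letter.a] 1 := by
  have key : ∀ s : Finset (Fin m), ∃ y ∈ piece m 2 (-1), del y =
      Finsupp.single ([fun _ => Letter.c] : Word m) (1 : ℝ) -
        Finsupp.single [fun i => if i ∈ s then Letter.a else Letter.c] 1 := by
    intro s
    induction s using Finset.induction_on with
    | empty => exact ⟨0, zero_mem _, by simp⟩
    | insert i s hi ih =>
      obtain ⟨y, hy, h⟩ := ih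
      set q : Fin m → Letter := fun j => if j ∈ s then Letter.a else Letter.c with hq
      have hqb : ∀ j, q j ≠ Letter.b := fun j => by simp only [hq]; split_ifs <;> simp
      have hb : ∀ j, Word.bCount ([Function.update q i Letter.b] : Word m) j = if j = i then 1 else 0 := by
        intro j
        rw [Word.bCount_cons]
        by_cases hj : j = i
        · subst hj; simp
        · simp [hj, hqb]
      have hp : Finsupp.single ([Function.update q i Letter.b] : Word m) (1 : ℝ) ∈ piece m 2 (-1) := by
        refine single_mem_supported ?_ 1
        exact ⟨rfl, by simp [Word.degree, hb]⟩
      refine ⟨y + Finsupp.single [Function.update q i Letter.b] 1, add_mem hy hp, ?_⟩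
      · have hc : Function.update q i Letter.c = q := by
          rw [Function.update_eq_self_iff]; simp [hq, hi]
        have ha : Function.update q i Letter.a =
            fun j => if j ∈ insert i s then Letter.a else Letter.c := by
          funext j
          by_cases hj : j = i
          · subst hj; simp
          · simp [hj, hq]
        rw [map_add, h, del_single, delWord_eq, Finset.sum_eq_single i]
        · have hs : rowSign i ([Function.update q i Letter.b] : Word m) = 1 := by
            rw [rowSign, Finset.sum_eq_zero, signChar_zero]
            intro j hj
            rw [hb, if_neg (Finset.mem_filter.1 hj).2.ne, Nat.cast_zero]
          rw [hs, one_smul, delRowWord, delRowWord, map_zero, smul_zero, add_zero,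
            Function.update_self, if_pos rfl, Function.update_idem, Function.update_idem, ha, hc]
          abel
        · intro j _ hj
          simp [delRowWord, hj, hqb]
        · simp
  simpa using key Finset.univ

end Omega
end RuthTensor

namespace RuthTensor

namespace Omega

variable {m : ℕ}

theorem piece_zero (l : ℤ) : piece m 0 l = ⊥ := by
  have : {W : Word m | W.order = 0 ∧ W.degree = l} = ∅ :=
    Set.eq_empty_of_forall_notMem fun W hW => by simp [Word.order] at hW
  rw [piece, this, Finsupp.supported_empty]

theorem star_mem_piece {k k' : ℕ} {l l' : ℤ} {x y : Omega m} (hx : x ∈ piece m k l)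
    (hy : y ∈ piece m k' l') : star x y ∈ piece m (k + k') (l + l') :=
  map_mem_of_mem_supported (f := star.flip y) hx fun U hU =>
    map_mem_of_mem_supported (f := star (Finsupp.single U 1)) hy fun V hV => by
      rw [star_single_single]
      refine Submodule.smul_mem _ _ (single_mem_supported ?_ 1)
      exact ⟨by rw [Word.order_circ, hU.1, hV.1], by rw [Word.degree_circ, hU.2, hV.2]⟩

theorem signedFace_mem_piece {k : ℕ} {l : ℤ} {x : Omega m} (hx : x ∈ piece m k l) :
    signedFace x ∈ piece m (k + 1) l :=
  map_mem_of_mem_supported hx fun W hW => by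
    rw [signedFace_single]
    refine Submodule.sum_mem _ fun i hi => Submodule.smul_mem _ _ (single_mem_supported ?_ 1)
    exact ⟨by rw [Word.order_faceWord (by simpa using hi), hW.1], by rw [Word.degree_faceWord, hW.2]⟩

theorem degreeSign_of_mem_piece {k : ℕ} {n : ℤ} {x : Omega m} (hx : x ∈ piece m k (n - k)) :
    degreeSign x = signChar n • x :=
  diag_of_mem_supported hx fun W hW => by
    have h1 : (W.totalDegree : ℤ) = n := by rw [Word.totalDegree, hW.1, hW.2]; ring
    rw [← Word.cast_totalDegree, h1]

end Omega

namespace Completion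

variable {m : ℕ}

/-! ## The complete DGA -/

theorem HasDegree.apply_zero {n : ℤ} {x : Completion m} (hx : HasDegree n x) : x 0 = 0 := by
  have := hx 0
  rwa [Omega.piece_zero, Submodule.mem_bot] at this

theorem HasDegree.zero (n : ℤ) : HasDegree n (0 : Completion m) := fun _ => zero_mem _

theorem HasDegree.sub {n : ℤ} {x y : Completion m} (hx : HasDegree n x) (hy : HasDegree n y) :
    HasDegree n (x - y) := fun k => sub_mem (hx k) (hy k)

/-- The part of the total differential that raises the order. -/
def faceTot (x : Completion m) : Completion m
  | 0 => 0
  | k + 1 => Omega.signedFace (x k)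

theorem dTot_apply (x : Completion m) (k : ℕ) : dTot x k = Omega.del (x k) + faceTot x k := by
  cases k <;> simp [dTot, faceTot]

theorem dTot_add (x y : Completion m) : dTot (x + y) = dTot x + dTot y := by
  funext k; cases k <;> simp [dTot]; abel

theorem dTot_smul (r : ℝ) (x : Completion m) : dTot (r • x) = r • dTot x := by
  funext k; cases k <;> simp [dTot]

theorem dTot_sub (x y : Completion m) : dTot (x - y) = dTot x - dTot y := by
  funext k; cases k <;> simp [dTot]; abel

theorem star_apply (x y : Completion m) (k : ℕ) :
    star x y k = ∑ ij ∈ Finset.HasAntidiagonal.antidiagonal k, Omega.star (x ij.1) (y ij.2) := rfl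

theorem star_add (x y z : Completion m) : star x (y + z) = star x y + star x z := by
  funext k; simp [star_apply, Finset.sum_add_distrib]

theorem add_star (x y z : Completion m) : star (x + y) z = star x z + star y z := by
  funext k; simp [star_apply, Finset.sum_add_distrib]

theorem star_sub (x y z : Completion m) : star x (y - z) = star x y - star x z := by
  funext k; simp [star_apply]

theorem sub_star (x y z : Completion m) : star (x - y) z = star x z - star y z := by
  funext k; simp [star_apply]

theorem star_smul (r : ℝ) (x y : Completion m) : star x (r • y) = r • star x y := by
  funext k; simp [star_apply, Finset.smul_sum]

theorem smul_star (r : ℝ) (x y : Completion m) : star (r • x) y = r • star x y := by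
  funext k; simp [star_apply, Finset.smul_sum]

theorem star_zero (x : Completion m) : star x 0 = 0 := by
  funext k; simp [star_apply]

theorem zero_star (x : Completion m) : star 0 x = 0 := by
  funext k; simp [star_apply]

theorem star_assoc (x y z : Completion m) : star (star x y) z = star x (star y z) := by
  funext k
  simp only [star_apply, map_sum, LinearMap.sum_apply, Omega.star_assoc]
  rw [Finset.sum_sigma', Finset.sum_sigma']
  refine Finset.sum_nbij' (fun ⟨⟨_i, j⟩, ⟨k, l⟩⟩ ↦ ⟨(k, l + j), (l, j)⟩)
    (fun ⟨⟨i, _j⟩, ⟨k, l⟩⟩ ↦ ⟨(i + k, l), (i, k)⟩) ?_ ?_ ?_ ?_ ?_ <;>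
    simp only [Finset.mem_sigma, Finset.HasAntidiagonal.mem_antidiagonal, Sigma.forall, Prod.forall] <;>
    rintro i j k l ⟨h1, rfl⟩ <;> simp_all [add_assoc]

theorem HasDegree.star {n n' : ℤ} {x y : Completion m} (hx : HasDegree n x) (hy : HasDegree n' y) :
    HasDegree (n + n') (star x y) := fun k => by
  refine Submodule.sum_mem _ fun ij h => ?_
  have h := Finset.HasAntidiagonal.mem_antidiagonal.1 h
  have := Omega.star_mem_piece (hx ij.1) (hy ij.2)
  rwa [h, show n - (ij.1 : ℤ) + (n' - (ij.2 : ℤ)) = n + n' - k by rw [← h]; push_cast; ring] at this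

theorem HasDegree.faceTot {n : ℤ} {x : Completion m} (hx : HasDegree n x) :
    HasDegree (n + 1) (faceTot x) := fun k => by
  cases k with
  | zero => exact zero_mem _
  | succ k =>
    have := Omega.signedFace_mem_piece (hx k)
    rwa [show n + 1 - ((k + 1 : ℕ) : ℤ) = n - k by push_cast; ring]

theorem dTot_dTot (x : Completion m) : dTot (dTot x) = 0 := by
  funext k
  cases k with
  | zero => simp [dTot, Omega.del_del]
  | succ k =>
    have h1 : Omega.signedFace (faceTot x k) = 0 := by
      cases k <;> simp [faceTot, Omega.signedFace_signedFace]
    rw [dTot, dTot_apply x k, dTot, map_add, map_add, Omega.del_del, h1, zero_add, add_zero,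
      Omega.del_signedFace]; rfl

theorem dTot_star {n : ℤ} {x : Completion m} (hx : HasDegree n x) (y : Completion m) :
    dTot (star x y) = star (dTot x) y + signChar n • star x (dTot y) := by
  have e : ∀ z : Completion m, dTot z = (fun k => Omega.del (z k)) + faceTot z := fun z =>
    funext (dTot_apply z)
  have e1 : (fun k => Omega.del (star x y k)) = star (fun k => Omega.del (x k)) y +
      signChar n • star x (fun k => Omega.del (y k)) := by
    funext k
    simp only [star_apply, map_sum, Pi.add_apply, Pi.smul_apply, Finset.smul_sum]
    rw [← Finset.sum_add_distrib]
    refine Finset.sum_congr rfl fun ij _ => ?_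
    rw [Omega.del_star, Omega.degreeSign_of_mem_piece (hx ij.1), map_smul, LinearMap.smul_apply]
  have e2 : faceTot (star x y) = star (faceTot x) y + signChar n • star x (faceTot y) := by
    funext k
    cases k with
    | zero => simp [faceTot, star_apply]
    | succ k =>
      simp only [star_apply, Pi.add_apply, Pi.smul_apply]
      rw [Finset.Nat.sum_antidiagonal_succ]
      rw [Finset.Nat.sum_antidiagonal_succ']
      simp only [faceTot, star_apply, map_sum, map_zero, LinearMap.zero_apply, zero_add,
        Finset.smul_sum]
      rw [← Finset.sum_add_distrib]
      refine Finset.sum_congr rfl fun ij _ => ?_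
      rw [Omega.signedFace_star, Omega.degreeSign_of_mem_piece (hx ij.1), map_smul,
        LinearMap.smul_apply]
  rw [e, e1, e2, e, e, add_star, star_add, smul_add]
  abel

theorem IsSymmetric.sub {x y : Completion m} (hx : IsSymmetric x) (hy : IsSymmetric y) :
    IsSymmetric (x - y) := fun σ k => by
  rw [Pi.sub_apply, map_sub, hx, hy]

theorem IsSymmetric.star {x y : Completion m} (hx : IsSymmetric x) (hy : IsSymmetric y) :
    IsSymmetric (star x y) := fun σ k => by
  rw [star_apply, map_sum]
  refine Finset.sum_congr rfl fun ij _ => ?_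
  rw [Omega.perm_star, hx, hy]

theorem IsSymmetric.faceTot {x : Completion m} (hx : IsSymmetric x) :
    IsSymmetric (faceTot x) := fun σ k => by
  cases k with
  | zero => exact map_zero _
  | succ k => rw [Completion.faceTot, Omega.perm_signedFace, hx]

/-! ## Equations that are solved order by order -/

/-- An equation `L (x k) = Φ x k`, where the right-hand side depends on the components of `x` of
order less than `k` only, can be solved order by order. -/
theorem exists_solution (n : ℤ) (L : Omega m → Omega m) (A : ℕ → Omega m → Prop)
    (hA : ∀ k y, A k y → y ∈ Omega.piece m k (n - k)) (Φ : Completion m → Completion m)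
    (causal : ∀ (x y : Completion m) (k : ℕ), HasDegree n x → HasDegree n y →
      (∀ j < k, x j = y j) → Φ x k = Φ y k)
    (step : ∀ (x : Completion m) (k : ℕ), HasDegree n x → (∀ j < k, A j (x j) ∧ L (x j) = Φ x j) →
      (∀ j, k ≤ j → x j = 0) → ∃ y, A k y ∧ L y = Φ x k) :
    ∃ x : Completion m, HasDegree n x ∧ ∀ k, A k (x k) ∧ L (x k) = Φ x k := by
  let P : ℕ → Completion m → Prop := fun k x => HasDegree n x ∧
    (∀ j < k, A j (x j) ∧ L (x j) = Φ x j) ∧ ∀ j, k ≤ j → x j = 0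
  have ext : ∀ k x, P k x → ∃ x', P (k + 1) x' ∧ ∀ j < k, x' j = x j := by
    rintro k x ⟨h1, h2, h3⟩
    obtain ⟨y, hy, hy'⟩ := step x k h1 h2 h3
    have hlt : ∀ j < k, Function.update x k y j = x j := fun j hj =>
      Function.update_of_ne hj.ne y x
    have hdeg : HasDegree n (Function.update x k y) := fun j => by
      by_cases hj : j = k
      · subst hj; rw [Function.update_self]; exact hA _ _ hy
      · rw [Function.update_of_ne hj]; exact h1 j
    have hΦ : ∀ j ≤ k, Φ (Function.update x k y) j = Φ x j := fun j hj =>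
      causal _ _ j hdeg h1 fun i hi => hlt i (hi.trans_le hj)
    refine ⟨Function.update x k y, ⟨hdeg, fun j hj => ?_, fun j hj => ?_⟩, hlt⟩
    · rcases Nat.lt_succ_iff_lt_or_eq.1 hj with hj | rfl
      · rw [hlt j hj, hΦ j hj.le]; exact h2 j hj
      · rw [Function.update_self, hΦ j le_rfl]; exact ⟨hy, hy'⟩
    · rw [Function.update_of_ne (by omega)]; exact h3 j (by omega)
  choose next hnext hnext' using ext
  let X : ∀ k, {x : Completion m // P k x} := fun k => Nat.rec
    ⟨0, HasDegree.zero n, fun j hj => absurd hj (Nat.not_lt_zero j), fun _ _ => rfl⟩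
    (fun k x => ⟨next k x.1 x.2, hnext k x.1 x.2⟩) k
  have hX : ∀ N j, j < N → (X N).1 j = (X (j + 1)).1 j := by
    intro N j hj
    induction N with
    | zero => omega
    | succ N ih =>
      rcases Nat.lt_succ_iff_lt_or_eq.1 hj with hj | rfl
      · exact (hnext' N (X N).1 (X N).2 j hj).trans (ih hj)
      · rfl
  have hdeg : HasDegree n (fun k => (X (k + 1)).1 k : Completion m) := fun k => (X (k + 1)).2.1 k
  refine ⟨fun k => (X (k + 1)).1 k, hdeg, fun k => ?_⟩
  have h := (X (k + 1)).2.2.1 k (Nat.lt_succ_self k)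
  rw [causal _ (X (k + 1)).1 k hdeg (X (k + 1)).2.1 fun j hj => (hX (k + 1) j (by omega)).symm]
  exact h

theorem star_congr_right {x y y' : Completion m} {k : ℕ} (hx : x 0 = 0) (h : ∀ j < k, y j = y' j) :
    star x y k = star x y' k := by
  refine Finset.sum_congr rfl fun ij hij => ?_
  have hij := Finset.HasAntidiagonal.mem_antidiagonal.1 hij
  rcases Nat.eq_zero_or_pos ij.1 with h0 | h0
  · rw [h0, hx]; simp
  · rw [h ij.2 (by omega)]

theorem star_congr_left {x x' y : Completion m} {k : ℕ} (hy : y 0 = 0) (h : ∀ j < k, x j = x' j) :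
    star x y k = star x' y k := by
  refine Finset.sum_congr rfl fun ij hij => ?_
  have hij := Finset.HasAntidiagonal.mem_antidiagonal.1 hij
  rcases Nat.eq_zero_or_pos ij.2 with h0 | h0
  · rw [h0, hy]; simp
  · rw [h ij.1 (by omega)]

theorem star_apply_congr {x x' y y' : Completion m} {k : ℕ} (hx : x 0 = 0)
    (hy' : y' 0 = 0) (h : ∀ j < k, x j = x' j) (h' : ∀ j < k, y j = y' j) :
    star x y k = star x' y' k :=
  (star_congr_right hx h').trans (star_congr_left hy' h)

theorem faceTot_congr {x y : Completion m} {k : ℕ} (h : ∀ j < k, x j = y j) :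
    faceTot x k = faceTot y k := by
  cases k with
  | zero => rfl
  | succ k => rw [faceTot, faceTot, h k (Nat.lt_succ_self k)]

theorem star_apply_eq_zero_left {x y : Completion m} {k : ℕ} (hy : y 0 = 0) (h : ∀ j < k, x j = 0) :
    star x y k = 0 := by
  rw [star_congr_left (x' := 0) hy h, zero_star]; rfl

theorem star_apply_eq_zero_right {x y : Completion m} {k : ℕ} (hx : x 0 = 0) (h : ∀ j < k, y j = 0) :
    star x y k = 0 := by
  rw [star_congr_right (y' := 0) hx h, star_zero]; rfl

theorem faceTot_apply_eq_zero {x : Completion m} {k : ℕ} (h : ∀ j < k, x j = 0) :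
    faceTot x k = 0 := by
  cases k with
  | zero => rfl
  | succ k => rw [faceTot, h k (Nat.lt_succ_self k), map_zero]

/-- In negative degrees closed symmetric elements have symmetric primitives. -/
theorem exists_del_eq_symmetric (p : Prop) {k : ℕ} {l : ℤ} (hl : l < 0) {z : Omega m}
    (hz : z ∈ Omega.piece m k l) (hdz : Omega.del z = 0) (hs : p → ∀ σ, Omega.perm σ z = z) :
    ∃ y ∈ Omega.piece m k (l - 1), (p → ∀ σ, Omega.perm σ y = y) ∧ Omega.del y = z := by
  obtain ⟨y, hy, h⟩ := Omega.exists_del_eq hl hz hdz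
  by_cases hp : p
  · exact ⟨Omega.average y, Omega.average_mem_piece hy, fun _ σ => Omega.perm_average σ y,
      Omega.del_average h (hs hp)⟩
  · exact ⟨y, hy, fun h => absurd h hp, h⟩

/-! ## Existence of symmetric universal Maurer-Cartan elements -/

theorem exists_symmetric_universalMC : ∃ η : Completion m, η.IsUniversalMC ∧ η.IsSymmetric := by
  let e : Omega m := Finsupp.single [] 1
  have he : e ∈ Omega.piece m 1 0 := by
    refine Omega.single_mem_supported ?_ 1
    exact ⟨rfl, by simp [Word.degree]⟩
  have hperm : ∀ (σ : Equiv.Perm (Fin m)) (W : Word m), W.parities = 0 → W.permute σ = W →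
      Omega.perm σ (Finsupp.single W 1) = Finsupp.single W 1 := fun σ W h h' => by
    rw [Omega.perm_single, h', h]
    simp [Omega.permExponent, pairing, signChar_zero]
  let A : ℕ → Omega m → Prop := fun k y => y ∈ Omega.piece m k (1 - k) ∧
    (∀ σ, Omega.perm σ y = y) ∧ (k = 1 → y = e)
  let Φ : Completion m → Completion m := fun x => -(faceTot x + star x x)
  have step : ∀ (x : Completion m) (k : ℕ), HasDegree 1 x →
      (∀ j < k, A j (x j) ∧ Omega.del (x j) = Φ x j) → (∀ j, k ≤ j → x j = 0) →
      ∃ y, A k y ∧ Omega.del y = Φ x k := by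
    intro x k hx hxA hx0
    have hx00 := hx.apply_zero
    rcases k with _ | _ | _ | k
    · exact ⟨0, ⟨zero_mem _, fun σ => map_zero _, by simp⟩, by
        simp [Φ, faceTot, star_apply, hx00]⟩
    · refine ⟨e, ⟨by simpa using he, fun σ => hperm σ _ (by funext i; simp [Word.parities]) rfl,
        fun _ => rfl⟩, ?_⟩
      have : star x x 1 = 0 := star_apply_eq_zero_left hx00 fun j hj => by
        rw [Nat.lt_one_iff.1 hj, hx00]
      simp [Φ, faceTot, this, hx00, e, Omega.delWord]
    · have hx1 : x 1 = e := (hxA 1 (by norm_num)).1.2.2 rfl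
      obtain ⟨y, hy, hdy⟩ := Omega.exists_del_eq_c_sub_a (m := m)
      refine ⟨Omega.average y, ⟨Omega.average_mem_piece (by simpa using hy),
        fun σ => Omega.perm_average σ y, by simp⟩, ?_⟩
      rw [Omega.del_average hdy]
      · have h2 : star x x 2 = -Finsupp.single ([fun _ => Letter.c] : Word m) (1 : ℝ) := by
          rw [star_apply, show Finset.HasAntidiagonal.antidiagonal 2 = {(0, 2), (1, 1), (2, 0)} from rfl,
            Finset.sum_insert (by simp), Finset.sum_insert (by simp), Finset.sum_singleton]
          simp only [hx00, hx1, map_zero, LinearMap.zero_apply, zero_add, add_zero, e]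
          rw [Omega.star_single_single]
          simp [Word.order, Word.bParity, pairing, Word.parities, signChar_one]
        have h3 : faceTot x 2 = Finsupp.single ([fun _ => Letter.a] : Word m) (1 : ℝ) := by
          rw [faceTot, hx1, Omega.signedFace_single]
          simp [Word.order, Word.bParity, Omega.faceWord, signChar_zero, zmod_two_add_self]
        simp only [Φ, Pi.neg_apply, Pi.add_apply]
        rw [show (0 + 1 + 1 : ℕ) = 2 from rfl, h2, h3]
        abel
      · intro σ
        rw [map_sub, hperm, hperm] <;> rfl
    · let C : Completion m := dTot x + star x x
      have hC : ∀ j, C j = Omega.del (x j) - Φ x j := fun j => by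
        simp only [C, Φ, Pi.add_apply, Pi.neg_apply, dTot_apply]; abel
      have hC0 : ∀ j < k + 3, C j = 0 := fun j hj => by rw [hC, (hxA j hj).2, sub_self]
      have hdC : dTot C = star C x - star x C := by
        simp only [C]
        rw [dTot_add, dTot_dTot, dTot_star hx, add_star, star_add, star_assoc]
        simp only [Int.cast_one, signChar_one]
        module
      have hcl : Omega.del (Φ x (k + 3)) = 0 := by
        have h1 : dTot C (k + 3) = 0 := by
          rw [hdC, Pi.sub_apply, star_apply_eq_zero_left hx00 hC0, star_apply_eq_zero_right hx00 hC0,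
            sub_self]
        rw [dTot_apply, faceTot_apply_eq_zero hC0, add_zero, hC, map_sub, Omega.del_del] at h1
        simpa using h1
      have hxs : IsSymmetric x := fun σ j => by
        rcases lt_or_ge j (k + 3) with hj | hj
        · exact (hxA j hj).1.2.1 σ
        · rw [hx0 j hj, map_zero]
      have hmem : Φ x (k + 3) ∈ Omega.piece m (k + 3) (1 + 1 - (k + 3 : ℕ)) :=
        neg_mem (add_mem (hx.faceTot (k + 3)) (hx.star hx (k + 3)))
      obtain ⟨y, hy, hys, hdy⟩ := exists_del_eq_symmetric True (by push_cast; omega) hmem hcl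
        (fun _ σ => by
          simp only [Φ, Pi.neg_apply, Pi.add_apply, map_neg, map_add]
          rw [hxs.faceTot σ, (hxs.star hxs) σ])
      exact ⟨y, ⟨by convert hy using 1; ring_nf, hys trivial, by omega⟩, hdy⟩
  obtain ⟨η, hη, h⟩ := exists_solution (m := m) 1 Omega.del A (fun k y h => h.1) Φ
    (by
      intro x y k hx hy hxy
      simp only [Φ, Pi.neg_apply, Pi.add_apply]
      rw [faceTot_congr hxy, star_apply_congr hx.apply_zero hy.apply_zero hxy hxy]) step
  refine ⟨η, ⟨⟨hη, ?_⟩, (h 1).1.2.2 rfl⟩, fun σ k => (h k).1.2.1 σ⟩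
  funext k
  have := (h k).2
  simp only [Φ, Pi.neg_apply, Pi.add_apply] at this
  rw [Pi.add_apply, dTot_apply, this, Pi.zero_apply]
  abel

/-! ## Acyclicity of the twisted differential -/

theorem exists_twisted_primitive (p : Prop) {η θ : Completion m} (hη : IsMaurerCartan η)
    (hθ : IsMaurerCartan θ) {n : ℤ} {z : Completion m} (hz : HasDegree n z)
    (hdz : dTot z + star θ z - signChar n • star z η = 0) (hz0 : ∀ k : ℕ, (k : ℤ) ≤ n → z k = 0)
    (hs : p → IsSymmetric η ∧ IsSymmetric θ ∧ IsSymmetric z) :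
    ∃ y : Completion m, HasDegree (n - 1) y ∧ (p → IsSymmetric y) ∧
      dTot y + star θ y + signChar n • star y η = z := by
  have hη0 := hη.1.apply_zero
  have hθ0 := hθ.1.apply_zero
  let A : ℕ → Omega m → Prop := fun k y => y ∈ Omega.piece m k (n - 1 - k) ∧
    (p → ∀ σ, Omega.perm σ y = y) ∧ ((k : ℤ) ≤ n → y = 0)
  let Φ : Completion m → Completion m := fun y => z - faceTot y - star θ y - signChar n • star y η
  obtain ⟨y, hy, h⟩ := exists_solution (m := m) (n - 1) Omega.del A (fun k y h => h.1) Φ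
    (by
      intro x y k hx hy hxy
      simp only [Φ, Pi.sub_apply, Pi.smul_apply]
      rw [faceTot_congr hxy, star_congr_left hη0 hxy, star_congr_right hθ0 hxy])
    (by
      intro x k hx hxA hx0
      by_cases hk : (k : ℤ) ≤ n
      · refine ⟨0, ⟨zero_mem _, fun _ σ => map_zero _, fun _ => rfl⟩, ?_⟩
        have hxz : ∀ j < k, x j = 0 := fun j hj => (hxA j hj).1.2.2 (by omega)
        simp only [Φ, Pi.sub_apply, Pi.smul_apply]
        rw [faceTot_apply_eq_zero hxz, star_apply_eq_zero_left hη0 hxz,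
          star_apply_eq_zero_right hθ0 hxz, hz0 k hk]
        simp
      · let C : Completion m := dTot x + star θ x + signChar n • star x η - z
        have hC : ∀ j, C j = Omega.del (x j) - Φ x j := fun j => by
          simp only [C, Φ, Pi.add_apply, Pi.sub_apply, dTot_apply]; abel
        have hC0 : ∀ j < k, C j = 0 := fun j hj => by rw [hC, (hxA j hj).2, sub_self]
        have hdC : dTot C = signChar n • star C η - star θ C := by
          have h1 : signChar ((n - 1 : ℤ) : ZMod 2) = -signChar n := by
            rw [Int.cast_sub, sub_eq_add_neg, zmod_two_neg, signChar_add, Int.cast_one, signChar_one,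
              mul_neg_one]
          have h2 : dTot η = -star η η := eq_neg_of_add_eq_zero_left hη.2
          have h3 : dTot θ = -star θ θ := eq_neg_of_add_eq_zero_left hθ.2
          have h4 : dTot z = signChar n • star z η - star θ z := by
            rw [sub_eq_zero] at hdz
            rw [← hdz]; abel
          simp only [C]
          rw [dTot_sub, dTot_add, dTot_add, dTot_dTot, dTot_smul, dTot_star hθ.1, dTot_star hx, h1, h2,
            h3, h4]
          simp only [sub_star, star_sub, add_star, star_add, star_smul, smul_star, star_assoc,
            Int.cast_one, signChar_one, ← neg_one_smul ℝ (star η η), ← neg_one_smul ℝ (star θ θ)]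
          have h5 := signChar_mul_self (n : ZMod 2)
          simp only [smul_add, smul_sub, smul_smul, h5, mul_neg, mul_one]
          module
        have hcl : Omega.del (Φ x k) = 0 := by
          have h1 : dTot C k = 0 := by
            rw [hdC, Pi.sub_apply, Pi.smul_apply, star_apply_eq_zero_left hη0 hC0,
              star_apply_eq_zero_right hθ0 hC0, smul_zero, sub_self]
          rw [dTot_apply, faceTot_apply_eq_zero hC0, add_zero, hC, map_sub, Omega.del_del] at h1
          simpa using h1
        have hxs : p → IsSymmetric x := fun hp σ j => by
          rcases lt_or_ge j k with hj | hj
          · exact (hxA j hj).1.2.1 hp σ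
          · rw [hx0 j hj, map_zero]
        have hmem : Φ x k ∈ Omega.piece m k (n - k) := by
          have h1 := hx.faceTot k
          have h2 := hθ.1.star hx k
          have h3 := hx.star hη.1 k
          rw [sub_add_cancel] at h1 h3
          rw [add_sub_cancel] at h2
          exact sub_mem (sub_mem (sub_mem (hz k) h1) h2) (Submodule.smul_mem _ _ h3)
        obtain ⟨y, hy, hys, hdy⟩ := exists_del_eq_symmetric p (by omega) hmem hcl
          (fun hp σ => by
            obtain ⟨h1, h2, h3⟩ := hs hp
            have hx := hxs hp
            simp only [Φ, Pi.sub_apply, Pi.smul_apply, map_sub, map_smul]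
            rw [hx.faceTot σ, (h2.star hx) σ, (hx.star h1) σ, h3 σ])
        exact ⟨y, ⟨by convert hy using 1; ring_nf, hys, fun h => absurd h hk⟩, hdy⟩)
  refine ⟨y, hy, fun hp σ k => (h k).1.2.1 hp σ, ?_⟩
  funext k
  have := (h k).2
  simp only [Φ, Pi.sub_apply] at this
  rw [Pi.add_apply, Pi.add_apply, dTot_apply, this]
  abel

/-- The solutions `x` of `d x = η - θ + x ⋆ η - θ ⋆ x` correspond to the gauge equivalences `1 + x`. -/
theorem exists_gauge (p : Prop) {η θ : Completion m} (hη : IsUniversalMC η) (hθ : IsUniversalMC θ)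
    (hs : p → IsSymmetric η ∧ IsSymmetric θ) :
    ∃ x : Completion m, HasDegree 0 x ∧ (p → IsSymmetric x) ∧
      dTot x = η - θ + star x η - star θ x := by
  have h2 : dTot η = -star η η := eq_neg_of_add_eq_zero_left hη.1.2
  have h3 : dTot θ = -star θ θ := eq_neg_of_add_eq_zero_left hθ.1.2
  obtain ⟨x, hx, hxs, h⟩ := exists_twisted_primitive p hη.1 hθ.1 (hη.1.1.sub hθ.1.1)
    (by
      rw [dTot_sub, h2, h3, star_sub, sub_star, Int.cast_one, signChar_one]
      module)
    (by
      intro k hk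
      have : k = 0 ∨ k = 1 := by omega
      rcases this with rfl | rfl
      · rw [Pi.sub_apply, hη.1.1.apply_zero, hθ.1.1.apply_zero, sub_self]
      · rw [Pi.sub_apply, hη.2, hθ.2, sub_self])
    (fun hp => ⟨(hs hp).1, (hs hp).2, (hs hp).1.sub (hs hp).2⟩)
  refine ⟨x, hx, hxs, ?_⟩
  rw [← h, Int.cast_one, signChar_one]
  module

end Completion

namespace UnitalCompletion

variable {m : ℕ}

open Completion

theorem mul_assoc (u v w : UnitalCompletion m) : mul (mul u v) w = mul u (mul v w) := by
  refine Prod.ext (_root_.mul_assoc _ _ _) ?_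
  simp only [mul, star_add, add_star, star_smul, smul_star, Completion.star_assoc]
  module

theorem sub_mul (u v w : UnitalCompletion m) : mul (u - v) w = mul u w - mul v w := by
  refine Prod.ext (_root_.sub_mul _ _ _) ?_
  simp only [mul, sub_star, Prod.snd_sub, Prod.fst_sub]
  module

theorem unit_mul (u : UnitalCompletion m) : mul (unit m) u = u := by
  refine Prod.ext (one_mul _) ?_
  simp [mul, unit, zero_star]

theorem mul_unit (u : UnitalCompletion m) : mul u (unit m) = u := by
  refine Prod.ext (mul_one _) ?_
  simp [mul, unit, Completion.star_zero]

theorem exists_inverse {x : Completion m} (hx : Completion.HasDegree 0 x) :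
    ∃ y, Completion.HasDegree 0 y ∧ mul (1, x) (1, y) = unit m ∧ mul (1, y) (1, x) = unit m := by
  have right : ∀ {x : Completion m}, Completion.HasDegree 0 x →
      ∃ y, Completion.HasDegree 0 y ∧ mul (1, x) (1, y) = unit m := by
    intro x hx
    obtain ⟨y, hy, h⟩ := exists_solution 0 id (fun k y => y ∈ Omega.piece m k (0 - k))
      (fun _ _ h => h) (fun y => -x - star x y)
      (fun y y' k _ _ h => by
        simp only [Pi.sub_apply]; rw [star_congr_right hx.apply_zero h])
      (fun y k hy _ _ => ⟨_, sub_mem (neg_mem (hx k)) (by simpa using hx.star hy k), rfl⟩)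
    refine ⟨y, hy, Prod.ext (one_mul _) ?_⟩
    have : y = -x - star x y := funext fun k => (h k).2
    simp only [mul, unit, one_smul]
    nth_rewrite 1 [this]
    abel
  obtain ⟨y, hy, h⟩ := right hx
  obtain ⟨z, hz, h'⟩ := right hy
  have : ((1, z) : UnitalCompletion m) = (1, x) := by
    rw [← unit_mul (1, z), ← h, mul_assoc, h', mul_unit]
  exact ⟨y, hy, h, this ▸ h'⟩

theorem exists_strongGaugeEquivalence {η θ : Completion m} (hη : η.IsUniversalMC)
    (hθ : θ.IsUniversalMC) : ∃ u, IsStrongGaugeEquivalence η θ u := by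
  obtain ⟨x, hx, -, h⟩ := exists_gauge False hη hθ (fun h => h.elim)
  obtain ⟨y, hy, hxy, hyx⟩ := exists_inverse hx
  refine ⟨(1, x), ⟨⟨fun h => absurd rfl h, hx⟩, (1, y), ⟨fun h => absurd rfl h, hy⟩, hxy, hyx, ?_⟩,
    rfl, hx.apply_zero⟩
  have e : mul (1, x) (incl η) - mul (incl θ) (1, x) = dTot (1, x) := by
    refine Prod.ext (by simp [mul, incl, dTot]) ?_
    simp only [mul, incl, dTot, h, Prod.snd_sub]
    module
  rw [← e, sub_mul, mul_assoc (incl θ), hxy, mul_unit]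

theorem IsStrongGaugeEquivalence.dTot_eq {η θ : Completion m} {u : UnitalCompletion m}
    (h : IsStrongGaugeEquivalence η θ u) :
    Completion.dTot u.2 = η - θ + star u.2 η - star θ u.2 := by
  obtain ⟨⟨-, v, -, -, hvu, e⟩, h1, -⟩ := h
  have e' := congrArg (fun w => mul w u) e
  simp only [sub_mul, mul_assoc, hvu, mul_unit] at e'
  have := congrArg Prod.snd e'
  simp only [mul, incl, dTot, Prod.snd_sub, h1] at this
  rw [← this]
  module

theorem IsStrongGaugeEquivalence.homotopic {η θ : Completion m} (hη : η.IsUniversalMC)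
    (hθ : θ.IsUniversalMC) {u v : UnitalCompletion m} (hu : IsStrongGaugeEquivalence η θ u)
    (hv : IsStrongGaugeEquivalence η θ v) : Homotopic η θ u v := by
  obtain ⟨y, hy, -, h⟩ := exists_twisted_primitive False hη.1 hθ.1
    (hu.1.1.2.sub hv.1.1.2)
    (by
      rw [dTot_sub, hu.dTot_eq, hv.dTot_eq, star_sub, sub_star, Int.cast_zero, signChar_zero]
      module)
    (by
      intro k hk
      have : k = 0 := by omega
      subst this
      rw [Pi.sub_apply, hu.2.2, hv.2.2, sub_zero])
    (fun h => h.elim)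
  refine ⟨(0, y), ⟨fun _ => rfl, hy⟩, Prod.ext ?_ ?_⟩
  · simp [mul, dTot, incl, hu.2.1, hv.2.1]
  · rw [Prod.snd_sub, ← h, Int.cast_zero, signChar_zero]
    simp only [mul, dTot, incl, Prod.snd_add]
    module

end UnitalCompletion
end RuthTensor

namespace RuthTensor

/-! ## Tensor products of graded maps -/

theorem signChar_sum {ι : Type*} (s : Finset ι) (f : ι → ZMod 2) :
    signChar (∑ i ∈ s, f i) = ∏ i ∈ s, signChar (f i) := by
  classical
  induction s using Finset.induction_on with
  | empty => simp [signChar_zero]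
  | insert i s hi ih => rw [Finset.sum_insert hi, Finset.prod_insert hi, signChar_add, ih]

section GradedTensor

variable {m : ℕ} {V V' V'' : Fin m → Type*} [∀ i, AddCommGroup (V i)] [∀ i, Module ℝ (V i)]
  [∀ i, AddCommGroup (V' i)] [∀ i, Module ℝ (V' i)] [∀ i, AddCommGroup (V'' i)]
  [∀ i, Module ℝ (V'' i)]

/-- The tensor product with Koszul signs of maps `φᵢ` of parity `nᵢ`, where `Pᵢ` is the parity
operator of the source. -/
def gradedTensor (P : ∀ i, Module.End ℝ (V i)) (φ : ∀ i, V i →ₗ[ℝ] V' i) (n : Fin m → ℕ) :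
    (⨂[ℝ] i, V i) →ₗ[ℝ] ⨂[ℝ] i, V' i :=
  PiTensorProduct.map fun i => φ i ∘ₗ P i ^ (∑ j ∈ Finset.univ.filter (fun j => i < j), n j)

theorem end_pow_parity {U : Type*} [AddCommGroup U] [Module ℝ U] {P : Module.End ℝ U} (hP : P * P = 1)
    {a b : ℕ} (h : (a : ZMod 2) = b) : P ^ a = P ^ b := by
  have hsq : P ^ 2 = 1 := by rw [pow_two, hP]
  have hmod : a % 2 = b % 2 := (ZMod.natCast_eq_natCast_iff' a b 2).1 h
  rw [← Nat.div_add_mod a 2, ← Nat.div_add_mod b 2, hmod, pow_add, pow_add, pow_mul, pow_mul, hsq,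
    one_pow, one_pow]

theorem gradedTensor_congr {P : ∀ i, Module.End ℝ (V i)} (hP : ∀ i, P i * P i = 1)
    {φ φ' : ∀ i, V i →ₗ[ℝ] V' i} {n n' : Fin m → ℕ} (hφ : ∀ i, φ i = φ' i)
    (hn : ∀ i, (n i : ZMod 2) = n' i) : gradedTensor P φ n = gradedTensor P φ' n' := by
  rw [gradedTensor, gradedTensor]
  congr 1
  funext i
  rw [hφ i, end_pow_parity (hP i)]
  push_cast
  exact Finset.sum_congr rfl fun j _ => hn j

theorem pow_comp_of_parity {U U' : Type*} [AddCommGroup U] [Module ℝ U] [AddCommGroup U'] [Module ℝ U']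
    {P : Module.End ℝ U} {P' : Module.End ℝ U'} {ψ : U →ₗ[ℝ] U'} {k : ZMod 2}
    (h : P' ∘ₗ ψ = signChar k • ψ ∘ₗ P) (a : ℕ) :
    (P' ^ a) ∘ₗ ψ = signChar (a * k) • ψ ∘ₗ (P ^ a) := by
  induction a with
  | zero => ext; simp [signChar_zero]
  | succ a ih =>
    rw [pow_succ, Module.End.mul_eq_comp, LinearMap.comp_assoc, h, LinearMap.comp_smul,
      ← LinearMap.comp_assoc, ih, LinearMap.smul_comp, smul_smul, ← signChar_add, pow_succ,
      Module.End.mul_eq_comp, LinearMap.comp_assoc]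
    congr 2
    push_cast; ring

theorem map_smul_family (c : Fin m → ℝ) (φ : ∀ i, V i →ₗ[ℝ] V' i) :
    PiTensorProduct.map (fun i => c i • φ i) = (∏ i, c i) • PiTensorProduct.map φ :=
  (PiTensorProduct.mapMultilinear ℝ V V').map_smul_univ c φ

theorem gradedTensor_comp {P : ∀ i, Module.End ℝ (V i)} {P' : ∀ i, Module.End ℝ (V' i)}
    (φ : ∀ i, V' i →ₗ[ℝ] V'' i) (n : Fin m → ℕ) {ψ : ∀ i, V i →ₗ[ℝ] V' i} {k : Fin m → ℕ}
    (h : ∀ i, P' i ∘ₗ ψ i = signChar (k i) • ψ i ∘ₗ P i) :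
    gradedTensor P' φ n ∘ₗ gradedTensor P ψ k =
      signChar (∑ i, ∑ j, if j < i then (n i : ZMod 2) * k j else 0) •
        gradedTensor P (fun i => φ i ∘ₗ ψ i) (fun i => n i + k i) := by
  rw [gradedTensor, gradedTensor, gradedTensor, ← PiTensorProduct.map_comp, Finset.sum_comm,
    signChar_sum, ← map_smul_family]
  congr 1
  funext i
  have := pow_comp_of_parity (h i) (∑ j ∈ Finset.univ.filter (fun j => i < j), n j)
  rw [LinearMap.comp_assoc, ← LinearMap.comp_assoc _ (ψ i), this, LinearMap.smul_comp,
    LinearMap.comp_smul, Finset.sum_add_distrib, pow_add, Module.End.mul_eq_comp]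
  congr 2
  push_cast
  rw [Finset.sum_mul, Finset.sum_filter]

/-- The dependence of `gradedTensor` on one factor. -/
def gradedTensorFactor (P : ∀ i, Module.End ℝ (V i)) (φ : ∀ i, V i →ₗ[ℝ] V' i) (n : Fin m → ℕ)
    (i : Fin m) : (V i →ₗ[ℝ] V' i) →ₗ[ℝ] (⨂[ℝ] i, V i) →ₗ[ℝ] ⨂[ℝ] i, V' i :=
  (PiTensorProduct.mapMultilinear ℝ V V').toLinearMap
    (fun j => φ j ∘ₗ P j ^ (∑ k ∈ Finset.univ.filter (fun k => j < k), n k)) i ∘ₗ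
    LinearMap.lcomp ℝ _ (P i ^ (∑ k ∈ Finset.univ.filter (fun k => i < k), n k))

theorem gradedTensorFactor_apply (P : ∀ i, Module.End ℝ (V i)) (φ : ∀ i, V i →ₗ[ℝ] V' i)
    (n : Fin m → ℕ) (i : Fin m) (ψ : V i →ₗ[ℝ] V' i) :
    gradedTensorFactor P φ n i ψ = gradedTensor P (Function.update φ i ψ) n := by
  rw [gradedTensorFactor, gradedTensor, LinearMap.comp_apply, MultilinearMap.toLinearMap_apply,
    PiTensorProduct.mapMultilinear_apply]
  congr 1
  funext j
  by_cases hj : j = i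
  · subst hj; simp; rfl
  · simp [hj]

/-- The terms of the tensor product of differentials. -/
def diffTerm (P R : ∀ i, Module.End ℝ (V i)) (i : Fin m) : Module.End ℝ (⨂[ℝ] i, V i) :=
  gradedTensor P (Function.update (fun _ => LinearMap.id) i (R i)) (Pi.single i 1)

theorem sum_ite_single_left (i : Fin m) (k : Fin m → ℕ) :
    (∑ a, ∑ b, if b < a then (((Pi.single i 1 : Fin m → ℕ) a : ℕ) : ZMod 2) * k b else 0) =
      ∑ b, if b < i then (k b : ZMod 2) else 0 := by
  rw [Finset.sum_eq_single i]
  · simp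
  · intro a _ ha; simp [ha]
  · simp

theorem sum_ite_single_right (i : Fin m) (k : Fin m → ℕ) :
    (∑ a, ∑ b, if b < a then (k a : ZMod 2) * (((Pi.single i 1 : Fin m → ℕ) b : ℕ) : ZMod 2) else 0) =
      ∑ a, if i < a then (k a : ZMod 2) else 0 := by
  refine Finset.sum_congr rfl fun a _ => ?_
  rw [Finset.sum_eq_single i]
  · simp
  · intro b _ hb; simp [hb]
  · simp

theorem diffTerm_comp {P : ∀ i, Module.End ℝ (V i)} {P' R' : ∀ i, Module.End ℝ (V' i)} (i : Fin m)
    {ψ : ∀ i, V i →ₗ[ℝ] V' i} {k : Fin m → ℕ}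
    (h : ∀ i, P' i ∘ₗ ψ i = signChar (k i) • ψ i ∘ₗ P i) :
    diffTerm P' R' i ∘ₗ gradedTensor P ψ k = signChar (∑ b, if b < i then (k b : ZMod 2) else 0) •
      gradedTensorFactor P ψ (fun j => k j + (Pi.single i 1 : Fin m → ℕ) j) i (R' i ∘ₗ ψ i) := by
  rw [diffTerm, gradedTensor_comp _ _ h, gradedTensorFactor_apply, sum_ite_single_left]
  congr 2
  · funext j
    by_cases hj : j = i
    · subst hj; simp
    · simp [hj]
  · funext j; exact add_comm _ _

theorem comp_diffTerm {P R : ∀ i, Module.End ℝ (V i)} (i : Fin m)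
    {ψ : ∀ i, V i →ₗ[ℝ] V' i} {k : Fin m → ℕ} (hR : P i ∘ₗ R i = -R i ∘ₗ P i) :
    gradedTensor P ψ k ∘ₗ diffTerm P R i = signChar (∑ b, if i < b then (k b : ZMod 2) else 0) •
      gradedTensorFactor P ψ (fun j => k j + (Pi.single i 1 : Fin m → ℕ) j) i (ψ i ∘ₗ R i) := by
  rw [diffTerm, gradedTensor_comp, gradedTensorFactor_apply, sum_ite_single_right]
  · congr 2
    funext j
    by_cases hj : j = i
    · subst hj; simp
    · simp [hj]
  · intro j
    by_cases hj : j = i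
    · subst hj; simp [signChar_one, hR]
    · simp [hj, signChar_zero, LinearMap.id_comp, LinearMap.comp_id]

theorem diffTerm_comp_diffTerm {P R : ∀ i, Module.End ℝ (V i)} (hP : ∀ i, P i * P i = 1)
    (hR : ∀ i, P i ∘ₗ R i = -R i ∘ₗ P i)
    (hRR : ∀ i, R i ∘ₗ R i = 0) (i j : Fin m) :
    diffTerm P R i ∘ₗ diffTerm P R j + diffTerm P R j ∘ₗ diffTerm P R i = 0 := by
  have hpar : ∀ j a, P a ∘ₗ (Function.update (fun _ => LinearMap.id) j (R j) : ∀ i, Module.End ℝ (V i)) a =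
      signChar (((Pi.single j 1 : Fin m → ℕ) a : ℕ) : ZMod 2) •
        (Function.update (fun _ => LinearMap.id) j (R j) : ∀ i, Module.End ℝ (V i)) a ∘ₗ P a := by
    intro j a
    by_cases hj : a = j
    · subst hj; simp [signChar_one, hR]
    · simp [hj, signChar_zero, LinearMap.id_comp, LinearMap.comp_id]
  have e : ∀ i j, diffTerm P R i ∘ₗ diffTerm P R j =
      signChar (if j < i then 1 else 0) • gradedTensorFactor P
        (Function.update (fun _ => LinearMap.id) j (R j))
        (fun a => (Pi.single j 1 : Fin m → ℕ) a + (Pi.single i 1 : Fin m → ℕ) a) i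
        (R i ∘ₗ (Function.update (fun _ => LinearMap.id) j (R j) : ∀ i, Module.End ℝ (V i)) i) := by
    intro i j
    rw [show diffTerm P R j = gradedTensor P _ _ from rfl, diffTerm_comp (P := P) i (hpar j)]
    congr 2
    rw [Finset.sum_eq_single j]
    · simp
    · intro b _ hb; simp [hb]
    · simp
  by_cases hij : i = j
  · subst hij
    rw [e]
    simp [hRR]
  · rw [e, e, gradedTensorFactor_apply, gradedTensorFactor_apply]
    simp only [Function.update_of_ne hij, Function.update_of_ne (Ne.symm hij), LinearMap.comp_id]
    rw [Function.update_comm hij,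
      gradedTensor_congr hP (fun _ => rfl) (n' := fun a => (Pi.single i 1 : Fin m → ℕ) a +
        (Pi.single j 1 : Fin m → ℕ) a) (fun a => by rw [add_comm]), ← add_smul]
    rcases lt_or_gt_of_ne hij with h | h
    · simp [h, h.not_gt, signChar_one, signChar_zero]
    · simp [h, h.not_gt, signChar_one, signChar_zero]

/-- The square of the tensor product of differentials vanishes. -/
theorem sum_diffTerm_comp_self {P R : ∀ i, Module.End ℝ (V i)} (hP : ∀ i, P i * P i = 1)
    (hR : ∀ i, P i ∘ₗ R i = -R i ∘ₗ P i) (hRR : ∀ i, R i ∘ₗ R i = 0) :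
    (∑ i, diffTerm P R i) ∘ₗ (∑ i, diffTerm P R i) = 0 := by
  have : (∑ i, diffTerm P R i) ∘ₗ (∑ i, diffTerm P R i) =
      ∑ i, ∑ j, diffTerm P R i ∘ₗ diffTerm P R j := by
    ext1; ext1
    simp [LinearMap.sum_apply, map_sum]
  rw [this]
  exact Omega.sum_sum_eq_zero_of_anticomm _ fun i j => diffTerm_comp_diffTerm hP hR hRR i j

/-- The graded commutator with a tensor product of differentials. -/
theorem sum_diffTerm_commutator {P R : ∀ i, Module.End ℝ (V i)} {P' R' : ∀ i, Module.End ℝ (V' i)}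
    (hR : ∀ i, P i ∘ₗ R i = -R i ∘ₗ P i) {ψ : ∀ i, V i →ₗ[ℝ] V' i} {k : Fin m → ℕ}
    (h : ∀ i, P' i ∘ₗ ψ i = signChar (k i) • ψ i ∘ₗ P i) :
    (∑ i, diffTerm P' R' i) ∘ₗ gradedTensor P ψ k -
      signChar (∑ i, (k i : ZMod 2)) • gradedTensor P ψ k ∘ₗ (∑ i, diffTerm P R i) =
    ∑ i, signChar (∑ b, if b < i then (k b : ZMod 2) else 0) •
      gradedTensorFactor P ψ (fun j => k j + (Pi.single i 1 : Fin m → ℕ) j) i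
        (R' i ∘ₗ ψ i - signChar (k i) • ψ i ∘ₗ R i) := by
  have e1 : (∑ i, diffTerm P' R' i) ∘ₗ gradedTensor P ψ k =
      ∑ i, diffTerm P' R' i ∘ₗ gradedTensor P ψ k := by
    ext1; ext1; simp [LinearMap.sum_apply]
  have e2 : gradedTensor P ψ k ∘ₗ (∑ i, diffTerm P R i) =
      ∑ i, gradedTensor P ψ k ∘ₗ diffTerm P R i := by
    ext1; ext1; simp [LinearMap.sum_apply, map_sum]
  rw [e1, e2, Finset.smul_sum, ← Finset.sum_sub_distrib]
  refine Finset.sum_congr rfl fun i _ => ?_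
  rw [diffTerm_comp i h, comp_diffTerm i (hR i), map_sub, map_smul, smul_sub, smul_smul,
    smul_smul, ← signChar_add, ← signChar_add]
  congr 3
  have split : (∑ j, (k j : ZMod 2)) = (∑ j, if j < i then (k j : ZMod 2) else 0) + k i +
      ∑ j, if i < j then (k j : ZMod 2) else 0 := by
    have : (k i : ZMod 2) = ∑ j, if j = i then (k j : ZMod 2) else 0 := by simp
    rw [this, ← Finset.sum_add_distrib, ← Finset.sum_add_distrib]
    refine Finset.sum_congr rfl fun j _ => ?_
    rcases lt_trichotomy j i with h | h | h
    · simp [h, h.ne, h.not_gt]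
    · simp [h]
    · simp [h, h.ne', h.not_gt]
  rw [split, add_assoc, zmod_two_add_self, add_zero]

end GradedTensor
end RuthTensor

namespace RuthTensor

/-! ## Differentials of words in one row -/

section Letters

variable {V : Type*} [AddCommGroup V] [Module ℝ V]

/-- The value of a function of words on the differential of a word. -/
def delLetters : (List Letter → V) → List Letter → V
  | _, [] => 0
  | f, x :: w => (if x = Letter.b then f (Letter.c :: w) - f (Letter.a :: w) else 0)
      + Omega.letterSign x • delLetters (fun w' => f (x :: w')) w

theorem delLetters_congr {f g : List Letter → V} {w : List Letter}
    (h : ∀ w', w'.length = w.length → f w' = g w') : delLetters f w = delLetters g w := by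
  induction w generalizing f g with
  | nil => rfl
  | cons x w ih =>
    rw [delLetters, delLetters, h _ (by simp), h _ (by simp),
      ih (f := fun w' => f (x :: w')) (g := fun w' => g (x :: w')) fun w' hw' => h _ (by simp [hw'])]

theorem delLetters_map {V' : Type*} [AddCommGroup V'] [Module ℝ V'] (L : V →ₗ[ℝ] V')
    (f : List Letter → V) (w : List Letter) : delLetters (fun w' => L (f w')) w = L (delLetters f w) := by
  induction w generalizing f with
  | nil => simp [delLetters]
  | cons x w ih =>
    rw [delLetters, delLetters, ih fun w' => f (x :: w'), map_add, map_smul]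
    split_ifs <;> simp

theorem delLetters_append (f : List Letter → V) (u v : List Letter) :
    delLetters f (u ++ v) = delLetters (fun u' => f (u' ++ v)) u +
      signChar (u.count Letter.b) • delLetters (fun v' => f (u ++ v')) v := by
  induction u generalizing f with
  | nil => simp [delLetters, signChar_zero]
  | cons x u ih =>
    rw [List.cons_append, delLetters, delLetters, ih, smul_add, smul_smul, add_assoc, List.count_cons,
      Nat.cast_add, signChar_add, mul_comm (Omega.letterSign x)]
    congr 4
    cases x <;> simp [Omega.letterSign, signChar_zero, signChar_one]

theorem delLetters_insertIdx (f : List Letter → V) {i : ℕ} {w : List Letter} (hi : i ≤ w.length) :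
    delLetters f (w.insertIdx i Letter.a) = delLetters (fun w' => f (w'.insertIdx i Letter.a)) w := by
  induction i generalizing f w with
  | zero => simp [delLetters, Omega.letterSign]
  | succ i ih =>
    cases w with
    | nil => simp at hi
    | cons x w =>
      simp only [List.insertIdx_succ_cons, delLetters]
      rw [ih _ (by simpa using hi)]

theorem delLetters_replicate (f : List Letter → V) (n : ℕ) :
    delLetters f (List.replicate n Letter.b) = ∑ p ∈ Finset.range n, signChar p •
      (f (List.replicate p Letter.b ++ Letter.c :: List.replicate (n - 1 - p) Letter.b) -
        f (List.replicate p Letter.b ++ Letter.a :: List.replicate (n - 1 - p) Letter.b)) := by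
  induction n generalizing f with
  | zero => simp [delLetters]
  | succ n ih =>
    rw [List.replicate_succ, delLetters, ih, Finset.sum_range_succ', add_comm, Finset.smul_sum]
    congr 1
    · refine Finset.sum_congr rfl fun p hp => ?_
      have hp : p < n := by simpa using hp
      rw [smul_smul, show n + 1 - 1 - (p + 1) = n - 1 - p by omega, Nat.cast_succ, signChar_add,
        List.replicate_succ]
      congr 1
      simp [Omega.letterSign, signChar_one]
    · simp [signChar_zero]

theorem append_cons_eq_insertIdx (u v : List Letter) (x : Letter) :
    u ++ x :: v = (u ++ v).insertIdx u.length x := by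
  induction u with
  | nil => simp
  | cons y u ih => simpa using ih

theorem letters_induction {P : List Letter → Prop} (hb : ∀ n, P (List.replicate n Letter.b))
    (hc : ∀ u v, P u → P v → P (u ++ Letter.c :: v))
    (ha : ∀ i w, i ≤ w.length → P w → P (w.insertIdx i Letter.a)) (w : List Letter) : P w := by
  induction hn : w.length using Nat.strong_induction_on generalizing w with
  | _ n ih =>
    by_cases h1 : Letter.c ∈ w
    · obtain ⟨u, v, rfl⟩ := List.append_of_mem h1
      simp only [List.length_append, List.length_cons] at hn
      exact hc u v (ih _ (by omega) u rfl) (ih _ (by omega) v rfl)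
    · by_cases h2 : Letter.a ∈ w
      · obtain ⟨u, v, rfl⟩ := List.append_of_mem h2
        simp only [List.length_append, List.length_cons] at hn
        rw [append_cons_eq_insertIdx]
        exact ha _ _ (by simp) (ih _ (by simp; omega) _ rfl)
      · have : w = List.replicate w.length Letter.b := by
          refine List.eq_replicate_iff.2 ⟨rfl, fun x hx => ?_⟩
          cases x
          · exact absurd hx h2
          · rfl
          · exact absurd hx h1
        rw [this]; exact hb _

end Letters

namespace Omega

variable {m : ℕ}

theorem linearCombination_delRowWord {V : Type*} [AddCommGroup V] [Module ℝ V] (i : Fin m)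
    {f : Word m → V} {g : List Letter → V} {W : Word m}
    (h : ∀ W' ∈ rowShift i (-1) W, (∀ j, j ≠ i → W'.factor j = W.factor j) →
      f W' = g (W'.factor i)) :
    Finsupp.linearCombination ℝ f (delRowWord i W) = delLetters g (W.factor i) := by
  induction W generalizing f g with
  | nil => simp [delRowWord, delLetters, Word.factor]
  | cons q W ih =>
    have e1 : Finsupp.linearCombination ℝ f (consMap q (delRowWord i W)) =
        Finsupp.linearCombination ℝ (fun W' => f (q :: W')) (delRowWord i W) := by
      rw [consMap, Finsupp.lmapDomain_apply, Finsupp.linearCombination_mapDomain]; rfl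
    rw [delRowWord, map_add, map_smul, e1, ih (g := fun w => g (q i :: w)) fun W' hW' hf => by
      rw [h _ (rowShift_cons q hW') fun j hj => by
        have := hf j hj
        simp only [Word.factor, List.map_cons] at this ⊢
        rw [this]]
      rfl]
    change _ = (if q i = Letter.b then _ else _) + _
    congr 1
    split_ifs with hq
    · have hu : ∀ x, x ≠ Letter.b → f (Function.update q i x :: W) = g (x :: Word.factor W i) := by
        intro x hx
        rw [h _ (update_mem_rowShift i W _ (by simp [hq, hx])) fun j hj => by simp [Word.factor, hj]]
        simp [Word.factor]
      rw [map_sub, Finsupp.linearCombination_single, Finsupp.linearCombination_single, one_smul,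
        one_smul, hu _ (by simp), hu _ (by simp)]
      rfl
    · simp

end Omega

/-! ## Strings of composable arrows -/

section Strings

variable {dM dG : ℕ}
  {M : Type*} [TopologicalSpace M] [ChartedSpace (EuclideanSpace ℝ (Fin dM)) M]
  [IsManifold (𝓡 dM) ∞ M]
  {G : Type*} [TopologicalSpace G] [ChartedSpace (EuclideanSpace ℝ (Fin dG)) G]
  [IsManifold (𝓡 dG) ∞ G]

namespace LieGroupoid

variable (Γ : LieGroupoid dM dG M G)

theorem vertex_zero (y : M) (l : List G) : Γ.vertex y l 0 = y := by cases l <;> rfl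

theorem vertex_length {l : List G} {y x : M} (h : Γ.IsString l y x) : Γ.vertex y l l.length = x := by
  induction l generalizing y with
  | nil => exact h
  | cons g l ih => exact ih h.2

theorem IsString.take {Γ : LieGroupoid dM dG M G} {l : List G} {y x : M} (h : Γ.IsString l y x) {j : ℕ}
    (hj : j ≤ l.length) : Γ.IsString (l.take j) y (Γ.vertex y l j) := by
  induction l generalizing y j with
  | nil => simp at hj; subst hj; rfl
  | cons g l ih =>
    cases j with
    | zero => rfl
    | succ j => exact ⟨h.1, ih h.2 (by simpa using hj)⟩

theorem IsString.drop {Γ : LieGroupoid dM dG M G} {l : List G} {y x : M} (h : Γ.IsString l y x) {j : ℕ}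
    (hj : j ≤ l.length) : Γ.IsString (l.drop j) (Γ.vertex y l j) x := by
  induction l generalizing y j with
  | nil => simp at hj; subst hj; exact h
  | cons g l ih =>
    cases j with
    | zero => exact h
    | succ j => exact ih h.2 (by simpa using hj)

theorem merge_succ_succ (j : ℕ) (g : G) (l : List G) :
    Γ.merge (j + 2) (g :: l) = g :: Γ.merge (j + 1) l := by rw [merge]; simp

theorem merge_one (g h : G) (l : List G) : Γ.merge 1 (g :: h :: l) = Γ.mul g h :: l := rfl

theorem length_merge {j : ℕ} {l : List G} (hj : j + 1 < l.length) :
    (Γ.merge (j + 1) l).length = l.length - 1 := by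
  induction j generalizing l with
  | zero =>
    match l, hj with
    | g :: h :: l, _ => rfl
  | succ j ih =>
    match l, hj with
    | g :: l, hj =>
      rw [merge_succ_succ, List.length_cons, ih (by simpa using hj), List.length_cons]
      simp at hj; omega

theorem IsString.merge {Γ : LieGroupoid dM dG M G} {l : List G} {y x : M} (h : Γ.IsString l y x) {j : ℕ}
    (hj : j + 1 < l.length) : Γ.IsString (Γ.merge (j + 1) l) y x := by
  induction j generalizing l y with
  | zero =>
    match l, hj, h with
    | g :: g' :: l, _, h =>
      obtain ⟨h1, h2, h3⟩ := h
      refine ⟨?_, ?_⟩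
      · rw [Γ.tgt_mul _ _ h2.symm, h1]
      · rwa [Γ.src_mul _ _ h2.symm]
  | succ j ih =>
    match l, hj, h with
    | g :: l, hj, h =>
      rw [merge_succ_succ]
      exact ⟨h.1, ih h.2 (by simpa using hj)⟩

end LieGroupoid

/-! ## The characteristic map of a representation up to homotopy -/

section WordOperation

variable (Γ : LieGroupoid dM dG M G) {E : GradedBundle M} (R : Operations G E E)

theorem wordOperationAux_append (w v : List Letter) (acc : List G) (p : G) (l : List G) (y x : M)
    (hs : Γ.IsString l (Γ.src p) x) (hl : l.length = w.length + v.length + 1) :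
    wordOperationAux Γ R (w ++ Letter.c :: v) acc p l y x =
      wordOperationAux Γ R w acc p (l.take w.length) y (Γ.vertex (Γ.src p) l w.length) ∘ₗ
        wordOperation Γ R v (l.drop w.length) (Γ.vertex (Γ.src p) l w.length) x := by
  induction w generalizing acc p l y with
  | nil =>
    match l, hl with
    | g :: l, _ => rfl
  | cons z w ih =>
    match l, hl, hs with
    | g :: l, hl, hs =>
      have hl' : l.length = w.length + v.length + 1 := by simp at hl; omega
      cases z with
      | a =>
        have := ih acc (Γ.mul p g) l y (by rw [Γ.src_mul _ _ hs.1.symm]; exact hs.2) hl'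
        rw [Γ.src_mul _ _ hs.1.symm] at this
        exact this
      | b => exact ih (acc ++ [p]) g l y hs.2 hl'
      | c =>
        have := ih [] g l (Γ.src p) hs.2 hl'
        exact congrArg (fun T => R (acc ++ [p]) y (Γ.src p) ∘ₗ T) this

theorem wordOperation_circ (w v : List Letter) (l : List G) (y x : M)
    (hs : Γ.IsString l y x) (hl : l.length = w.length + v.length + 2) :
    wordOperation Γ R (w ++ Letter.c :: v) l y x =
      wordOperation Γ R w (l.take (w.length + 1)) y (Γ.vertex y l (w.length + 1)) ∘ₗ
        wordOperation Γ R v (l.drop (w.length + 1)) (Γ.vertex y l (w.length + 1)) x := by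
  match l, hl, hs with
  | g :: l, hl, hs => exact wordOperationAux_append Γ R w v [] g l y x hs.2 (by simp at hl; omega)

theorem wordOperationAux_insertIdx (w : List Letter) (j : ℕ) (acc : List G) (p : G) (l : List G)
    (y x : M) (hs : Γ.IsString l (Γ.src p) x) (hl : l.length = w.length + 1) (hj : j + 1 ≤ w.length) :
    wordOperationAux Γ R (w.insertIdx (j + 1) Letter.a) acc p l y x =
      wordOperationAux Γ R w acc p (Γ.merge (j + 1) l) y x := by
  induction w generalizing j acc p l y with
  | nil => simp at hj
  | cons z w ih =>
    match l, hl, hs with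
    | g :: l, hl, hs =>
      have hl' : l.length = w.length + 1 := by simpa using hl
      rw [List.insertIdx_succ_cons]
      cases j with
      | zero =>
        match l, hl', hs with
        | h :: l, hl', hs =>
          rw [LieGroupoid.merge_one, List.insertIdx_zero]
          cases z with
          | a =>
            change wordOperationAux Γ R w acc _ l y x = wordOperationAux Γ R w acc _ l y x
            rw [Γ.mul_assoc _ _ _ hs.1.symm hs.2.1.symm]
          | b => rfl
          | c => rfl
      | succ j =>
        rw [LieGroupoid.merge_succ_succ]
        have hj' : j + 1 ≤ w.length := by simpa using hj
        cases z with
        | a => exact ih j acc (Γ.mul p g) l y (by rw [Γ.src_mul _ _ hs.1.symm]; exact hs.2) hl' hj'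
        | b => exact ih j (acc ++ [p]) g l y hs.2 hl' hj'
        | c => exact congrArg (fun T => R (acc ++ [p]) y (Γ.src p) ∘ₗ T) (ih j [] g l (Γ.src p) hs.2 hl' hj')

theorem wordOperation_insertIdx (w : List Letter) (j : ℕ) (l : List G)
    (y x : M) (hs : Γ.IsString l y x) (hl : l.length = w.length + 2) (hj : j ≤ w.length) :
    wordOperation Γ R (w.insertIdx j Letter.a) l y x =
      wordOperation Γ R w (Γ.merge (j + 1) l) y x := by
  match l, hl, hs with
  | g :: h :: l, hl, hs =>
    cases j with
    | zero => rfl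
    | succ j =>
      rw [LieGroupoid.merge_succ_succ]
      exact wordOperationAux_insertIdx Γ R w j [] g (h :: l) y x hs.2 (by simpa using hl) hj

theorem wordOperation_replicate (n : ℕ) (l : List G) (y x : M) (hl : l.length = n + 1) :
    wordOperation Γ R (List.replicate n Letter.b) l y x = R l y x := by
  have aux : ∀ (n : ℕ) (acc : List G) (p : G) (l : List G), l.length = n →
      wordOperationAux Γ R (List.replicate n Letter.b) acc p l y x = R (acc ++ p :: l) y x := by
    intro n
    induction n with
    | zero => intro acc p l hl; rw [List.eq_nil_of_length_eq_zero hl]; rfl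
    | succ n ih =>
      intro acc p l hl
      match l, hl with
      | g :: l, hl =>
        refine (ih (acc ++ [p]) g l (by simpa using hl)).trans ?_
        rw [List.append_assoc]; rfl
  match l, hl with
  | g :: l, hl => exact aux n [] g l (by simpa using hl)

/-- The characteristic map is compatible with the differentials. -/
theorem wordOperation_del
    (hR : ∀ (l : List G) (y x : M), Γ.IsString l y x →
      R.mergeSum Γ l y x =
        ∑ j ∈ Finset.range (l.length + 1), ((-1 : ℝ) ^ j) • Operations.comp Γ R R j l y x)
    (w : List Letter) (l : List G) (y x : M) (hs : Γ.IsString l y x) (hl : l.length = w.length + 1) :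
    R [] y y ∘ₗ wordOperation Γ R w l y x -
        signChar (w.count Letter.b) • wordOperation Γ R w l y x ∘ₗ R [] x x =
      delLetters (fun w' => wordOperation Γ R w' l y x) w := by
  induction w using letters_induction generalizing l y x with
  | hb n =>
    have hl : l.length = n + 1 := by simpa using hl
    have h := hR l y x hs
    rw [Finset.sum_range_succ, hl, Finset.sum_range_succ'] at h
    have h0 : Operations.comp Γ R R 0 l y x = R [] y y ∘ₗ R l y x := by
      rw [Operations.comp, Γ.vertex_zero]; rfl
    have h1 : Operations.comp Γ R R (n + 1) l y x = R l y x ∘ₗ R [] x x := by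
      rw [← hl, Operations.comp, Γ.vertex_length hs, List.take_length, List.drop_length]
    rw [h0, h1, pow_zero, one_smul, Operations.mergeSum, hl, Finset.sum_Ico_eq_sum_range] at h
    rw [delLetters_replicate, wordOperation_replicate Γ R n l y x hl, List.count_replicate_self]
    have e : ∀ p ∈ Finset.range n, signChar p •
      (wordOperation Γ R (List.replicate p Letter.b ++ Letter.c :: List.replicate (n - 1 - p) Letter.b)
        l y x -
      wordOperation Γ R (List.replicate p Letter.b ++ Letter.a :: List.replicate (n - 1 - p) Letter.b)
        l y x) = signChar p • Operations.comp Γ R R (p + 1) l y x -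
          signChar p • R (Γ.merge (p + 1) l) y x := by
      intro p hp
      have hp : p < n := by simpa using hp
      have e1 : List.replicate p Letter.b ++ Letter.a :: List.replicate (n - 1 - p) Letter.b =
          (List.replicate (n - 1) Letter.b).insertIdx p Letter.a := by
        rw [append_cons_eq_insertIdx, ← List.replicate_add, List.length_replicate,
          show p + (n - 1 - p) = n - 1 by omega]
      rw [e1, wordOperation_insertIdx Γ R _ _ _ _ _ hs (by simp; omega) (by simp; omega),
        wordOperation_replicate Γ R _ _ _ _ (by rw [Γ.length_merge (by omega)]; omega),
        wordOperation_circ Γ R _ _ _ _ _ hs (by simp; omega), List.length_replicate,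
        wordOperation_replicate _ _ _ _ _ _ (by simp; omega),
        wordOperation_replicate _ _ _ _ _ _ (by simp; omega), smul_sub]
      rfl
    rw [Finset.sum_congr rfl e, Finset.sum_sub_distrib]
    simp only [neg_one_pow_eq_signChar, Nat.add_sub_cancel, Nat.cast_add,
      Nat.cast_one, signChar_add, signChar_one, mul_neg_one, neg_smul,
      Finset.sum_neg_distrib, add_comm 1] at h ⊢
    rw [sub_eq_sub_iff_add_eq_add, ← sub_eq_zero]
    rw [← sub_eq_zero] at h
    rw [← neg_eq_zero, ← h]
    abel
  | hc u v hu hv =>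
    have hl : l.length = u.length + v.length + 2 := by simp at hl; omega
    have hj : u.length + 1 ≤ l.length := by omega
    set z := Γ.vertex y l (u.length + 1) with hz
    have iu := hu (l.take (u.length + 1)) y z (hs.take hj) (by simp; omega)
    have iv := hv (l.drop (u.length + 1)) z x (hs.drop hj) (by simp; omega)
    set A := wordOperation Γ R u (l.take (u.length + 1)) y z with hA
    set B := wordOperation Γ R v (l.drop (u.length + 1)) z x with hB
    rw [delLetters_append, wordOperation_circ Γ R u v l y x hs hl, ← hz, ← hA, ← hB]
    have e1 : delLetters (fun u' => wordOperation Γ R (u' ++ Letter.c :: v) l y x) u =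
        delLetters (fun u' => wordOperation Γ R u' (l.take (u.length + 1)) y z) u ∘ₗ B := by
      rw [← LinearMap.lcomp_apply' (R := ℝ) B (S := ℝ)]
      rw [← delLetters_map]
      refine delLetters_congr fun w' hw' => ?_
      rw [wordOperation_circ Γ R w' v l y x hs (by omega), hw']
      rfl
    have e2 : delLetters (fun v' => wordOperation Γ R (u ++ v') l y x) (Letter.c :: v) =
        A ∘ₗ delLetters (fun v' => wordOperation Γ R v' (l.drop (u.length + 1)) z x) v := by
      rw [delLetters]
      simp only [reduceCtorEq, if_false, zero_add, Omega.letterSign, one_smul]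
      rw [← LinearMap.compRight_apply ℝ A, ← delLetters_map]
      refine delLetters_congr fun w' hw' => ?_
      rw [wordOperation_circ Γ R u w' l y x hs (by omega)]
      rfl
    rw [e1, e2, ← iu, ← iv, List.count_append, List.count_cons]
    simp only [reduceCtorEq, beq_iff_eq, if_false, add_zero, Nat.cast_add, signChar_add]
    simp only [LinearMap.sub_comp, LinearMap.comp_sub, LinearMap.smul_comp, LinearMap.comp_smul,
      smul_sub, smul_smul, LinearMap.comp_assoc]
    abel
  | ha i w hi ih =>
    have hl : l.length = w.length + 2 := by
      rw [List.length_insertIdx_of_le_length hi] at hl; exact hl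
    have hc : (w.insertIdx i Letter.a).count Letter.b = w.count Letter.b := by
      rw [((List.perm_insertIdx Letter.a w hi).count_eq Letter.b), List.count_cons]; simp
    rw [delLetters_insertIdx _ hi, hc, wordOperation_insertIdx Γ R w i l y x hs hl hi,
      ih _ y x (hs.merge (by omega)) (by rw [Γ.length_merge (by omega)]; omega)]
    refine delLetters_congr fun w' hw' => ?_
    rw [wordOperation_insertIdx Γ R w' i l y x hs (by omega) (by omega)]

theorem wordOperation_hasDegree (hR : R.HasDegree Γ 1) (w : List Letter) (l : List G) (y x : M)
    (hs : Γ.IsString l y x) (hl : l.length = w.length + 1) (p : ℤ) (v : E.Fiber x)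
    (hv : v ∈ E.grading x p) :
    wordOperation Γ R w l y x v ∈ E.grading y (p - w.count Letter.b) := by
  induction w using letters_induction generalizing l y x p v with
  | hb n =>
    have hl : l.length = n + 1 := by simpa using hl
    rw [wordOperation_replicate Γ R n l y x hl, List.count_replicate_self]
    have := hR l y x hs p v hv
    rwa [hl, show p + 1 - ((n + 1 : ℕ) : ℤ) = p - n by push_cast; ring] at this
  | hc u v' hu hv' =>
    have hl : l.length = u.length + v'.length + 2 := by simp at hl; omega
    have hj : u.length + 1 ≤ l.length := by omega
    rw [wordOperation_circ Γ R u v' l y x hs hl, LinearMap.comp_apply]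
    have := hu _ _ _ (hs.take hj) (by simp; omega) _ _
      (hv' _ _ _ (hs.drop hj) (by simp; omega) _ _ hv)
    convert this using 2
    rw [List.count_append, List.count_cons]; simp; ring
  | ha i w hi ih =>
    have hl : l.length = w.length + 2 := by
      rw [List.length_insertIdx_of_le_length hi] at hl; exact hl
    have hc : (w.insertIdx i Letter.a).count Letter.b = w.count Letter.b := by
      rw [((List.perm_insertIdx Letter.a w hi).count_eq Letter.b), List.count_cons]; simp
    rw [wordOperation_insertIdx Γ R w i l y x hs hl hi, hc]
    exact ih _ y x (hs.merge (by omega)) (by rw [Γ.length_merge (by omega)]; omega) p v hv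

end WordOperation

end Strings
end RuthTensor

namespace RuthTensor

/-! ## Fibres of graded vector bundles -/

namespace GradedBundle

section Fibres

variable {d : ℕ} {M : Type*} [TopologicalSpace M] [ChartedSpace (EuclideanSpace ℝ (Fin d)) M]
  {E : GradedBundle M}

theorem IsVectorBundle.exists_basis (hE : E.IsVectorBundle (d := d)) (x : M) :
    ∃ (r : ℕ) (deg : Fin r → ℤ) (b : Module.Basis (Fin r) ℝ (E.Fiber x)),
      ∀ n : ℤ, E.grading x n = Submodule.span ℝ (b '' {i | deg i = n}) := by
  obtain ⟨U, -, hx, r, deg, e, h, -⟩ := hE x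
  obtain ⟨h1, h2, h3⟩ := h x hx
  refine ⟨r, deg, Module.Basis.mk h1 h2.ge, fun n => ?_⟩
  rw [h3, Module.Basis.coe_mk]

theorem IsVectorBundle.parity_apply (hE : E.IsVectorBundle (d := d)) {x : M} {n : ℤ} {v : E.Fiber x}
    (hv : v ∈ E.grading x n) : E.parity x v = signChar n • v := by
  obtain ⟨r, deg, b, hb⟩ := hE.exists_basis x
  have hex : ∃ T : Module.End ℝ (E.Fiber x), ∀ n : ℤ, ∀ v ∈ E.grading x n, T v = ((-1 : ℝ) ^ n) • v := by
    refine ⟨b.constr ℝ fun i => ((-1 : ℝ) ^ deg i) • b i, fun n v hv => ?_⟩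
    rw [hb] at hv
    refine LinearMap.eqOn_span (f := b.constr ℝ fun i => ((-1 : ℝ) ^ deg i) • b i)
      (g := ((-1 : ℝ) ^ n) • LinearMap.id) ?_ hv
    rintro _ ⟨i, hi, rfl⟩
    rw [Module.Basis.constr_basis, LinearMap.smul_apply, LinearMap.id_apply, show deg i = n from hi]
  rw [← neg_one_zpow_eq_signChar]
  exact Classical.epsilon_spec hex n v hv

theorem IsVectorBundle.linearMap_ext (hE : E.IsVectorBundle (d := d)) {x : M} {V : Type*}
    [AddCommGroup V] [Module ℝ V] {f g : E.Fiber x →ₗ[ℝ] V}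
    (h : ∀ n, ∀ v ∈ E.grading x n, f v = g v) : f = g := by
  obtain ⟨r, deg, b, hb⟩ := hE.exists_basis x
  refine b.ext fun i => h (deg i) _ ?_
  rw [hb]
  exact Submodule.subset_span ⟨i, rfl, rfl⟩

theorem IsVectorBundle.parity_mul_self (hE : E.IsVectorBundle (d := d)) (x : M) :
    E.parity x * E.parity x = 1 :=
  hE.linearMap_ext fun n v hv => by
    rw [Module.End.mul_apply, hE.parity_apply hv, map_smul, hE.parity_apply hv, smul_smul,
      signChar_mul_self, one_smul, Module.End.one_apply]

theorem IsVectorBundle.parity_pow_apply (hE : E.IsVectorBundle (d := d)) {x : M} {n : ℤ} {v : E.Fiber x}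
    (hv : v ∈ E.grading x n) (a : ℕ) : (E.parity x ^ a) v = signChar (a * n) • v := by
  induction a with
  | zero => simp [signChar_zero]
  | succ a ih =>
    rw [pow_succ, Module.End.mul_apply, hE.parity_apply hv, map_smul, ih, smul_smul, ← signChar_add]
    congr 2; push_cast; ring

end Fibres

end GradedBundle

section TensorOperations

variable {dM dG : ℕ}
  {M : Type*} [TopologicalSpace M] [ChartedSpace (EuclideanSpace ℝ (Fin dM)) M]
  [IsManifold (𝓡 dM) ∞ M]
  {G : Type*} [TopologicalSpace G] [ChartedSpace (EuclideanSpace ℝ (Fin dG)) G]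
  [IsManifold (𝓡 dG) ∞ G]
  {Γ : LieGroupoid dM dG M G}

section Single

variable {E : GradedBundle M} {R : Operations G E E}

theorem IsRepUpToHomotopy.parity_comp (h : IsRepUpToHomotopy Γ E R) (x : M) :
    E.parity x ∘ₗ R [] x x = -R [] x x ∘ₗ E.parity x :=
  h.isVectorBundle.linearMap_ext fun n v hv => by
    have := h.hasDegree [] x x rfl n v hv
    rw [LinearMap.comp_apply, h.isVectorBundle.parity_apply this,
      LinearMap.neg_apply, LinearMap.comp_apply, h.isVectorBundle.parity_apply hv, map_smul]
    simp [signChar_add, signChar_one]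

theorem IsRepUpToHomotopy.comp_self (h : IsRepUpToHomotopy Γ E R) (x : M) :
    R [] x x ∘ₗ R [] x x = 0 := by
  have := h.equation [] x x rfl
  simp [Operations.mergeSum, Operations.comp, LieGroupoid.vertex] at this
  exact this.symm

theorem IsRepUpToHomotopy.parity_wordOperation (h : IsRepUpToHomotopy Γ E R) (w : List Letter)
    {l : List G} {y x : M} (hs : Γ.IsString l y x) (hl : l.length = w.length + 1) :
    E.parity y ∘ₗ wordOperation Γ R w l y x =
      signChar (w.count Letter.b) • wordOperation Γ R w l y x ∘ₗ E.parity x :=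
  h.isVectorBundle.linearMap_ext fun n v hv => by
    have := wordOperation_hasDegree Γ R h.hasDegree w l y x hs hl n v hv
    rw [LinearMap.comp_apply, h.isVectorBundle.parity_apply this, LinearMap.smul_apply,
      LinearMap.comp_apply, h.isVectorBundle.parity_apply hv, map_smul, smul_smul, ← signChar_add]
    congr 2
    push_cast
    rw [sub_eq_add_neg, zmod_two_neg, add_comm]

end Single

variable {m : ℕ} {E : Fin m → GradedBundle M} {R : ∀ i, Operations G (E i) (E i)}

theorem factor_length (W : Word m) (i : Fin m) : (W.factor i).length = W.length := by
  simp [Word.factor]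

variable (Γ R) in
/-- The operation `k_{E₁}(w₁) ⊗ ... ⊗ k_{Eₘ}(wₘ)` as a map between tensor products. -/
def tensorWordMap (W : Word m) (l : List G) (y x : M) :
    (⨂[ℝ] i, (E i).Fiber x) →ₗ[ℝ] ⨂[ℝ] i, (E i).Fiber y :=
  gradedTensor (fun i => (E i).parity x) (fun i => wordOperation Γ (R i) (W.factor i) l y x) W.bCount

variable (R) in
/-- The differential of a tensor product of complexes as an endomorphism of the tensor product. -/
def tensorDiff (x : M) : (⨂[ℝ] i, (E i).Fiber x) →ₗ[ℝ] ⨂[ℝ] i, (E i).Fiber x :=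
  ∑ i, diffTerm (fun i => (E i).parity x) (fun i => R i [] x x) i

theorem tensorDifferential_eq (x : M) : tensorDifferential (dM := dM) R x = tensorDiff R x := by
  rw [tensorDifferential, tensorDiff]
  refine Finset.sum_congr rfl fun i _ => ?_
  rw [diffTerm, gradedTensor]
  congr 1
  funext j
  have hsum : (∑ k ∈ Finset.univ.filter (fun k => j < k), (Pi.single i 1 : Fin m → ℕ) k) =
      if j < i then 1 else 0 := by
    simp only [Pi.single_apply]
    rw [Finset.sum_ite_eq']
    simp
  rw [hsum]
  rcases lt_trichotomy j i with h | h | h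
  · simp [h, h.ne, LinearMap.id_comp]
  · subst h; ext; simp
  · ext; simp [h.not_gt, h.ne']

variable (Γ R) in
/-- The operations `k_{E₁} ⊗ ... ⊗ k_{Eₘ}` of elements of `Ωₘ`. -/
def tensorEval (l : List G) (y x : M) :
    Omega m →ₗ[ℝ] (⨂[ℝ] i, (E i).Fiber x) →ₗ[ℝ] ⨂[ℝ] i, (E i).Fiber y :=
  Finsupp.linearCombination ℝ fun W => tensorWordMap Γ R W l y x

theorem tensorEval_single (l : List G) (y x : M) (W : Word m) :
    tensorEval Γ R l y x (Finsupp.single W 1) = tensorWordMap Γ R W l y x := by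
  rw [tensorEval, Finsupp.linearCombination_single, one_smul]

theorem tensorWordMap_faceWord {l : List G} {y x : M} (hs : Γ.IsString l y x) {W : Word m}
    (hl : l.length = W.order + 1) {i : ℕ} (hi : i < W.order) :
    tensorWordMap Γ R (Omega.faceWord i W) l y x =
      tensorWordMap Γ R W (Γ.merge (i + 1) l) y x := by
  rw [tensorWordMap, tensorWordMap]
  congr 1
  · funext j
    have : (Omega.faceWord i W).factor j = (W.factor j).insertIdx i Letter.a := by
      simp [Word.factor, Omega.faceWord, List.map_insertIdx]
    rw [this, wordOperation_insertIdx Γ (R j) _ i l y x hs]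
    · rw [factor_length]; exact hl
    · rw [factor_length]; exact Nat.lt_succ_iff.1 hi
  · funext j; exact Word.bCount_faceWord i W j

variable (hE : ∀ i, IsRepUpToHomotopy Γ (E i) (R i))

include hE

theorem tensorWordMap_circ {l : List G} {y x : M} (hs : Γ.IsString l y x) {U V : Word m}
    (hl : l.length = U.order + V.order) :
    (tensorWordMap Γ R U (l.take U.order) y (Γ.vertex y l U.order) ∘ₗ
      tensorWordMap Γ R V (l.drop U.order) (Γ.vertex y l U.order) x) =
      signChar (pairing (fun i j => j < i) U.parities V.parities) •
        tensorWordMap Γ R (U ++ (fun _ => Letter.c) :: V) l y x := by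
  have hU : U.order = U.length + 1 := rfl
  have hV : V.order = V.length + 1 := rfl
  rw [tensorWordMap, tensorWordMap, tensorWordMap]
  refine (gradedTensor_comp _ _ fun i => (hE i).parity_wordOperation _ (hs.drop (by omega))
    (by rw [factor_length, List.length_drop]; omega)).trans ?_
  congr 2
  · funext i
    have : Word.factor (U ++ (fun _ => Letter.c) :: V) i = U.factor i ++ Letter.c :: V.factor i := by
      simp [Word.factor]
    rw [this, wordOperation_circ Γ (R i) _ _ l y x hs (by rw [factor_length, factor_length]; omega),
      factor_length]
    rfl
  · funext i
    rw [Word.bCount_circ]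
    rfl

theorem tensorWordMap_del {l : List G} {y x : M} (hs : Γ.IsString l y x) {W : Word m}
    (hl : l.length = W.order) :
    (tensorDiff R y ∘ₗ tensorWordMap Γ R W l y x -
      signChar W.bParity • tensorWordMap Γ R W l y x ∘ₗ tensorDiff R x) =
      tensorEval Γ R l y x (Omega.delWord W) := by
  have hW : ∀ i, l.length = (W.factor i).length + 1 := fun i => by rw [factor_length]; exact hl
  rw [tensorDiff, tensorDiff, tensorWordMap]
  refine (sum_diffTerm_commutator (fun i => (hE i).parity_comp x)
    fun i => (hE i).parity_wordOperation _ hs (hW i)).trans ?_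
  rw [Omega.delWord_eq, map_sum]
  refine Finset.sum_congr rfl fun i _ => ?_
  rw [map_smul, Omega.rowSign_eq]
  congr 1
  have e := wordOperation_del Γ (R i) (hE i).equation (W.factor i) l y x hs (hW i)
  refine (congrArg _ e).trans ?_
  rw [← delLetters_map, tensorEval]
  symm
  refine Omega.linearCombination_delRowWord i fun W' hW' hf => ?_
  rw [gradedTensorFactor_apply, tensorWordMap]
  refine gradedTensor_congr (fun i => (hE i).isVectorBundle.parity_mul_self x) (fun j => ?_) fun j => ?_
  · by_cases hj : j = i
    · subst hj; simp
    · rw [Function.update_of_ne hj, hf j hj]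
  · have := congrFun (Omega.parities_of_mem_rowShift hW') j
    refine this.trans ?_
    by_cases hj : j = i
    · subst hj
      simp only [Pi.add_apply, Pi.single_eq_same, Word.parities]
      rw [show (((-1 : ℤ)) : ZMod 2) = 1 by decide]
      push_cast
      rfl
    · simp only [Pi.add_apply, Pi.single_eq_of_ne hj, add_zero]
      rfl

theorem tensorDiff_comp_self (x : M) :
    tensorDiff R x ∘ₗ tensorDiff R x = 0 := by
  rw [tensorDiff]
  exact sum_diffTerm_comp_self (fun i => (hE i).isVectorBundle.parity_mul_self x)
    (fun i => (hE i).parity_comp x) fun i => (hE i).comp_self x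

omit hE

variable (Γ R) in
/-- The operations of a formal sum of elements of `Ωₘ`. -/
def completionOperations (z : Completion m) :
    Operations G (GradedBundle.tensor (d := dM) E) (GradedBundle.tensor (d := dM) E) :=
  fun l y x => tensorEval Γ R l y x (z l.length)

theorem tensorEval_faceTot {n : ℤ} {z : Completion m} (hz : z.HasDegree n) {l : List G} {y x : M}
    (hs : Γ.IsString l y x) : tensorEval Γ R l y x (z.faceTot l.length) =
      signChar n • (completionOperations Γ R z).mergeSum Γ l y x := by
  rcases h : l.length with _ | k
  · rw [Operations.mergeSum, h]; simp [Completion.faceTot]; rfl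
  · have e : tensorEval Γ R l y x ∘ₗ Omega.signedFace = tensorEval Γ R l y x ∘ₗ Omega.signedFace := rfl
    rw [Completion.faceTot, Operations.mergeSum, h]
    rw [Finset.sum_Ico_eq_sum_range]
    simp only [Nat.add_sub_cancel]
    have key : ∀ W : Word m, W.order = k → (W.degree : ℤ) = n - k →
        tensorEval Γ R l y x (Omega.signedFace (Finsupp.single W 1)) =
        (signChar n • ∑ i ∈ Finset.range k, ((-1 : ℝ) ^ (1 + i)) •
          tensorEval Γ R (Γ.merge (1 + i) l) y x) (Finsupp.single W 1) := by
      intro W hW hd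
      rw [Omega.signedFace_single, map_sum, LinearMap.smul_apply, LinearMap.sum_apply, hW,
        Finset.smul_sum]
      refine Finset.sum_congr rfl fun i hi => ?_
      have hi : i < k := by simpa using hi
      rw [map_smul, tensorEval_single, LinearMap.smul_apply, tensorEval_single,
        tensorWordMap_faceWord hs (by omega) (by omega), smul_smul, neg_one_pow_eq_signChar,
        ← signChar_add, add_comm 1 i]
      congr 2
      have : W.totalDegree = n := by rw [Word.totalDegree, hW, hd]; ring
      rw [← this, Word.cast_totalDegree, hW]
      push_cast; ring
    have := Omega.eq_of_mem_supported (f := tensorEval Γ R l y x ∘ₗ Omega.signedFace) (hz k)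
      fun W hW => key W hW.1 hW.2
    refine this.trans ?_
    rw [LinearMap.smul_apply, LinearMap.sum_apply]
    congr 1
    refine Finset.sum_congr rfl fun i hi => ?_
    have hi : i < k := by simpa using hi
    rw [LinearMap.smul_apply]
    congr 1
    rw [completionOperations, add_comm 1 i, Γ.length_merge (by omega), h]
    rfl

include hE

theorem tensorEval_del {n : ℤ} {z : Completion m} (hz : z.HasDegree n) {l : List G} {y x : M}
    (hs : Γ.IsString l y x) : tensorEval Γ R l y x (Omega.del (z l.length)) =
      (tensorDiff R y ∘ₗ tensorEval Γ R l y x (z l.length) -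
        signChar (n + l.length) • tensorEval Γ R l y x (z l.length) ∘ₗ tensorDiff R x) := by
  refine Omega.eq_of_mem_supported (f := tensorEval Γ R l y x ∘ₗ Omega.del)
    (g := LinearMap.compRight ℝ (tensorDiff R y) ∘ₗ tensorEval Γ R l y x -
      signChar (n + l.length) • LinearMap.lcomp ℝ _ (tensorDiff R x) ∘ₗ tensorEval Γ R l y x) (hz l.length) ?_
  intro W hW
  have e := tensorWordMap_del hE hs hW.1.symm
  rw [LinearMap.comp_apply, Omega.del_single, ← e]
  have hp : W.bParity = n + l.length := by
    rw [← Word.cast_degree, hW.2]; push_cast; rw [sub_eq_add_neg, zmod_two_neg]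
  rw [hp]
  simp only [LinearMap.sub_apply, LinearMap.comp_apply, LinearMap.smul_apply, tensorEval_single]
  rfl

theorem tensorEval_star {n n' : ℤ} {z z' : Completion m} (hz : z.HasDegree n) (hz' : z'.HasDegree n')
    {l : List G} {y x : M} (hs : Γ.IsString l y x) :
    tensorEval Γ R l y x (z.star z' l.length) =
      ∑ j ∈ Finset.range (l.length + 1), signChar (j * n') •
        Operations.comp Γ (completionOperations Γ R z) (completionOperations Γ R z') j l y x := by
  rw [Completion.star_apply, Finset.Nat.sum_antidiagonal_eq_sum_range_succ_mk, map_sum]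
  refine Finset.sum_congr rfl fun j hj => ?_
  have hj : j ≤ l.length := by simpa [Nat.lt_succ_iff] using hj
  set v := Γ.vertex y l j with hv
  have h1 : (l.take j).length = j := by simp [hj]
  have h2 : (l.drop j).length = l.length - j := by simp
  have e : Operations.comp Γ (completionOperations Γ R z) (completionOperations Γ R z') j l y x =
      tensorEval Γ R (l.take j) y v (z j) ∘ₗ tensorEval Γ R (l.drop j) v x (z' (l.length - j)) := by
    rw [Operations.comp, completionOperations, completionOperations, h1, h2]; rfl
  rw [e]
  let B : Omega m →ₗ[ℝ] Omega m →ₗ[ℝ] (⨂[ℝ] i, (E i).Fiber x) →ₗ[ℝ] ⨂[ℝ] i, (E i).Fiber y :=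
    ((LinearMap.llcomp ℝ _ _ _) ∘ₗ tensorEval Γ R (l.take j) y v).compl₂
      (tensorEval Γ R (l.drop j) v x)
  refine Omega.eq_of_mem_supported (f := tensorEval Γ R l y x ∘ₗ Omega.star.flip (z' (l.length - j)))
    (g := signChar (j * n') • B.flip (z' (l.length - j))) (hz j) fun U hU => ?_
  refine Omega.eq_of_mem_supported (f := tensorEval Γ R l y x ∘ₗ Omega.star (Finsupp.single U 1))
    (g := signChar (j * n') • B (Finsupp.single U 1)) (hz' (l.length - j)) fun V hV => ?_
  have hc := tensorWordMap_circ hE hs (U := U) (V := V) (by rw [hU.1, hV.1]; omega)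
  rw [hU.1] at hc
  rw [LinearMap.comp_apply, Omega.star_single_single, map_smul, tensorEval_single, LinearMap.smul_apply]
  have hB : B (Finsupp.single U 1) (Finsupp.single V 1) =
      (tensorWordMap Γ R U (l.take j) y v ∘ₗ tensorWordMap Γ R V (l.drop j) v x) := by
    simp only [B, LinearMap.compl₂_apply, LinearMap.comp_apply, tensorEval_single]
    rfl
  rw [hB, hc, smul_smul, ← signChar_add]
  congr 2
  have : V.totalDegree = n' := by rw [Word.totalDegree, hV.1, hV.2]; ring
  rw [← this, Word.cast_totalDegree, hU.1]

end TensorOperations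
end RuthTensor

namespace RuthTensor

/-! ## The structure equations -/

section Extend

variable {dM dG : ℕ}
  {M : Type*} [TopologicalSpace M] [ChartedSpace (EuclideanSpace ℝ (Fin dM)) M]
  [IsManifold (𝓡 dM) ∞ M]
  {G : Type*} [TopologicalSpace G] [ChartedSpace (EuclideanSpace ℝ (Fin dG)) G]
  [IsManifold (𝓡 dG) ∞ G]
  {Γ : LieGroupoid dM dG M G}

theorem GradedBundle.diagonal_self (F : GradedBundle M) (D : ∀ x, F.Fiber x →ₗ[ℝ] F.Fiber x) (x : M) :
    F.diagonal D x x = D x := by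
  simp [GradedBundle.diagonal]

namespace Operations

variable {F : GradedBundle M}

/-- The family of operations given by `D` on strings of length zero and by `c` on other strings. -/
def extend (D : ∀ x, F.Fiber x →ₗ[ℝ] F.Fiber x) (c : Operations G F F) : Operations G F F
  | [], y, x => F.diagonal D y x
  | g :: l, y, x => c (g :: l) y x

theorem extend_nil (D : ∀ x, F.Fiber x →ₗ[ℝ] F.Fiber x) (c : Operations G F F) (x : M) :
    extend D c [] x x = D x := F.diagonal_self D x

theorem extend_of_ne_nil (D : ∀ x, F.Fiber x →ₗ[ℝ] F.Fiber x) (c : Operations G F F) {l : List G}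
    (hl : l ≠ []) : extend D c l = c l := by
  cases l with
  | nil => exact absurd rfl hl
  | cons g l => rfl

theorem mergeSum_extend (D : ∀ x, F.Fiber x →ₗ[ℝ] F.Fiber x) (c : Operations G F F) (l : List G)
    (y x : M) : (extend D c).mergeSum Γ l y x = c.mergeSum Γ l y x := by
  refine Finset.sum_congr rfl fun j hj => ?_
  obtain ⟨h1, h2⟩ := Finset.mem_Ico.1 hj
  obtain ⟨j, rfl⟩ : ∃ i, j = i + 1 := ⟨j - 1, by omega⟩
  rw [extend_of_ne_nil]
  refine List.ne_nil_of_length_pos ?_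
  rw [Γ.length_merge h2]; omega

theorem sum_comp_extend {D D' : ∀ x, F.Fiber x →ₗ[ℝ] F.Fiber x} {c c' : Operations G F F}
    (hc : ∀ y x, c [] y x = 0) (hc' : ∀ y x, c' [] y x = 0) {l : List G} {y x : M}
    (hs : Γ.IsString l y x) (hl : l ≠ []) (s : ℕ → ℝ) :
    ∑ j ∈ Finset.range (l.length + 1), s j • comp Γ (extend D c) (extend D' c') j l y x =
      s 0 • D y ∘ₗ c' l y x + s l.length • c l y x ∘ₗ D' x +
        ∑ j ∈ Finset.range (l.length + 1), s j • comp Γ c c' j l y x := by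
  have key : ∀ j ∈ Finset.range (l.length + 1), s j • comp Γ (extend D c) (extend D' c') j l y x =
      (if j = 0 then s 0 • D y ∘ₗ c' l y x else 0) +
      (if j = l.length then s l.length • c l y x ∘ₗ D' x else 0) + s j • comp Γ c c' j l y x := by
    intro j hj
    have hlen : 0 < l.length := List.length_pos_iff.2 hl
    have hj : j ≤ l.length := by simpa [Nat.lt_succ_iff] using hj
    by_cases h0 : j = 0
    · subst h0
      rw [if_pos rfl, if_neg hlen.ne, comp, comp, Γ.vertex_zero, List.take_zero, List.drop_zero,
        extend_nil, extend_of_ne_nil _ _ hl, hc, LinearMap.zero_comp]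
      simp
    · by_cases h1 : j = l.length
      · subst h1
        rw [if_neg h0, if_pos rfl, comp, comp, Γ.vertex_length hs, List.take_length, List.drop_length,
          extend_nil, extend_of_ne_nil _ _ hl, hc', LinearMap.comp_zero]
        simp
      · rw [if_neg h0, if_neg h1, comp, comp, extend_of_ne_nil, extend_of_ne_nil]
        · simp
        · exact List.ne_nil_of_length_pos (by simp; omega)
        · exact List.ne_nil_of_length_pos (by simp; omega)
  rw [Finset.sum_congr rfl key, Finset.sum_add_distrib, Finset.sum_add_distrib,
    Finset.sum_ite_eq', Finset.sum_ite_eq', if_pos (by simp), if_pos (by simp)]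

theorem extend_representation_equation {D : ∀ x, F.Fiber x →ₗ[ℝ] F.Fiber x} {c : Operations G F F}
    (hc : ∀ y x, c [] y x = 0) (hD : ∀ x, D x ∘ₗ D x = 0) {l : List G} {y x : M}
    (hs : Γ.IsString l y x)
    (h : D y ∘ₗ c l y x - signChar (((1 : ℤ) : ZMod 2) + l.length) • c l y x ∘ₗ D x +
      signChar ((1 : ℤ) : ZMod 2) • c.mergeSum Γ l y x +
      ∑ j ∈ Finset.range (l.length + 1), signChar (j * ((1 : ℤ) : ZMod 2)) • comp Γ c c j l y x = 0) :
    (extend D c).mergeSum Γ l y x =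
      ∑ j ∈ Finset.range (l.length + 1), ((-1 : ℝ) ^ j) • comp Γ (extend D c) (extend D c) j l y x := by
  by_cases hl : l = []
  · subst hl
    obtain rfl : y = x := hs
    simp only [mergeSum, comp, LieGroupoid.vertex, extend_nil, List.length_nil, zero_add,
      Finset.range_one, Finset.sum_singleton, pow_zero, one_smul, List.take_nil, List.drop_nil]
    exact (hD y).symm
  · rw [mergeSum_extend, sum_comp_extend hc hc hs hl]
    simp only [Int.cast_one, mul_one, signChar_add, signChar_one, neg_one_pow_eq_signChar,
      Nat.cast_zero, signChar_zero, neg_mul, one_mul, neg_smul, one_smul] at h ⊢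
    rw [← sub_eq_zero, ← neg_eq_zero, ← h]
    abel

theorem extend_morphism_equation {D : ∀ x, F.Fiber x →ₗ[ℝ] F.Fiber x} {c c' z : Operations G F F}
    (hc : ∀ y x, c [] y x = 0) (hc' : ∀ y x, c' [] y x = 0) (hz : ∀ y x, z [] y x = 0)
    {l : List G} {y x : M} (hs : Γ.IsString l y x)
    (h : D y ∘ₗ z l y x - signChar (((0 : ℤ) : ZMod 2) + l.length) • z l y x ∘ₗ D x +
      signChar ((0 : ℤ) : ZMod 2) • z.mergeSum Γ l y x = c l y x - c' l y x +
      ∑ j ∈ Finset.range (l.length + 1), signChar (j * ((1 : ℤ) : ZMod 2)) • comp Γ z c j l y x -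
      ∑ j ∈ Finset.range (l.length + 1), signChar (j * ((0 : ℤ) : ZMod 2)) • comp Γ c' z j l y x) :
    ∑ j ∈ Finset.range (l.length + 1), ((-1 : ℝ) ^ j) •
        comp Γ (extend (fun _ => LinearMap.id) z) (extend D c) j l y x =
      ∑ j ∈ Finset.range (l.length + 1),
        comp Γ (extend D c') (extend (fun _ => LinearMap.id) z) j l y x +
      (extend (fun _ => LinearMap.id) z).mergeSum Γ l y x := by
  by_cases hl : l = []
  · subst hl
    obtain rfl : y = x := hs
    simp [mergeSum, comp, LieGroupoid.vertex, extend_nil]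
    rfl
  · have h2 := sum_comp_extend (D := D) (D' := fun _ => LinearMap.id) hc' hz hs hl fun _ => 1
    simp only [one_smul] at h2
    rw [mergeSum_extend, sum_comp_extend hz hc hs hl, h2]
    simp only [Int.cast_one, Int.cast_zero, mul_one, mul_zero, zero_add,
      neg_one_pow_eq_signChar, Nat.cast_zero, signChar_zero, one_smul, LinearMap.id_comp,
      LinearMap.comp_id] at h ⊢
    rw [← sub_eq_zero] at h ⊢
    rw [← neg_eq_zero, ← h]
    abel

end Operations

end Extend

section TensorEquations

variable {dM dG : ℕ}
  {M : Type*} [TopologicalSpace M] [ChartedSpace (EuclideanSpace ℝ (Fin dM)) M]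
  [IsManifold (𝓡 dM) ∞ M]
  {G : Type*} [TopologicalSpace G] [ChartedSpace (EuclideanSpace ℝ (Fin dG)) G]
  [IsManifold (𝓡 dG) ∞ G]
  {Γ : LieGroupoid dM dG M G} {m : ℕ} {E : Fin m → GradedBundle M}
  {R : ∀ i, Operations G (E i) (E i)}

theorem tensorOperations_eq_extend (η : Completion m) :
    tensorOperations Γ η R = Operations.extend (F := GradedBundle.tensor (d := dM) E)
      (tensorDifferential R) (completionOperations Γ R η) := by
  funext l y x
  cases l with
  | nil => rfl
  | cons g l => rfl

variable (Γ R) in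
/-- The operations of `1 + z`. -/
def gaugeOperations (z : Completion m) :
    Operations G (GradedBundle.tensor (d := dM) E) (GradedBundle.tensor (d := dM) E) :=
  Operations.extend (fun _ => LinearMap.id) (completionOperations Γ R z)

theorem completionOperations_nil {n : ℤ} {z : Completion m} (hz : z.HasDegree n) (y x : M) :
    completionOperations (E := E) Γ R z [] y x = 0 :=
  (congrArg (tensorEval Γ R [] y x) hz.apply_zero).trans (map_zero _)

theorem tensorOperations_equation (hE : ∀ i, IsRepUpToHomotopy Γ (E i) (R i)) {η : Completion m}
    (hη : η.IsUniversalMC) {l : List G} {y x : M} (hs : Γ.IsString l y x) :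
    (tensorOperations Γ η R).mergeSum Γ l y x =
      ∑ j ∈ Finset.range (l.length + 1), ((-1 : ℝ) ^ j) •
        Operations.comp Γ (tensorOperations Γ η R) (tensorOperations Γ η R) j l y x := by
  rw [tensorOperations_eq_extend]
  refine Operations.extend_representation_equation (completionOperations_nil hη.1.1)
    (fun x => ?_) hs ?_
  · rw [tensorDifferential_eq]; exact tensorDiff_comp_self hE x
  · rw [tensorDifferential_eq, tensorDifferential_eq]
    have h := congrArg (tensorEval Γ R l y x) (congrFun hη.1.2 l.length)
    have e : tensorEval Γ R l y x (η.dTot l.length) +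
      tensorEval Γ R l y x (η.star η l.length) = 0 := by
      rw [← map_add]; exact h.trans (map_zero _)
    rw [Completion.dTot_apply, map_add, tensorEval_del hE hη.1.1 hs, tensorEval_faceTot hη.1.1 hs,
      tensorEval_star hE hη.1.1 hη.1.1 hs] at e
    exact e

theorem gaugeOperations_equation (hE : ∀ i, IsRepUpToHomotopy Γ (E i) (R i)) {η θ z : Completion m}
    (hη : η.HasDegree 1) (hθ : θ.HasDegree 1) (hz : z.HasDegree 0)
    (h : z.dTot = η - θ + z.star η - θ.star z) {l : List G} {y x : M} (hs : Γ.IsString l y x) :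
    ∑ j ∈ Finset.range (l.length + 1), ((-1 : ℝ) ^ j) •
        Operations.comp Γ (gaugeOperations Γ R z) (tensorOperations Γ η R) j l y x =
      ∑ j ∈ Finset.range (l.length + 1),
        Operations.comp Γ (tensorOperations Γ θ R) (gaugeOperations Γ R z) j l y x +
      (gaugeOperations Γ R z).mergeSum Γ l y x := by
  rw [tensorOperations_eq_extend, tensorOperations_eq_extend]
  refine Operations.extend_morphism_equation (completionOperations_nil hη)
    (completionOperations_nil hθ) (completionOperations_nil hz) hs ?_
  rw [tensorDifferential_eq, tensorDifferential_eq]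
  have e : tensorEval Γ R l y x (z.dTot l.length) = tensorEval Γ R l y x (η l.length) -
      tensorEval Γ R l y x (θ l.length) + tensorEval Γ R l y x (z.star η l.length) -
      tensorEval Γ R l y x (θ.star z l.length) := by
    rw [← map_sub, ← map_add, ← map_sub]; exact congrArg _ (congrFun h l.length)
  rw [Completion.dTot_apply, map_add, tensorEval_del hE hz hs, tensorEval_faceTot hz hs,
    tensorEval_star hE hz hη hs, tensorEval_star hE hθ hz hs] at e
  exact e

end TensorEquations
end RuthTensor

namespace RuthTensor

/-! ## Smooth families of maps between fibres -/

namespace GradedBundle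

section SmoothAlong

variable {d n : ℕ} {M : Type*} [TopologicalSpace M] [ChartedSpace (EuclideanSpace ℝ (Fin d)) M]
  {E E' E'' : GradedBundle M} {x y z : EuclideanSpace ℝ (Fin n) → M} {p : EuclideanSpace ℝ (Fin n)}

theorem SmoothAlongAt.of_fintype {ι : Type*} [Fintype ι] {ξ : ∀ q, E.Fiber (x q)}
    (c : ι → EuclideanSpace ℝ (Fin n) → ℝ) (σ : ι → ∀ x, E.Fiber x)
    (hc : ∀ i, ContDiffAt ℝ ∞ (c i) p) (hσ : ∀ i, E.SmoothAt (σ i) (x p))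
    (h : ∀ᶠ q in 𝓝 p, ξ q = ∑ i, c i q • σ i (x q)) : E.SmoothAlongAt x ξ p := by
  refine ⟨Fintype.card ι, fun i => c ((Fintype.equivFin ι).symm i),
    fun i => σ ((Fintype.equivFin ι).symm i), fun i => hc _, fun i => hσ _, ?_⟩
  filter_upwards [h] with q hq
  rw [hq]
  exact (Equiv.sum_comp (Fintype.equivFin ι).symm fun i => c i q • σ i (x q)).symm

theorem SmoothAlongAt.congr {ξ ξ' : ∀ q, E.Fiber (x q)} (h : E.SmoothAlongAt x ξ p)
    (e : ∀ᶠ q in 𝓝 p, ξ' q = ξ q) : E.SmoothAlongAt x ξ' p := by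
  obtain ⟨N, c, σ, hc, hσ, h⟩ := h
  refine ⟨N, c, σ, hc, hσ, ?_⟩
  filter_upwards [h, e] with q h1 h2
  rw [h2, h1]

theorem SmoothAlongAt.pullback {σ : ∀ x, E.Fiber x} (h : E.SmoothAt σ (x p)) :
    E.SmoothAlongAt x (fun q => σ (x q)) p :=
  ⟨1, fun _ _ => 1, fun _ => σ, fun _ => contDiffAt_const, fun _ => h, by simp⟩

theorem SmoothAlongAt.zero : E.SmoothAlongAt x (fun _ => 0) p :=
  ⟨0, Fin.elim0, Fin.elim0, fun i => i.elim0, fun i => i.elim0, by simp⟩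

theorem SmoothAlongAt.add {ξ ξ' : ∀ q, E.Fiber (x q)} (h : E.SmoothAlongAt x ξ p)
    (h' : E.SmoothAlongAt x ξ' p) : E.SmoothAlongAt x (fun q => ξ q + ξ' q) p := by
  obtain ⟨N, c, σ, hc, hσ, h⟩ := h
  obtain ⟨N', c', σ', hc', hσ', h'⟩ := h'
  refine SmoothAlongAt.of_fintype (Sum.elim c c') (Sum.elim σ σ') ?_ ?_ ?_
  · rintro (i | i)
    exacts [hc i, hc' i]
  · rintro (i | i)
    exacts [hσ i, hσ' i]
  · filter_upwards [h, h'] with q h1 h2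
    rw [h1, h2, Fintype.sum_sum_type]
    rfl

theorem SmoothAlongAt.sum {ι : Type*} (s : Finset ι) {ξ : ι → ∀ q, E.Fiber (x q)}
    (h : ∀ i ∈ s, E.SmoothAlongAt x (ξ i) p) : E.SmoothAlongAt x (fun q => ∑ i ∈ s, ξ i q) p := by
  classical
  induction s using Finset.induction_on with
  | empty => simpa using SmoothAlongAt.zero
  | insert i s hi ih =>
    simp only [Finset.sum_insert hi]
    exact (h i (by simp)).add (ih fun j hj => h j (by simp [hj]))

theorem SmoothAlongAt.smul {ξ : ∀ q, E.Fiber (x q)} {c : EuclideanSpace ℝ (Fin n) → ℝ}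
    (hc : ContDiffAt ℝ ∞ c p) (h : E.SmoothAlongAt x ξ p) :
    E.SmoothAlongAt x (fun q => c q • ξ q) p := by
  obtain ⟨N, c', σ, hc', hσ, h⟩ := h
  refine ⟨N, fun i q => c q * c' i q, σ, fun i => hc.mul (hc' i), hσ, ?_⟩
  filter_upwards [h] with q h1
  rw [h1, Finset.smul_sum]
  exact Finset.sum_congr rfl fun i _ => smul_smul _ _ _

/-- A family of maps `E_{x(q)} → E'_{y(q)}` that maps smooth sections to smooth sections. -/
def SmoothFamilyAt (E E' : GradedBundle M) (x y : EuclideanSpace ℝ (Fin n) → M)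
    (T : ∀ q, E.Fiber (x q) →ₗ[ℝ] E'.Fiber (y q)) (p : EuclideanSpace ℝ (Fin n)) : Prop :=
  ∀ ξ : ∀ q, E.Fiber (x q), E.SmoothAlongAt x ξ p → E'.SmoothAlongAt y (fun q => T q (ξ q)) p

theorem SmoothFamilyAt.congr {T T' : ∀ q, E.Fiber (x q) →ₗ[ℝ] E'.Fiber (y q)}
    (h : SmoothFamilyAt E E' x y T p) (e : ∀ q, T' q = T q) : SmoothFamilyAt E E' x y T' p := by
  rwa [show T' = T from funext e]

theorem SmoothFamilyAt.comp {T : ∀ q, E'.Fiber (y q) →ₗ[ℝ] E''.Fiber (z q)}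
    {S : ∀ q, E.Fiber (x q) →ₗ[ℝ] E'.Fiber (y q)} (hT : SmoothFamilyAt E' E'' y z T p)
    (hS : SmoothFamilyAt E E' x y S p) : SmoothFamilyAt E E'' x z (fun q => T q ∘ₗ S q) p :=
  fun ξ hξ => hT _ (hS ξ hξ)

theorem SmoothFamilyAt.id : SmoothFamilyAt E E x x (fun _ => LinearMap.id) p := fun _ hξ => hξ

theorem SmoothFamilyAt.pow {T : ∀ q, Module.End ℝ (E.Fiber (x q))} (hT : SmoothFamilyAt E E x x T p)
    (a : ℕ) : SmoothFamilyAt E E x x (fun q => T q ^ a) p := by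
  induction a with
  | zero => exact SmoothFamilyAt.id
  | succ a ih => simp only [pow_succ, Module.End.mul_eq_comp]; exact ih.comp hT

theorem SmoothFamilyAt.sum {ι : Type*} (s : Finset ι) {T : ι → ∀ q, E.Fiber (x q) →ₗ[ℝ] E'.Fiber (y q)}
    (h : ∀ i ∈ s, SmoothFamilyAt E E' x y (T i) p) :
    SmoothFamilyAt E E' x y (fun q => ∑ i ∈ s, T i q) p := fun ξ hξ => by
  simp only [LinearMap.sum_apply]
  exact SmoothAlongAt.sum s fun i hi => h i hi ξ hξ

end SmoothAlong

/-! ### Tensor products -/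

section Tensor

variable {d n m : ℕ} {M : Type*} [TopologicalSpace M] [ChartedSpace (EuclideanSpace ℝ (Fin d)) M]
  {E E' : Fin m → GradedBundle M} {x y : EuclideanSpace ℝ (Fin n) → M} {p : EuclideanSpace ℝ (Fin n)}

theorem tprod_sum_smul {ι : Fin m → Type*} [∀ i, Fintype (ι i)] {V : Fin m → Type*}
    [∀ i, AddCommGroup (V i)] [∀ i, Module ℝ (V i)] (c : ∀ i, ι i → ℝ) (v : ∀ i, ι i → V i) :
    PiTensorProduct.tprod ℝ (fun i => ∑ k, c i k • v i k) =
      ∑ k : ∀ i, ι i, (∏ i, c i (k i)) • PiTensorProduct.tprod ℝ (fun i => v i (k i)) := by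
  classical
  rw [MultilinearMap.map_sum]
  exact Finset.sum_congr rfl fun k _ => MultilinearMap.map_smul_univ _ _ _

theorem tensor_smoothAt_tprod {s : ∀ i, ∀ z, (E i).Fiber z} {z : M}
    (hs : ∀ i, (E i).SmoothAt (s i) z) :
    (tensor (d := d) E).SmoothAt (fun z => PiTensorProduct.tprod ℝ fun i => s i z) z :=
  ⟨1, fun _ _ => 1, fun _ => s, fun _ => contMDiffAt_const, fun _ => hs, by simp⟩

theorem tensor_smoothAlongAt_tprod {ξ : ∀ i, ∀ q, (E i).Fiber (x q)}
    (h : ∀ i, (E i).SmoothAlongAt x (ξ i) p) :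
    (tensor (d := d) E).SmoothAlongAt x (fun q => PiTensorProduct.tprod ℝ fun i => ξ i q) p := by
  choose N c σ hc hσ h using h
  refine SmoothAlongAt.of_fintype (ι := ∀ i, Fin (N i)) (fun k q => ∏ i, c i (k i) q)
    (fun k z => PiTensorProduct.tprod ℝ fun i => σ i (k i) z)
    (fun k => (ContMDiffAt.prod fun i _ => (hc i (k i)).contMDiffAt).contDiffAt)
    (fun k => tensor_smoothAt_tprod fun i => hσ i (k i)) ?_
  filter_upwards [Filter.eventually_all.2 h] with q hq
  exact (congrArg (PiTensorProduct.tprod ℝ) (funext hq)).trans (tprod_sum_smul _ _)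

theorem tensor_smoothAlongAt_expand (hx : ContMDiffAt (𝓡 n) (𝓡 d) ∞ x p)
    {ξ : ∀ q, ⨂[ℝ] i, (E i).Fiber (x q)} (h : (tensor (d := d) E).SmoothAlongAt x ξ p) :
    ∃ (ι : Type) (_ : Fintype ι) (c : ι → EuclideanSpace ℝ (Fin n) → ℝ) (s : ι → ∀ i z, (E i).Fiber z),
      (∀ a, ContDiffAt ℝ ∞ (c a) p) ∧ (∀ a i, (E i).SmoothAt (s a i) (x p)) ∧
      ∀ᶠ q in 𝓝 p, ξ q = ∑ a, c a q • PiTensorProduct.tprod ℝ fun i => s a i (x q) := by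
  obtain ⟨N, c, σ, hc, hσ, h⟩ := h
  choose N' c' s hc' hs h' using hσ
  refine ⟨Σ a : Fin N, Fin (N' a), inferInstance, fun a q => c a.1 q * c' a.1 a.2 (x q),
    fun a => s a.1 a.2, fun a => (hc a.1).mul ((hc' a.1 a.2).comp p hx).contDiffAt,
    fun a => hs a.1 a.2, ?_⟩
  filter_upwards [h, hx.continuousAt.eventually (Filter.eventually_all.2 h')] with q h1 h2
  rw [Fintype.sum_sigma]
  refine h1.trans (Finset.sum_congr rfl fun a _ => ?_)
  refine (congrArg (c a q • ·) (h2 a)).trans ?_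
  refine (Finset.smul_sum (N := ⨂[ℝ] i, (E i).Fiber (x q))).trans (Finset.sum_congr rfl fun b _ => ?_)
  exact smul_smul _ _ _

theorem SmoothFamilyAt.map {T : ∀ i, ∀ q, (E i).Fiber (x q) →ₗ[ℝ] (E' i).Fiber (y q)}
    (hx : ContMDiffAt (𝓡 n) (𝓡 d) ∞ x p) (h : ∀ i, SmoothFamilyAt (E i) (E' i) x y (T i) p) :
    SmoothFamilyAt (tensor (d := d) E) (tensor (d := d) E') x y
      (fun q => PiTensorProduct.map fun i => T i q) p := by
  intro ξ hξ
  obtain ⟨ι, _, c, s, hc, hs, e⟩ := tensor_smoothAlongAt_expand hx hξ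
  refine (SmoothAlongAt.sum Finset.univ fun a _ => SmoothAlongAt.smul (hc a)
    (tensor_smoothAlongAt_tprod (d := d) fun i =>
      h i _ (SmoothAlongAt.pullback (x := x) (hs a i)))).congr ?_
  filter_upwards [e] with q hq
  refine (congrArg _ hq).trans ((map_sum _ _ _).trans (Finset.sum_congr rfl fun a _ => ?_))
  refine (map_smul _ _ _).trans (congrArg (c a q • ·) ?_)
  exact PiTensorProduct.map_tprod _ _

end Tensor

end GradedBundle
end RuthTensor

namespace RuthTensor

/-! ## Frames -/

namespace GradedBundle

section Frame

variable {d n : ℕ} {M : Type*} [TopologicalSpace M] [ChartedSpace (EuclideanSpace ℝ (Fin d)) M]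
  {E : GradedBundle M}

/-- The homogeneous sections `e i` form a frame of the graded bundle `E` over `U`. -/
structure IsFrame (d : ℕ) {M : Type*} [TopologicalSpace M] [ChartedSpace (EuclideanSpace ℝ (Fin d)) M]
    (E : GradedBundle M) (U : Set M) {ι : Type*} [Fintype ι] (deg : ι → ℤ)
    (e : ι → ∀ x, E.Fiber x) : Prop where
  linearIndependent : ∀ x ∈ U, LinearIndependent ℝ fun i => e i x
  span_eq : ∀ x ∈ U, Submodule.span ℝ (Set.range fun i => e i x) = ⊤
  grading_eq : ∀ x ∈ U, ∀ n : ℤ,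
    E.grading x n = Submodule.span ℝ ((fun i => e i x) '' {i | deg i = n})
  smoothAt_iff : ∀ (σ : ∀ x, E.Fiber x), ∀ x ∈ U, E.SmoothAt σ x ↔
    ∃ c : ι → M → ℝ, (∀ i, ContMDiffAt (𝓡 d) 𝓘(ℝ) ∞ (c i) x) ∧ ∀ᶠ z in 𝓝 x, σ z = ∑ i, c i z • e i z

theorem IsVectorBundle.exists_isFrame (hE : E.IsVectorBundle (d := d)) (x₀ : M) :
    ∃ U : Set M, IsOpen U ∧ x₀ ∈ U ∧ ∃ (r : ℕ) (deg : Fin r → ℤ) (e : Fin r → ∀ x, E.Fiber x),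
      IsFrame d E U deg e := by
  obtain ⟨U, hU, hx, r, deg, e, h, h'⟩ := hE x₀
  exact ⟨U, hU, hx, r, deg, e, fun x hx => (h x hx).1, fun x hx => (h x hx).2.1,
    fun x hx => (h x hx).2.2, h'⟩

theorem IsVectorBundle.of_isFrame (h : ∀ x₀ : M, ∃ U : Set M, IsOpen U ∧ x₀ ∈ U ∧
    ∃ (ι : Type) (_ : Fintype ι) (deg : ι → ℤ) (e : ι → ∀ x, E.Fiber x), IsFrame d E U deg e) :
    E.IsVectorBundle (d := d) := by
  intro x₀
  obtain ⟨U, hU, hx, ι, _, deg, e, h⟩ := h x₀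
  let f := Fintype.equivFin ι
  refine ⟨U, hU, hx, Fintype.card ι, fun i => deg (f.symm i), fun i => e (f.symm i),
    fun x hx => ⟨(h.linearIndependent x hx).comp _ f.symm.injective, ?_, fun n => ?_⟩,
    fun σ x hx => ?_⟩
  · rw [← h.span_eq x hx, ← f.symm.surjective.range_comp fun i => e i x]
    rfl
  · rw [h.grading_eq x hx]
    congr 1
    ext v
    constructor
    · rintro ⟨i, hi, rfl⟩
      exact ⟨f i, by simpa using hi, by simp⟩
    · rintro ⟨i, hi, rfl⟩
      exact ⟨f.symm i, hi, rfl⟩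
  · rw [h.smoothAt_iff σ x hx]
    constructor
    · rintro ⟨c, hc, hs⟩
      refine ⟨fun i => c (f.symm i), fun i => hc _, ?_⟩
      filter_upwards [hs] with z hz
      rw [hz]
      exact (Equiv.sum_comp f.symm fun i => c i z • e i z).symm
    · rintro ⟨c, hc, hs⟩
      refine ⟨fun i => c (f i), fun i => hc _, ?_⟩
      filter_upwards [hs] with z hz
      rw [hz, ← Equiv.sum_comp f.symm]
      simp

theorem IsFrame.mem_grading {U : Set M} {ι : Type*} [Fintype ι] {deg : ι → ℤ} {e : ι → ∀ x, E.Fiber x}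
    (h : IsFrame d E U deg e) {x : M} (hx : x ∈ U) (i : ι) : e i x ∈ E.grading x (deg i) := by
  rw [h.grading_eq x hx]
  exact Submodule.subset_span ⟨i, rfl, rfl⟩

theorem IsFrame.smoothAt {U : Set M} {ι : Type*} [Fintype ι] {deg : ι → ℤ} {e : ι → ∀ x, E.Fiber x}
    (h : IsFrame d E U deg e) {x : M} (hx : x ∈ U) (i : ι) : E.SmoothAt (e i) x := by
  classical
  rw [h.smoothAt_iff _ x hx]
  exact ⟨fun j _ => if j = i then 1 else 0, fun j => contMDiffAt_const, by simp⟩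

theorem IsVectorBundle.parity_smoothAt (hE : E.IsVectorBundle (d := d)) {σ : ∀ x, E.Fiber x} {x : M}
    (hσ : E.SmoothAt σ x) : E.SmoothAt (fun z => E.parity z (σ z)) x := by
  obtain ⟨U, hU, hx, r, deg, e, h⟩ := hE.exists_isFrame x
  obtain ⟨c, hc, hs⟩ := (h.smoothAt_iff σ x hx).1 hσ
  refine (h.smoothAt_iff _ x hx).2 ⟨fun i z => c i z * signChar (deg i),
    fun i => (hc i).mul contMDiffAt_const, ?_⟩
  filter_upwards [hs, hU.mem_nhds hx] with z hz hzU
  rw [hz, map_sum]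
  refine Finset.sum_congr rfl fun i _ => ?_
  rw [map_smul, hE.parity_apply (h.mem_grading hzU i), smul_smul]

theorem SmoothFamilyAt.of_smoothAt {x : EuclideanSpace ℝ (Fin n) → M} {p : EuclideanSpace ℝ (Fin n)}
    {T : ∀ z, Module.End ℝ (E.Fiber z)}
    (h : ∀ σ, E.SmoothAt σ (x p) → E.SmoothAt (fun z => T z (σ z)) (x p)) :
    SmoothFamilyAt E E x x (fun q => T (x q)) p := by
  rintro ξ ⟨N, c, σ, hc, hσ, e⟩
  refine ⟨N, c, fun i z => T z (σ i z), hc, fun i => h _ (hσ i), ?_⟩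
  filter_upwards [e] with q hq
  rw [hq, map_sum]
  exact Finset.sum_congr rfl fun i _ => map_smul _ _ _

end Frame

end GradedBundle

/-! ## Smoothness of operations -/

section SmoothOperations

open GradedBundle

variable {dM dG n : ℕ}
  {M : Type*} [TopologicalSpace M] [ChartedSpace (EuclideanSpace ℝ (Fin dM)) M]
  [IsManifold (𝓡 dM) ∞ M]
  {G : Type*} [TopologicalSpace G] [ChartedSpace (EuclideanSpace ℝ (Fin dG)) G]
  [IsManifold (𝓡 dG) ∞ G]
  {Γ : LieGroupoid dM dG M G}

namespace LieGroupoid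

theorem contMDiff_vertex {L : List (EuclideanSpace ℝ (Fin n) → G)}
    (hL : ∀ g ∈ L, ContMDiff (𝓡 n) (𝓡 dG) ∞ g) {y : EuclideanSpace ℝ (Fin n) → M}
    (hy : ContMDiff (𝓡 n) (𝓡 dM) ∞ y) (j : ℕ) :
    ContMDiff (𝓡 n) (𝓡 dM) ∞ fun q => Γ.vertex (y q) (L.map fun g => g q) j := by
  induction L generalizing y j with
  | nil => exact hy
  | cons g L ih =>
    cases j with
    | zero => exact hy
    | succ j =>
      exact ih (fun g hg => hL g (by simp [hg]))
        (Γ.submersion_src.contMDiff.comp (hL g (by simp))) j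

theorem exists_merge {L : List (EuclideanSpace ℝ (Fin n) → G)}
    (hL : ∀ g ∈ L, ContMDiff (𝓡 n) (𝓡 dG) ∞ g) {y x : EuclideanSpace ℝ (Fin n) → M}
    (hs : ∀ q, Γ.IsString (L.map fun g => g q) (y q) (x q)) {j : ℕ} (hj : j + 1 < L.length) :
    ∃ L' : List (EuclideanSpace ℝ (Fin n) → G), (∀ g ∈ L', ContMDiff (𝓡 n) (𝓡 dG) ∞ g) ∧
      L'.length + 1 = L.length ∧
      ∀ q, L'.map (fun g => g q) = Γ.merge (j + 1) (L.map fun g => g q) := by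
  induction j generalizing L y with
  | zero =>
    match L, hj, hL, hs with
    | g :: h :: L, _, hL, hs =>
      refine ⟨(fun q => Γ.mul (g q) (h q)) :: L, ?_, rfl, fun q => rfl⟩
      intro f hf
      rcases List.mem_cons.1 hf with rfl | hf
      · have h1 := (hL g (by simp)).prodMk (hL h (by simp))
        have h2 := Γ.smooth_mul.comp (s := Set.univ) h1.contMDiffOn
          (fun q _ => (hs q).2.1.symm)
        exact contMDiffOn_univ.1 h2
      · exact hL f (by simp [hf])
  | succ j ih =>
    match L, hj, hL, hs with
    | g :: L, hj, hL, hs =>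
      obtain ⟨L', h1, h2, h3⟩ := ih (L := L) (y := fun q => Γ.src (g q))
        (fun f hf => hL f (by simp [hf])) (fun q => (hs q).2) (by simpa using hj)
      refine ⟨g :: L', ?_, by simp [h2], fun q => ?_⟩
      · intro f hf
        rcases List.mem_cons.1 hf with rfl | hf
        · exact hL f (by simp)
        · exact h1 f hf
      · rw [List.map_cons, List.map_cons, merge_succ_succ, h3]

end LieGroupoid

/-- Smoothness of operations on a smooth family of strings. -/
theorem Operations.IsSmooth.smoothFamilyAt {E E' : GradedBundle M} {A : Operations G E E'}
    (hA : A.IsSmooth Γ) {L : List (EuclideanSpace ℝ (Fin n) → G)}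
    (hL : ∀ g ∈ L, ContMDiff (𝓡 n) (𝓡 dG) ∞ g) {y x : EuclideanSpace ℝ (Fin n) → M}
    (hy : ContMDiff (𝓡 n) (𝓡 dM) ∞ y) (hx : ContMDiff (𝓡 n) (𝓡 dM) ∞ x)
    (hs : ∀ q, Γ.IsString (L.map fun g => g q) (y q) (x q)) (p : EuclideanSpace ℝ (Fin n)) :
    SmoothFamilyAt E E' x y (fun q => A (L.map fun g => g q) (y q) (x q)) p := by
  have e : ∀ q, L.map (fun g => g q) = List.ofFn fun i => L.get i q := fun q =>
    (congrArg _ (List.ofFn_get L).symm).trans List.map_ofFn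
  have h := hA L.length n L.get y x (fun i => hL _ (List.get_mem _ _)) hy hx
    (fun q => by rw [← e]; exact hs q) p
  simp only [← e] at h
  exact h

theorem Operations.isSmooth_of_smoothFamilyAt {E E' : GradedBundle M} {A : Operations G E E'}
    (h : ∀ {n : ℕ} {L : List (EuclideanSpace ℝ (Fin n) → G)} {y x : EuclideanSpace ℝ (Fin n) → M},
      (∀ g ∈ L, ContMDiff (𝓡 n) (𝓡 dG) ∞ g) → ContMDiff (𝓡 n) (𝓡 dM) ∞ y →
      ContMDiff (𝓡 n) (𝓡 dM) ∞ x → (∀ q, Γ.IsString (L.map fun g => g q) (y q) (x q)) →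
      ∀ p, SmoothFamilyAt E E' x y (fun q => A (L.map fun g => g q) (y q) (x q)) p) :
    A.IsSmooth Γ := by
  intro k n g y x hg hy hx hs p ξ hξ
  have e : ∀ q, (List.ofFn g).map (fun g => g q) = List.ofFn fun i => g i q := fun q => by
    rw [List.map_ofFn]; rfl
  have := h (L := List.ofFn g) (by simpa [List.mem_ofFn] using hg) hy hx
    (fun q => by rw [e]; exact hs q) p ξ hξ
  simp only [e] at this
  exact this

theorem wordOperation_smoothFamilyAt {E : GradedBundle M} {R : Operations G E E} (hR : R.IsSmooth Γ)
    (w : List Letter) {L : List (EuclideanSpace ℝ (Fin n) → G)}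
    (hL : ∀ g ∈ L, ContMDiff (𝓡 n) (𝓡 dG) ∞ g) {y x : EuclideanSpace ℝ (Fin n) → M}
    (hy : ContMDiff (𝓡 n) (𝓡 dM) ∞ y) (hx : ContMDiff (𝓡 n) (𝓡 dM) ∞ x)
    (hs : ∀ q, Γ.IsString (L.map fun g => g q) (y q) (x q)) (hl : L.length = w.length + 1)
    (p : EuclideanSpace ℝ (Fin n)) :
    SmoothFamilyAt E E x y (fun q => wordOperation Γ R w (L.map fun g => g q) (y q) (x q)) p := by
  induction w using letters_induction generalizing L y x with
  | hb k =>
    have := hR.smoothFamilyAt hL hy hx hs p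
    have e : ∀ q, wordOperation Γ R (List.replicate k Letter.b) (L.map fun g => g q) (y q) (x q) =
        R (L.map fun g => g q) (y q) (x q) := fun q =>
      wordOperation_replicate Γ R k _ _ _ (by simpa using hl)
    simpa only [e] using this
  | hc u v hu hv =>
    have hl : L.length = u.length + v.length + 2 := by simp at hl; omega
    have hz := LieGroupoid.contMDiff_vertex (Γ := Γ) hL hy (u.length + 1)
    have hj : ∀ q, u.length + 1 ≤ (L.map fun g => g q).length := fun q => by simp; omega
    have h1 := hu (L := L.take (u.length + 1)) (fun g hg => hL g (List.mem_of_mem_take hg)) hy hz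
      (fun q => by rw [List.map_take]; exact (hs q).take (hj q)) (by simp; omega)
    have h2 := hv (L := L.drop (u.length + 1)) (fun g hg => hL g (List.mem_of_mem_drop hg)) hz hx
      (fun q => by rw [List.map_drop]; exact (hs q).drop (hj q)) (by simp; omega)
    have := h1.comp h2
    have e : ∀ q, wordOperation Γ R (u ++ Letter.c :: v) (L.map fun g => g q) (y q) (x q) = _ :=
      fun q => wordOperation_circ Γ R u v _ _ _ (hs q) (by simpa using hl)
    simpa only [e, List.map_take, List.map_drop] using this
  | ha i w hi ih =>
    have hl : L.length = w.length + 2 := by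
      rw [List.length_insertIdx_of_le_length hi] at hl; exact hl
    obtain ⟨L', h1, h2, h3⟩ := LieGroupoid.exists_merge hL hs (j := i) (by omega)
    have := ih h1 hy hx (fun q => by rw [h3]; exact (hs q).merge (by simp; omega)) (by omega)
    have e : ∀ q, wordOperation Γ R (w.insertIdx i Letter.a) (L.map fun g => g q) (y q) (x q) = _ :=
      fun q => wordOperation_insertIdx Γ R w i _ _ _ (hs q) (by simpa using hl) hi
    simpa only [e, ← h3] using this

variable {m : ℕ} {E E' : Fin m → GradedBundle M} {R : ∀ i, Operations G (E i) (E i)}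

theorem gradedTensor_smoothFamilyAt (hE : ∀ i, (E i).IsVectorBundle (d := dM))
    {x y : EuclideanSpace ℝ (Fin n) → M} {p : EuclideanSpace ℝ (Fin n)}
    (hx : ContMDiff (𝓡 n) (𝓡 dM) ∞ x) {T : ∀ i, ∀ q, (E i).Fiber (x q) →ₗ[ℝ] (E' i).Fiber (y q)}
    (h : ∀ i, SmoothFamilyAt (E i) (E' i) x y (T i) p) (k : Fin m → ℕ) :
    SmoothFamilyAt (tensor (d := dM) E) (tensor (d := dM) E') x y
      (fun q => gradedTensor (fun i => (E i).parity (x q)) (fun i => T i q) k) p :=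
  SmoothFamilyAt.map (T := fun i q => T i q ∘ₗ
      (E i).parity (x q) ^ (∑ j ∈ Finset.univ.filter (fun j => i < j), k j)) (hx p) fun i =>
    (h i).comp (SmoothFamilyAt.pow (SmoothFamilyAt.of_smoothAt (T := fun z => (E i).parity z)
      fun _ hσ => (hE i).parity_smoothAt hσ) _)

theorem diagonal_smoothFamilyAt {F : GradedBundle M} {D : ∀ x, F.Fiber x →ₗ[ℝ] F.Fiber x}
    {x y : EuclideanSpace ℝ (Fin n) → M} {p : EuclideanSpace ℝ (Fin n)}
    (hs : ∀ q, y q = x q) (h : SmoothFamilyAt F F x x (fun q => D (x q)) p) :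
    SmoothFamilyAt F F x y (fun q => F.diagonal D (y q) (x q)) p := by
  obtain rfl : y = x := funext hs
  simpa only [diagonal_self] using h

theorem Operations.extend_isSmooth {F : GradedBundle M} {D : ∀ x, F.Fiber x →ₗ[ℝ] F.Fiber x}
    {c : Operations G F F}
    (hD : ∀ {n : ℕ} {x : EuclideanSpace ℝ (Fin n) → M}, ContMDiff (𝓡 n) (𝓡 dM) ∞ x →
      ∀ p, SmoothFamilyAt F F x x (fun q => D (x q)) p) (hc : c.IsSmooth Γ) :
    (extend D c).IsSmooth Γ := by
  refine isSmooth_of_smoothFamilyAt fun {n L y x} hL hy hx hs p => ?_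
  match L, hL, hs with
  | [], _, hs => exact diagonal_smoothFamilyAt hs (hD hx p)
  | g :: L, hL, hs => exact hc.smoothFamilyAt hL hy hx hs p

theorem tensorDifferential_smoothFamilyAt (hE : ∀ i, IsRepUpToHomotopy Γ (E i) (R i))
    {x : EuclideanSpace ℝ (Fin n) → M} (hx : ContMDiff (𝓡 n) (𝓡 dM) ∞ x)
    (p : EuclideanSpace ℝ (Fin n)) :
    SmoothFamilyAt (tensor (d := dM) E) (tensor (d := dM) E) x x
      (fun q => tensorDifferential R (x q)) p := by
  refine SmoothFamilyAt.congr ?_ fun q => tensorDifferential_eq (dM := dM) (x q)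
  refine SmoothFamilyAt.sum (E := tensor (d := dM) E) (E' := tensor (d := dM) E) (x := x) (y := x)
    Finset.univ (T := fun i q => diffTerm (fun i => (E i).parity (x q))
      (fun i => R i [] (x q) (x q)) i) fun i _ => ?_
  refine gradedTensor_smoothFamilyAt (T := fun j q => (Function.update
    (fun _ => LinearMap.id) i (R i [] (x q) (x q)) : ∀ j, Module.End ℝ ((E j).Fiber (x q))) j)
    (fun i => (hE i).isVectorBundle) hx (fun j => ?_) _
  by_cases hj : j = i
  · subst hj
    simp only [Function.update_self]
    exact (hE j).isSmooth.smoothFamilyAt (L := []) (by simp) hx hx (fun q => rfl) p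
  · simp only [Function.update_of_ne hj]
    exact SmoothFamilyAt.id

theorem tensorEval_apply_apply (l : List G) (y x : M) (u : Omega m) (t : ⨂[ℝ] i, (E i).Fiber x) :
    tensorEval Γ R l y x u t = ∑ W ∈ u.support, u W • tensorWordMap Γ R W l y x t := by
  rw [tensorEval, Finsupp.linearCombination_apply, Finsupp.sum, LinearMap.sum_apply]
  rfl

theorem completionOperations_isSmooth (hE : ∀ i, IsRepUpToHomotopy Γ (E i) (R i)) {k : ℤ}
    {z : Completion m} (hz : z.HasDegree k) :
    Operations.IsSmooth Γ (E := tensor (d := dM) E) (E' := tensor (d := dM) E)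
      (completionOperations Γ R z) := by
  refine Operations.isSmooth_of_smoothFamilyAt fun {n L y x} hL hy hx hs p ξ hξ => ?_
  have h : ∀ W ∈ (z L.length).support, (tensor (d := dM) E).SmoothAlongAt y
      (fun q => tensorWordMap Γ R W (L.map fun g => g q) (y q) (x q) (ξ q)) p := fun W hW => by
    have hW : W.order = L.length := ((Finsupp.mem_supported _ _).1 (hz L.length) hW).1
    exact gradedTensor_smoothFamilyAt (fun i => (hE i).isVectorBundle) hx (fun i =>
      wordOperation_smoothFamilyAt (hE i).isSmooth _ hL hy hx hs
        (by rw [factor_length, ← hW]; rfl) p) _ ξ hξ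
  refine (SmoothAlongAt.sum _ fun W hW => SmoothAlongAt.smul (c := fun _ => z L.length W)
    contDiffAt_const (h W hW)).congr (Filter.Eventually.of_forall fun q => ?_)
  have e : (L.map fun g => g q).length = L.length := List.length_map _
  refine (congrArg (fun k => tensorEval Γ R _ (y q) (x q) (z k) (ξ q)) e).trans ?_
  exact tensorEval_apply_apply _ _ _ _ _

end SmoothOperations
end RuthTensor

namespace RuthTensor

/-! ## Tensor products of graded vector bundles -/

namespace GradedBundle

section TensorBundle

variable {d m : ℕ} {M : Type*} [TopologicalSpace M] [ChartedSpace (EuclideanSpace ℝ (Fin d)) M]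
  {E E' : Fin m → GradedBundle M}

variable (E) in
/-- The grading of the fibre of `tensor E`, as a family of subspaces of the tensor product. -/
abbrev tensorGrading (x : M) (n : ℤ) : Submodule ℝ (⨂[ℝ] i, (E i).Fiber x) :=
  (tensor (d := d) E).grading x n

/-- The tensor product of frames. -/
def tensorFrame {r : Fin m → ℕ} (e : ∀ i, Fin (r i) → ∀ x, (E i).Fiber x) (f : ∀ i, Fin (r i)) (x : M) :
    ⨂[ℝ] i, (E i).Fiber x :=
  PiTensorProduct.tprod ℝ fun i => e i (f i) x

theorem tensor_isFrame {U : Fin m → Set M} {r : Fin m → ℕ}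
    {deg : ∀ i, Fin (r i) → ℤ} {e : ∀ i, Fin (r i) → ∀ x, (E i).Fiber x}
    (h : ∀ i, IsFrame d (E i) (U i) (deg i) (e i)) :
    IsFrame d (tensor (d := d) E) (⋂ i, U i) (fun f : ∀ i, Fin (r i) => ∑ i, deg i (f i))
      (tensorFrame e) := by
  have hx' : ∀ {x}, x ∈ (⋂ i, U i) → ∀ i, x ∈ U i := fun hx i => Set.mem_iInter.1 hx i
  let b : ∀ x, x ∈ (⋂ i, U i) → ∀ i, Module.Basis (Fin (r i)) ℝ ((E i).Fiber x) := fun x hx i =>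
    Module.Basis.mk ((h i).linearIndependent x (hx' hx i)) ((h i).span_eq x (hx' hx i)).ge
  have hb : ∀ x (hx : x ∈ (⋂ i, U i)), (fun f => tensorFrame e f x) =
      Basis.piTensorProduct (b x hx) := fun x hx => by
    funext f
    rw [Basis.piTensorProduct_apply, tensorFrame]
    congr 1
    funext i
    simp [b]
  refine ⟨fun x hx => ?_, fun x hx => ?_, fun x hx n => ?_, fun σ x hx => ?_⟩
  · have := (Basis.piTensorProduct (b x hx)).linearIndependent
    rw [← hb x hx] at this
    exact this
  · have := (Basis.piTensorProduct (b x hx)).span_eq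
    rw [← hb x hx] at this
    exact this
  · refine le_antisymm (Submodule.span_le.2 ?_) (Submodule.span_le.2 ?_)
    · rintro _ ⟨p, v, hp, hv, rfl⟩
      have hc : ∀ i, ∃ c : Fin (r i) → ℝ, (∀ k, deg i k ≠ p i → c k = 0) ∧
          v i = ∑ k, c k • e i k x := by
        intro i
        have := hv i
        rw [(h i).grading_eq x (hx' hx i)] at this
        rw [← Set.image_eta] at this
        obtain ⟨c, hc, hcv⟩ := (Finsupp.mem_span_image_iff_linearCombination ℝ).1 this
        refine ⟨c, fun k hk => ?_, ?_⟩
        · by_contra hne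
          exact hk ((Finsupp.mem_supported _ _).1 hc (Finsupp.mem_support_iff.2 hne))
        · rw [← hcv, Finsupp.linearCombination_apply, Finsupp.sum_fintype _ _ (by simp)]
      choose c hc hcv using hc
      have e1 : PiTensorProduct.tprod ℝ v =
          ∑ f : ∀ i, Fin (r i), (∏ i, c i (f i)) • tensorFrame e f x := by
        rw [show v = fun i => ∑ k, c i k • e i k x from funext hcv]
        exact tprod_sum_smul _ _
      change PiTensorProduct.tprod ℝ v ∈ Submodule.span ℝ (M := ⨂[ℝ] i, (E i).Fiber x)
        ((fun f => tensorFrame e f x) '' {f | ∑ i, deg i (f i) = n})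
      rw [e1]
      refine Submodule.sum_mem _ fun f _ => ?_
      by_cases hf : ∀ i, deg i (f i) = p i
      · refine Submodule.smul_mem _ _ (Submodule.subset_span ⟨f, ?_, rfl⟩)
        exact (Finset.sum_congr rfl fun i _ => hf i).trans hp
      · push Not at hf
        obtain ⟨i, hi⟩ := hf
        rw [Finset.prod_eq_zero (Finset.mem_univ i) (hc i _ hi), zero_smul]
        exact Submodule.zero_mem _
    · rintro _ ⟨f, hf, rfl⟩
      exact Submodule.subset_span (M := ⨂[ℝ] i, (E i).Fiber x) ⟨fun i => deg i (f i),
        fun i => e i (f i) x, hf, fun i => (h i).mem_grading (hx' hx i) _, rfl⟩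
  · constructor
    · rintro ⟨N, c, s, hc, hs, hσ⟩
      choose c' hc' hs' using fun a i => ((h i).smoothAt_iff (s a i) x (hx' hx i)).1 (hs a i)
      refine ⟨fun f z => ∑ a, c a z * ∏ i, c' a i (f i) z, fun f => ContMDiffAt.sum fun a _ =>
        (hc a).mul (ContMDiffAt.prod fun i _ => hc' a i (f i)), ?_⟩
      filter_upwards [hσ, Filter.eventually_all.2 fun a => Filter.eventually_all.2 fun i => hs' a i]
        with z h1 h2
      have e1 : ∀ a, PiTensorProduct.tprod ℝ (fun i => s a i z) =
          ∑ f : ∀ i, Fin (r i), (∏ i, c' a i (f i) z) • tensorFrame e f z := fun a => by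
        rw [show (fun i => s a i z) = fun i => ∑ k, c' a i k z • e i k z from funext (h2 a)]
        exact tprod_sum_smul _ _
      have e2 : (∑ a, c a z • PiTensorProduct.tprod ℝ (fun i => s a i z) : ⨂[ℝ] i, (E i).Fiber z) =
          ∑ f : ∀ i, Fin (r i), (∑ a, c a z * ∏ i, c' a i (f i) z) • tensorFrame e f z := by
        simp only [e1, Finset.smul_sum, smul_smul, Finset.sum_smul]
        exact Finset.sum_comm
      exact h1.trans e2
    · rintro ⟨c, hc, hσ⟩
      refine ⟨Fintype.card (∀ i, Fin (r i)), fun a => c ((Fintype.equivFin _).symm a),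
        fun a i => e i ((Fintype.equivFin _).symm a i), fun a => hc _,
        fun a i => (h i).smoothAt (hx' hx i) _, ?_⟩
      filter_upwards [hσ] with z hz
      exact hz.trans (Equiv.sum_comp (Fintype.equivFin (∀ i, Fin (r i))).symm
        fun f => c f z • tensorFrame e f z).symm

theorem tensor_isVectorBundle (hE : ∀ i, (E i).IsVectorBundle (d := d)) :
    (tensor (d := d) E).IsVectorBundle (d := d) := by
  refine IsVectorBundle.of_isFrame fun x₀ => ?_
  choose U hU hx r deg e h using fun i => (hE i).exists_isFrame x₀
  exact ⟨⋂ i, U i, isOpen_iInter_of_finite hU, Set.mem_iInter.2 hx, _, inferInstance, _, _,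
    tensor_isFrame h⟩

theorem gradedTensor_mem_grading (hE : ∀ i, (E i).IsVectorBundle (d := d)) {x y : M}
    {φ : ∀ i, (E i).Fiber x →ₗ[ℝ] (E' i).Fiber y} {a : Fin m → ℤ}
    (hφ : ∀ i p, ∀ v ∈ (E i).grading x p, φ i v ∈ (E' i).grading y (p + a i)) (k : Fin m → ℕ) {n : ℤ}
    {t : ⨂[ℝ] i, (E i).Fiber x} (ht : t ∈ (tensor (d := d) E).grading x n) :
    gradedTensor (fun i => (E i).parity x) φ k t ∈ (tensor (d := d) E').grading y (n + ∑ i, a i) := by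
  have : (tensor (d := d) E).grading x n ≤ ((tensor (d := d) E').grading y (n + ∑ i, a i)).comap
      (gradedTensor (fun i => (E i).parity x) φ k) := by
    refine Submodule.span_le.2 ?_
    rintro _ ⟨p, v, rfl, hv, rfl⟩
    refine Submodule.subset_span ⟨fun i => p i + a i, _, Finset.sum_add_distrib, fun i => ?_,
      PiTensorProduct.map_tprod _ _⟩
    rw [LinearMap.comp_apply, (hE i).parity_pow_apply (hv i), map_smul]
    exact Submodule.smul_mem _ _ (hφ i _ _ (hv i))
  exact this ht

end TensorBundle

end GradedBundle

section TensorRepresentation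

open GradedBundle

variable {dM dG : ℕ}
  {M : Type*} [TopologicalSpace M] [ChartedSpace (EuclideanSpace ℝ (Fin dM)) M]
  [IsManifold (𝓡 dM) ∞ M]
  {G : Type*} [TopologicalSpace G] [ChartedSpace (EuclideanSpace ℝ (Fin dG)) G]
  [IsManifold (𝓡 dG) ∞ G]
  {Γ : LieGroupoid dM dG M G}

theorem Operations.extend_hasDegree {F : GradedBundle M} {D : ∀ x, F.Fiber x →ₗ[ℝ] F.Fiber x}
    {c : Operations G F F} {n : ℤ} (hD : ∀ x p, ∀ v ∈ F.grading x p, D x v ∈ F.grading x (p + n))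
    (hc : c.HasDegree Γ n) : (extend D c).HasDegree Γ n := by
  intro l y x hs
  match l, hs with
  | [], hs =>
    obtain rfl : y = x := hs
    intro p v hv
    rw [extend_nil]
    simpa using hD y p v hv
  | g :: l, hs => exact hc _ y x hs

variable {m : ℕ} {E : Fin m → GradedBundle M} {R : ∀ i, Operations G (E i) (E i)}

theorem tensorDifferential_mem_grading (hE : ∀ i, IsRepUpToHomotopy Γ (E i) (R i)) (x : M) (p : ℤ)
    (v : ⨂[ℝ] i, (E i).Fiber x) (hv : v ∈ (tensor (d := dM) E).grading x p) :
    tensorDifferential (dM := dM) R x v ∈ (tensor (d := dM) E).grading x (p + 1) := by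
  change tensorDifferential (dM := dM) R x v ∈ tensorGrading (d := dM) E x (p + 1)
  have e : tensorDifferential (dM := dM) R x v = tensorDiff R x v := by
    rw [tensorDifferential_eq]; rfl
  rw [e, tensorDiff, LinearMap.sum_apply]
  refine Submodule.sum_mem _ fun i _ => ?_
  have := gradedTensor_mem_grading (E := E) (E' := E) (fun i => (hE i).isVectorBundle)
    (φ := (Function.update (fun _ => LinearMap.id) i (R i [] x x) : ∀ j, Module.End ℝ ((E j).Fiber x)))
    (a := Pi.single i 1) (fun j p v hv => ?_) (Pi.single i 1) hv
  · rwa [Finset.sum_pi_single', if_pos (Finset.mem_univ i)] at this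
  · by_cases hj : j = i
    · subst hj
      simpa using (hE j).hasDegree [] x x rfl p v hv
    · simpa [hj] using hv

theorem completionOperations_hasDegree (hE : ∀ i, IsRepUpToHomotopy Γ (E i) (R i)) {n : ℤ}
    {z : Completion m} (hz : z.HasDegree n) :
    Operations.HasDegree Γ (E := tensor (d := dM) E) (E' := tensor (d := dM) E) n
      (completionOperations Γ R z) := by
  intro l y x hs p (v : ⨂[ℝ] i, (E i).Fiber x) hv
  change tensorEval Γ R l y x (z l.length) v ∈ tensorGrading (d := dM) E y (p + n - l.length)
  rw [tensorEval_apply_apply]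
  refine Submodule.sum_mem _ fun W hW => Submodule.smul_mem _ _ ?_
  obtain ⟨hW1, hW2⟩ := (Finsupp.mem_supported _ _).1 (hz l.length) hW
  have := gradedTensor_mem_grading (E := E) (E' := E) (fun i => (hE i).isVectorBundle)
    (φ := fun i => wordOperation Γ (R i) (W.factor i) l y x) (a := fun i => -(W.bCount i : ℤ))
    (fun i p v hv => wordOperation_hasDegree Γ (R i) (hE i).hasDegree _ l y x hs
      (by rw [factor_length, ← hW1]; rfl) p v hv) W.bCount hv
  rw [show p + n - (l.length : ℤ) = p + ∑ i, -(W.bCount i : ℤ) from ?_]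
  · exact this
  · rw [Finset.sum_neg_distrib, ← Nat.cast_sum]
    have : W.degree = -∑ i, (W.bCount i : ℤ) := by simp [Word.degree]
    push_cast
    rw [← this, hW2]; ring

theorem tensorOperations_isRepUpToHomotopy (hE : ∀ i, IsRepUpToHomotopy Γ (E i) (R i))
    {η : Completion m} (hη : η.IsUniversalMC) :
    IsRepUpToHomotopy Γ (tensor (d := dM) E) (tensorOperations Γ η R) where
  isVectorBundle := tensor_isVectorBundle fun i => (hE i).isVectorBundle
  hasDegree := by
    rw [tensorOperations_eq_extend]
    exact Operations.extend_hasDegree (tensorDifferential_mem_grading hE)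
      (completionOperations_hasDegree hE hη.1.1)
  isSmooth := by
    rw [tensorOperations_eq_extend]
    exact Operations.extend_isSmooth (tensorDifferential_smoothFamilyAt hE)
      (completionOperations_isSmooth hE hη.1.1)
  equation _ _ _ hs := tensorOperations_equation hE hη hs

theorem gaugeOperations_isMorphism (hE : ∀ i, IsRepUpToHomotopy Γ (E i) (R i)) {η θ z : Completion m}
    (hη : η.HasDegree 1) (hθ : θ.HasDegree 1) (hz : z.HasDegree 0)
    (h : z.dTot = η - θ + z.star η - θ.star z) :
    IsMorphism Γ (tensorOperations Γ η R) (tensorOperations Γ θ R) (gaugeOperations Γ R z) where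
  hasDegree := Operations.extend_hasDegree (fun x p v hv => by simpa using hv)
    (completionOperations_hasDegree hE hz)
  isSmooth := Operations.extend_isSmooth (fun _ _ => SmoothFamilyAt.id)
    (completionOperations_isSmooth hE hz)
  equation _ _ _ hs := gaugeOperations_equation hE hη hθ hz h hs

theorem gaugeOperations_nil (z : Completion m) (x : M) :
    gaugeOperations (E := E) Γ R z [] x x = LinearMap.id :=
  Operations.extend_nil _ _ x

theorem tensorOperations_stronglyIsomorphic (hE : ∀ i, IsRepUpToHomotopy Γ (E i) (R i))
    {η θ : Completion m} (hη : η.IsUniversalMC) (hθ : θ.IsUniversalMC) :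
    StronglyIsomorphic Γ (tensorOperations Γ η R) (tensorOperations Γ θ R) := by
  obtain ⟨z, hz, -, h⟩ := Completion.exists_gauge False hη hθ fun h => h.elim
  exact ⟨fun _ => rfl, gaugeOperations Γ R z, gaugeOperations_isMorphism hE hη.1.1 hθ.1.1 hz h,
    gaugeOperations_nil z⟩

end TensorRepresentation
end RuthTensor

namespace RuthTensor

/-! ## Quotients of graded vector bundles -/

/-- A quotient of a graded vector space with a homogeneous basis by a homogeneous subspace has a basis
of classes of basis vectors, in which the classes of the basis vectors have homogeneous coordinates. -/
theorem exists_homogeneous_basis_quotient {ι : Type} [Fintype ι] [DecidableEq ι] (deg : ι → ℤ)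
    (N : Submodule ℝ (ι → ℝ)) (hN : ∀ n, ∀ c ∈ N, (fun i => if deg i = n then c i else 0) ∈ N) :
    ∃ (κ : Type) (_ : Fintype κ) (a : κ → ι) (A : ι → κ → ℝ),
      (∀ f, Pi.single f 1 - ∑ k, A f k • Pi.single (a k) 1 ∈ N) ∧
      (∀ f k, deg f ≠ deg (a k) → A f k = 0) ∧
      ∀ c : κ → ℝ, ∑ k, c k • Pi.single (a k) 1 ∈ N → c = 0 := by
  let v : ι → (ι → ℝ) ⧸ N := fun f => N.mkQ (Pi.single f 1)
  obtain ⟨b, hb, hspan, hli⟩ := exists_linearIndependent ℝ (Set.range v)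
  have : Finite b := (Set.finite_range v).subset hb
  have : Fintype b := Fintype.ofFinite b
  choose a ha using fun k : b => hb k.2
  have hval : ∀ c : b → ℝ, N.mkQ (∑ k, c k • Pi.single (a k) 1) = ∑ k, c k • (k : (ι → ℝ) ⧸ N) :=
    fun c => by
      rw [map_sum]
      exact Finset.sum_congr rfl fun k _ => by rw [map_smul, ← ha k]
  have hA : ∀ f, ∃ c : b → ℝ, Pi.single f 1 - ∑ k, c k • Pi.single (a k) 1 ∈ N := by
    intro f
    have h1 : v f ∈ Submodule.span ℝ (Set.range ((↑) : b → (ι → ℝ) ⧸ N)) := by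
      rw [Subtype.range_coe, hspan]
      exact Submodule.subset_span ⟨f, rfl⟩
    obtain ⟨c, hc⟩ := (Submodule.mem_span_range_iff_exists_fun ℝ).1 h1
    refine ⟨c, ?_⟩
    rw [← Submodule.Quotient.mk_eq_zero, ← Submodule.mkQ_apply, map_sub, hval, hc, sub_self]
  choose A hA using hA
  refine ⟨b, inferInstance, a, fun f k => if deg f = deg (a k) then A f k else 0, fun f => ?_,
    fun f k h => if_neg h, fun c hc => ?_⟩
  · convert hN (deg f) _ (hA f) using 1
    funext i
    simp only [Pi.sub_apply, Finset.sum_apply, Pi.smul_apply, smul_eq_mul, Pi.single_apply]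
    by_cases hi : deg i = deg f
    · rw [if_pos hi]
      congr 1
      refine Finset.sum_congr rfl fun k _ => ?_
      by_cases hk : i = a k
      · subst hk; simp [hi]
      · simp [hk]
    · rw [if_neg hi, if_neg fun h => hi (by rw [h]), zero_sub, neg_eq_zero]
      refine Finset.sum_eq_zero fun k _ => ?_
      by_cases hk : i = a k
      · subst hk; simp [Ne.symm hi]
      · simp [hk]
  · have h0 : ∑ k, c k • (k : (ι → ℝ) ⧸ N) = 0 := by
      rw [← hval, Submodule.mkQ_apply, Submodule.Quotient.mk_eq_zero]; exact hc
    exact funext (Fintype.linearIndependent_iff.1 hli c h0)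

namespace GradedBundle

variable {d n : ℕ} {M : Type*} [TopologicalSpace M] [ChartedSpace (EuclideanSpace ℝ (Fin d)) M]
  {F F' : GradedBundle M} {π : ∀ x, F.Fiber x →ₗ[ℝ] F'.Fiber x}

/-- The maps `π x` present `F'` as a quotient of `F`. -/
structure IsQuotient (F F' : GradedBundle M) (π : ∀ x, F.Fiber x →ₗ[ℝ] F'.Fiber x) : Prop where
  surjective : ∀ x, Function.Surjective (π x)
  grading_eq : ∀ x n, F'.grading x n = (F.grading x n).map (π x)
  smoothAt_iff : ∀ (σ : ∀ x, F'.Fiber x) (x : M), F'.SmoothAt σ x ↔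
    ∃ τ : ∀ x, F.Fiber x, F.SmoothAt τ x ∧ ∀ᶠ z in 𝓝 x, σ z = π z (τ z)

theorem IsFrame.exists_quotient (hπ : IsQuotient F F' π) {U : Set M} (hU : IsOpen U) {ι : Type}
    [Fintype ι] [DecidableEq ι] {deg : ι → ℤ} {e : ι → ∀ x, F.Fiber x} (h : IsFrame d F U deg e)
    (N : Submodule ℝ (ι → ℝ)) (hN : ∀ n, ∀ c ∈ N, (fun i => if deg i = n then c i else 0) ∈ N)
    (hker : ∀ x ∈ U, ∀ c : ι → ℝ, π x (∑ i, c i • e i x) = 0 ↔ c ∈ N) :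
    ∃ (κ : Type) (_ : Fintype κ) (deg' : κ → ℤ) (e' : κ → ∀ x, F'.Fiber x), IsFrame d F' U deg' e' := by
  obtain ⟨κ, _, a, A, hA, hdeg, hli⟩ := exists_homogeneous_basis_quotient deg N hN
  have hsum : ∀ x (c : κ → ℝ),
      ∑ i, (∑ k, c k • (Pi.single (a k) 1 : ι → ℝ)) i • e i x = ∑ k, c k • e (a k) x := fun x c => by
    simp only [Finset.sum_apply, Pi.smul_apply, smul_eq_mul, Finset.sum_smul]
    rw [Finset.sum_comm]
    refine Finset.sum_congr rfl fun k _ => ?_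
    rw [Finset.sum_eq_single (a k)]
    · simp
    · intro i _ hi; simp [hi]
    · simp
  have hrel : ∀ x ∈ U, ∀ f, π x (e f x) = ∑ k, A f k • π x (e (a k) x) := fun x hx f => by
    have := (hker x hx _).2 (hA f)
    simp only [Pi.sub_apply, sub_smul, Finset.sum_sub_distrib, hsum] at this
    rw [map_sub, sub_eq_zero, map_sum (π x) _ (Finset.univ : Finset κ)] at this
    simp only [map_smul] at this
    rw [← this]
    congr 1
    rw [Finset.sum_eq_single f]
    · simp
    · intro i _ hi; simp [hi]
    · simp
  have htop : ∀ x ∈ U, Submodule.map (π x) ⊤ = ⊤ := fun x _ => by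
    rw [Submodule.map_top, LinearMap.range_eq_top.2 (hπ.surjective x)]
  refine ⟨κ, inferInstance, fun k => deg (a k), fun k x => π x (e (a k) x),
    fun x hx => ?_, fun x hx => ?_, fun x hx n => ?_, fun σ x hx => ?_⟩
  · refine Fintype.linearIndependent_iff.2 fun c hc => congrFun (hli c ((hker x hx _).1 ?_))
    rw [hsum, map_sum, ← hc]
    simp only [map_smul]
  · rw [eq_top_iff, ← htop x hx, ← h.span_eq x hx, Submodule.map_span, Submodule.span_le]
    rintro _ ⟨_, ⟨f, rfl⟩, rfl⟩
    rw [SetLike.mem_coe, hrel x hx]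
    exact Submodule.sum_mem _ fun k _ => Submodule.smul_mem _ _ (Submodule.subset_span ⟨k, rfl⟩)
  · rw [hπ.grading_eq, h.grading_eq x hx, Submodule.map_span]
    refine le_antisymm (Submodule.span_le.2 ?_) (Submodule.span_le.2 ?_)
    · rintro _ ⟨_, ⟨f, hf, rfl⟩, rfl⟩
      rw [SetLike.mem_coe, hrel x hx]
      refine Submodule.sum_mem _ fun k _ => ?_
      by_cases hk : deg f = deg (a k)
      · exact Submodule.smul_mem _ _ (Submodule.subset_span ⟨k, hk.symm.trans hf, rfl⟩)
      · rw [hdeg f k hk, zero_smul]; exact Submodule.zero_mem _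
    · rintro _ ⟨k, hk, rfl⟩
      exact Submodule.subset_span ⟨_, ⟨a k, hk, rfl⟩, rfl⟩
  · rw [hπ.smoothAt_iff]
    constructor
    · rintro ⟨τ, hτ, hσ⟩
      obtain ⟨c, hc, hs⟩ := (h.smoothAt_iff τ x hx).1 hτ
      refine ⟨fun k z => ∑ f, c f z * A f k, fun k => ContMDiffAt.sum fun f _ =>
        (hc f).mul contMDiffAt_const, ?_⟩
      filter_upwards [hσ, hs, hU.mem_nhds hx] with z h1 h2 hz
      rw [h1, h2, map_sum]
      have e1 : ∀ f, π z (c f z • e f z) = ∑ k, (c f z * A f k) • π z (e (a k) z) := fun f => by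
        rw [map_smul, hrel z hz f, Finset.smul_sum]
        exact Finset.sum_congr rfl fun k _ => smul_smul _ _ _
      rw [Finset.sum_congr rfl fun f _ => e1 f, Finset.sum_comm]
      exact Finset.sum_congr rfl fun k _ => (Finset.sum_smul).symm
    · rintro ⟨c, hc, hs⟩
      refine ⟨fun z => ∑ k, c k z • e (a k) z, (h.smoothAt_iff _ x hx).2
        ⟨fun i z => ∑ k, c k z * (Pi.single (a k) 1 : ι → ℝ) i, fun i => ContMDiffAt.sum fun k _ =>
          (hc k).mul contMDiffAt_const, Filter.Eventually.of_forall fun z => ?_⟩, ?_⟩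
      · rw [← hsum]
        refine Finset.sum_congr rfl fun i _ => ?_
        rw [Finset.sum_apply]
        rfl
      · filter_upwards [hs] with z hz
        rw [hz, map_sum]
        simp only [map_smul]

section Operations

variable {x y : EuclideanSpace ℝ (Fin n) → M} {p : EuclideanSpace ℝ (Fin n)}

theorem IsQuotient.smoothAlongAt_map (hπ : IsQuotient F F' π)
    {ξ : ∀ q, F.Fiber (x q)} (h : F.SmoothAlongAt x ξ p) :
    F'.SmoothAlongAt x (fun q => π (x q) (ξ q)) p := by
  obtain ⟨N, c, σ, hc, hσ, h⟩ := h
  refine ⟨N, c, fun i z => π z (σ i z), hc, fun i => (hπ.smoothAt_iff _ _).2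
    ⟨σ i, hσ i, Filter.Eventually.of_forall fun _ => rfl⟩, ?_⟩
  filter_upwards [h] with q hq
  rw [hq, map_sum]
  simp only [map_smul]

theorem IsQuotient.exists_lift (hπ : IsQuotient F F' π) (hx : Continuous x)
    {ξ : ∀ q, F'.Fiber (x q)} (h : F'.SmoothAlongAt x ξ p) :
    ∃ ζ : ∀ q, F.Fiber (x q), F.SmoothAlongAt x ζ p ∧ ∀ᶠ q in 𝓝 p, ξ q = π (x q) (ζ q) := by
  obtain ⟨N, c, σ, hc, hσ, h⟩ := h
  choose τ hτ e using fun i => (hπ.smoothAt_iff _ _).1 (hσ i)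
  refine ⟨fun q => ∑ i, c i q • τ i (x q), ⟨N, c, τ, hc, hτ, Filter.Eventually.of_forall fun _ => rfl⟩,
    ?_⟩
  filter_upwards [h, hx.continuousAt.eventually (Filter.eventually_all.2 e)] with q h1 h2
  rw [h1, map_sum]
  simp only [map_smul, h2]

end Operations

end GradedBundle

section QuotientOperations

open GradedBundle

variable {dM dG : ℕ}
  {M : Type*} [TopologicalSpace M] [ChartedSpace (EuclideanSpace ℝ (Fin dM)) M]
  [IsManifold (𝓡 dM) ∞ M]
  {G : Type*} [TopologicalSpace G] [ChartedSpace (EuclideanSpace ℝ (Fin dG)) G]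
  [IsManifold (𝓡 dG) ∞ G]
  {Γ : LieGroupoid dM dG M G} {F F' : GradedBundle M} {π : ∀ x, F.Fiber x →ₗ[ℝ] F'.Fiber x}

namespace Operations

/-- The operations `A'` are induced by `A` on a quotient. -/
def Induces (Γ : LieGroupoid dM dG M G) (π : ∀ x, F.Fiber x →ₗ[ℝ] F'.Fiber x)
    (A : Operations G F F) (A' : Operations G F' F') : Prop :=
  ∀ l y x, Γ.IsString l y x → A' l y x ∘ₗ π x = π y ∘ₗ A l y x

variable {A B : Operations G F F} {A' B' : Operations G F' F'}

theorem Induces.hasDegree (h : Induces Γ π A A') (hπ : IsQuotient F F' π) {n : ℤ}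
    (hA : A.HasDegree Γ n) : A'.HasDegree Γ n := by
  intro l y x hs p v hv
  rw [hπ.grading_eq] at hv ⊢
  obtain ⟨w, hw, rfl⟩ := hv
  exact ⟨A l y x w, hA l y x hs p w hw, (LinearMap.congr_fun (h l y x hs) w).symm⟩

theorem Induces.isSmooth (h : Induces Γ π A A') (hπ : IsQuotient F F' π)
    (hA : A.IsSmooth Γ) : A'.IsSmooth Γ := by
  intro k n g y x hg hy hx hs p ξ hξ
  obtain ⟨ζ, hζ, e⟩ := hπ.exists_lift hx.continuous hξ
  refine (hπ.smoothAlongAt_map (hA k n g y x hg hy hx hs p ζ hζ)).congr ?_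
  filter_upwards [e] with q hq
  rw [hq]
  exact LinearMap.congr_fun (h _ _ _ (hs q)) (ζ q)

theorem Induces.comp (h : Induces Γ π A A') (h' : Induces Γ π B B') {l : List G} {y x : M}
    (hs : Γ.IsString l y x) {j : ℕ} (hj : j ≤ l.length) :
    Operations.comp Γ A' B' j l y x ∘ₗ π x = π y ∘ₗ Operations.comp Γ A B j l y x := by
  rw [Operations.comp, LinearMap.comp_assoc, h' _ _ _ (hs.drop hj), ← LinearMap.comp_assoc,
    h _ _ _ (hs.take hj)]
  rfl

theorem sum_smul_comp_eq {V W V' W' : Type*} [AddCommGroup V] [Module ℝ V] [AddCommGroup W] [Module ℝ W]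
    [AddCommGroup V'] [Module ℝ V'] [AddCommGroup W'] [Module ℝ W'] {ι : Type*} (s : Finset ι)
    (c : ι → ℝ) {f : ι → V →ₗ[ℝ] W} {f' : ι → V' →ₗ[ℝ] W'} {α : V →ₗ[ℝ] V'} {β : W →ₗ[ℝ] W'}
    (h : ∀ i ∈ s, f' i ∘ₗ α = β ∘ₗ f i) :
    (∑ i ∈ s, c i • f' i) ∘ₗ α = β ∘ₗ (∑ i ∈ s, c i • f i) := by
  ext v
  simp only [LinearMap.comp_apply, LinearMap.sum_apply, LinearMap.smul_apply, map_sum, map_smul]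
  exact Finset.sum_congr rfl fun i hi => by rw [← LinearMap.comp_apply, h i hi]; rfl

theorem Induces.mergeSum (h : Induces Γ π A A') {l : List G} {y x : M} (hs : Γ.IsString l y x) :
    A'.mergeSum Γ l y x ∘ₗ π x = π y ∘ₗ A.mergeSum Γ l y x :=
  sum_smul_comp_eq _ _ fun j hj => by
    obtain ⟨h1, h2⟩ := Finset.mem_Ico.1 hj
    obtain ⟨j, rfl⟩ : ∃ i, j = i + 1 := ⟨j - 1, by omega⟩
    exact h _ _ _ (hs.merge h2)

theorem Induces.sum_comp (h : Induces Γ π A A') (h' : Induces Γ π B B') {l : List G} {y x : M}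
    (hs : Γ.IsString l y x) (c : ℕ → ℝ) :
    (∑ j ∈ Finset.range (l.length + 1), c j • Operations.comp Γ A' B' j l y x) ∘ₗ π x =
      π y ∘ₗ ∑ j ∈ Finset.range (l.length + 1), c j • Operations.comp Γ A B j l y x :=
  sum_smul_comp_eq _ _ fun j hj => h.comp h' hs (by simpa [Nat.lt_succ_iff] using hj)

end Operations

theorem IsRepUpToHomotopy.of_induces {A : Operations G F F} {A' : Operations G F' F'}
    (h : Operations.Induces Γ π A A') (hπ : IsQuotient F F' π) (hF' : F'.IsVectorBundle (d := dM))
    (hA : IsRepUpToHomotopy Γ F A) : IsRepUpToHomotopy Γ F' A' where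
  isVectorBundle := hF'
  hasDegree := h.hasDegree hπ hA.hasDegree
  isSmooth := h.isSmooth hπ hA.isSmooth
  equation l y x hs := by
    rw [← LinearMap.cancel_right (hπ.surjective x), h.mergeSum hs, h.sum_comp h hs,
      hA.equation l y x hs]

theorem IsMorphism.of_induces {A B Φ : Operations G F F} {A' B' Φ' : Operations G F' F'}
    (hA : Operations.Induces Γ π A A') (hB : Operations.Induces Γ π B B')
    (hΦ : Operations.Induces Γ π Φ Φ') (hπ : IsQuotient F F' π) (h : IsMorphism Γ A B Φ) :
    IsMorphism Γ A' B' Φ' where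
  hasDegree := hΦ.hasDegree hπ h.hasDegree
  isSmooth := hΦ.isSmooth hπ h.isSmooth
  equation l y x hs := by
    have h1 := h.equation l y x hs
    have h2 := hB.sum_comp hΦ hs fun _ => 1
    simp only [one_smul] at h2
    rw [← LinearMap.cancel_right (hπ.surjective x), LinearMap.add_comp, hΦ.mergeSum hs,
      hΦ.sum_comp hA hs, h2, h1, LinearMap.comp_add]

end QuotientOperations
end RuthTensor

namespace RuthTensor

/-! ## Symmetric powers of graded vector bundles -/

namespace GradedBundle

section SymBundle

variable {d m : ℕ} {M : Type*} [TopologicalSpace M] [ChartedSpace (EuclideanSpace ℝ (Fin d)) M]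
  {E : GradedBundle M}

theorem sym_isQuotient : IsQuotient (tensor (d := d) fun _ : Fin m => E) (E.sym (d := d) m)
    fun x => (E.symRelations m x).mkQ where
  surjective x := (E.symRelations m x).mkQ_surjective
  grading_eq _ _ := rfl
  smoothAt_iff _ _ := Iff.rfl

/-- The coordinates of the relations of the symmetric power in a frame. -/
def symModel (m : ℕ) {r : ℕ} (deg : Fin r → ℤ) : Submodule ℝ ((Fin m → Fin r) → ℝ) :=
  Submodule.span ℝ {c | ∃ (i j : Fin m) (f : Fin m → Fin r), (i : ℕ) + 1 = j ∧
    c = Pi.single f 1 - ((-1 : ℝ) ^ (deg (f i) * deg (f j))) •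
      Pi.single (fun a => f (Equiv.swap i j a)) 1}

theorem symModel_homogeneous {r : ℕ} (deg : Fin r → ℤ) (n : ℤ) (c : (Fin m → Fin r) → ℝ)
    (hc : c ∈ symModel m deg) :
    (fun f => if ∑ a, deg (f a) = n then c f else 0) ∈ symModel m deg := by
  let P : ((Fin m → Fin r) → ℝ) →ₗ[ℝ] (Fin m → Fin r) → ℝ :=
    { toFun := fun c f => if ∑ a, deg (f a) = n then c f else 0
      map_add' := fun c c' => by funext f; simp only [Pi.add_apply]; split_ifs <;> simp
      map_smul' := fun t c => by
        funext f; simp only [Pi.smul_apply, RingHom.id_apply]; split_ifs <;> simp }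
  have hP : ∀ f : Fin m → Fin r, P (Pi.single f 1) =
      if ∑ a, deg (f a) = n then Pi.single f 1 else 0 := by
    intro f
    funext g
    change (if ∑ a, deg (g a) = n then (Pi.single f 1 : (Fin m → Fin r) → ℝ) g else 0) = _
    by_cases hg : g = f
    · subst hg; split_ifs <;> simp
    · split_ifs <;> simp [hg]
  have hle : symModel m deg ≤ (symModel m deg).comap P := by
    refine Submodule.span_le.2 ?_
    rintro _ ⟨i, j, f, hij, rfl⟩
    rw [SetLike.mem_coe, Submodule.mem_comap, map_sub, map_smul, hP, hP,
      Equiv.sum_comp (Equiv.swap i j) fun a => deg (f a)]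
    by_cases h : ∑ a, deg (f a) = n
    · rw [if_pos h, if_pos h]
      exact Submodule.subset_span ⟨i, j, f, hij, rfl⟩
    · rw [if_neg h, if_neg h, smul_zero, sub_zero]
      exact Submodule.zero_mem _
  exact hle hc

theorem IsFrame.exists_coeff {U : Set M} {r : ℕ} {deg : Fin r → ℤ} {e : Fin r → ∀ x, E.Fiber x}
    (h : IsFrame d E U deg e) {x : M} (hx : x ∈ U) (v : E.Fiber x) :
    ∃ c : Fin r → ℝ, v = ∑ k, c k • e k x := by
  have hv : v ∈ Submodule.span ℝ (Set.range fun i => e i x) := by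
    rw [h.span_eq x hx]; exact Submodule.mem_top
  obtain ⟨c, hc⟩ := (Submodule.mem_span_range_iff_exists_fun ℝ).1 hv
  exact ⟨c, hc.symm⟩

theorem IsFrame.exists_coeff_of_mem_grading {U : Set M} {r : ℕ} {deg : Fin r → ℤ}
    {e : Fin r → ∀ x, E.Fiber x} (h : IsFrame d E U deg e) {x : M} (hx : x ∈ U) {n : ℤ} {v : E.Fiber x}
    (hv : v ∈ E.grading x n) :
    ∃ c : Fin r → ℝ, (∀ k, deg k ≠ n → c k = 0) ∧ v = ∑ k, c k • e k x := by
  rw [h.grading_eq x hx] at hv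
  obtain ⟨c, hc, hcv⟩ := (Finsupp.mem_span_image_iff_linearCombination ℝ).1 hv
  refine ⟨c, fun k hk => ?_, ?_⟩
  · by_contra hne
    exact hk ((Finsupp.mem_supported _ _).1 hc (Finsupp.mem_support_iff.2 hne))
  · rw [← hcv, Finsupp.linearCombination_apply, Finsupp.sum_fintype _ _ (by simp)]

theorem IsFrame.symRelations_eq {U : Set M} {r : ℕ} {deg : Fin r → ℤ} {e : Fin r → ∀ x, E.Fiber x}
    (h : IsFrame d E U deg e) {x : M} (hx : x ∈ U) :
    E.symRelations m x = (symModel m deg).map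
      (Fintype.linearCombination ℝ fun f => tensorFrame (fun _ : Fin m => e) f x) := by
  set Ψ := Fintype.linearCombination ℝ fun f => tensorFrame (fun _ : Fin m => e) f x with hΨ
  have hΨ1 : ∀ f, Ψ (Pi.single f 1) = tensorFrame (fun _ : Fin m => e) f x := fun f => by
    rw [hΨ, Fintype.linearCombination_apply_single, one_smul]
  refine le_antisymm (Submodule.span_le.2 ?_) (Submodule.map_le_iff_le_comap.2 (Submodule.span_le.2 ?_))
  · rintro _ ⟨i, j, p, q, v, hij, hi, hj, rfl⟩
    have hne : i ≠ j := fun h => by subst h; omega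
    have hc : ∀ a, ∃ c : Fin r → ℝ, (a = i → ∀ k, deg k ≠ p → c k = 0) ∧
        (a = j → ∀ k, deg k ≠ q → c k = 0) ∧ v a = ∑ k, c k • e k x := by
      intro a
      by_cases hai : a = i
      · subst hai
        obtain ⟨c, h1, h2⟩ := h.exists_coeff_of_mem_grading hx hi
        exact ⟨c, fun _ => h1, fun h => absurd h hne, h2⟩
      · by_cases haj : a = j
        · subst haj
          obtain ⟨c, h1, h2⟩ := h.exists_coeff_of_mem_grading hx hj
          exact ⟨c, fun h => absurd h hai, fun _ => h1, h2⟩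
        · obtain ⟨c, h2⟩ := h.exists_coeff hx (v a)
          exact ⟨c, fun h => absurd h hai, fun h => absurd h haj, h2⟩
    choose c hci hcj hcv using hc
    have e1 : PiTensorProduct.tprod ℝ v =
        ∑ f : Fin m → Fin r, (∏ a, c a (f a)) • tensorFrame (fun _ => e) f x := by
      rw [show v = fun a => ∑ k, c a k • e k x from funext hcv]
      exact tprod_sum_smul _ _
    have e2 : PiTensorProduct.tprod ℝ (fun a => v (Equiv.swap i j a)) =
        ∑ f : Fin m → Fin r, (∏ a, c a (f a)) •
          tensorFrame (fun _ => e) (fun a => f (Equiv.swap i j a)) x := by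
      rw [show (fun a => v (Equiv.swap i j a)) = fun a => ∑ k, c (Equiv.swap i j a) k • e k x from
        funext fun a => hcv _]
      refine (tprod_sum_smul _ _).trans ?_
      rw [← Equiv.sum_comp ((Equiv.swap i j).arrowCongr (Equiv.refl (Fin r)))]
      refine Finset.sum_congr rfl fun f _ => ?_
      rw [← Equiv.prod_comp (Equiv.swap i j) fun a => c a (f a)]
      rfl
    rw [e1, e2, Finset.smul_sum, ← Finset.sum_sub_distrib]
    refine Submodule.sum_mem _ fun f _ => ?_
    rw [smul_comm, ← smul_sub]
    by_cases hf : deg (f i) = p ∧ deg (f j) = q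
    · refine Submodule.smul_mem _ _ ⟨_, Submodule.subset_span ⟨i, j, f, hij, rfl⟩, ?_⟩
      rw [map_sub, map_smul, hΨ1, hΨ1, hf.1, hf.2]
    · have : ∏ a, c a (f a) = 0 := by
        rcases not_and_or.1 hf with hf | hf
        · exact Finset.prod_eq_zero (Finset.mem_univ i) (hci i rfl _ hf)
        · exact Finset.prod_eq_zero (Finset.mem_univ j) (hcj j rfl _ hf)
      rw [this, zero_smul]
      exact Submodule.zero_mem _
  · rintro _ ⟨i, j, f, hij, rfl⟩
    rw [SetLike.mem_coe, Submodule.mem_comap, map_sub, map_smul, hΨ1, hΨ1]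
    exact Submodule.subset_span ⟨i, j, deg (f i), deg (f j), fun a => e (f a) x, hij,
      h.mem_grading hx _, h.mem_grading hx _, rfl⟩

theorem sym_isVectorBundle (hE : E.IsVectorBundle (d := d)) :
    (E.sym (d := d) m).IsVectorBundle (d := d) := by
  refine IsVectorBundle.of_isFrame fun x₀ => ?_
  obtain ⟨U, hU, hx, r, deg, e, h⟩ := hE.exists_isFrame x₀
  have hT : IsFrame d (tensor (d := d) fun _ : Fin m => E) (⋂ _ : Fin m, U)
      (fun f : Fin m → Fin r => ∑ i, deg (f i)) (tensorFrame fun _ => e) := tensor_isFrame fun _ => h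
  refine ⟨U ∩ ⋂ _ : Fin m, U, hU.inter (isOpen_iInter_of_finite fun _ => hU),
    ⟨hx, Set.mem_iInter.2 fun _ => hx⟩, ?_⟩
  have hT' : IsFrame d (tensor (d := d) fun _ : Fin m => E) (U ∩ ⋂ _ : Fin m, U)
      (fun f : Fin m → Fin r => ∑ i, deg (f i)) (tensorFrame fun _ => e) :=
    ⟨fun x hx => hT.linearIndependent x hx.2, fun x hx => hT.span_eq x hx.2,
      fun x hx => hT.grading_eq x hx.2, fun σ x hx => hT.smoothAt_iff σ x hx.2⟩
  refine hT'.exists_quotient sym_isQuotient (hU.inter (isOpen_iInter_of_finite fun _ => hU))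
    (symModel m deg) (symModel_homogeneous deg) fun x hx c => ?_
  have hinj : Function.Injective (Fintype.linearCombination ℝ
      fun f => tensorFrame (fun _ : Fin m => e) f x) := by
    refine (injective_iff_map_eq_zero _).2 fun c hc => ?_
    exact funext (Fintype.linearIndependent_iff.1 (hT.linearIndependent x hx.2) c hc)
  have h1 : (E.symRelations m x).mkQ (Fintype.linearCombination ℝ
      (fun f => tensorFrame (fun _ : Fin m => e) f x) c) = 0 ↔ c ∈ symModel m deg := by
    rw [Submodule.mkQ_apply, Submodule.Quotient.mk_eq_zero, h.symRelations_eq hx.1,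
      Submodule.mem_map]
    exact ⟨fun ⟨c', hc', e⟩ => hinj e ▸ hc', fun hc => ⟨c, hc, rfl⟩⟩
  exact h1

end SymBundle

end GradedBundle

/-! ## Operations that descend to symmetric powers -/

section Swap

variable {m : ℕ}

theorem lt_swap_iff {i j : Fin m} (hij : (i : ℕ) + 1 = j) {b : Fin m} (hi : b ≠ i) (hj : b ≠ j)
    (c : Fin m) : b < Equiv.swap i j c ↔ b < c := by
  rw [Equiv.swap_apply_def]
  simp only [Ne, Fin.ext_iff, Fin.lt_def] at *
  split_ifs <;> omega

theorem lt_and_swap_lt_iff {i j : Fin m} (hij : (i : ℕ) + 1 = j) (a b : Fin m) :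
    (a < b ∧ Equiv.swap i j b < Equiv.swap i j a) ↔ a = i ∧ b = j := by
  rw [Equiv.swap_apply_def, Equiv.swap_apply_def]
  simp only [Fin.ext_iff, Fin.lt_def]
  split_ifs <;> omega

theorem permExponent_swap {i j : Fin m} (hij : (i : ℕ) + 1 = j) (u : Fin m → ZMod 2) :
    Omega.permExponent (Equiv.swap i j) u = u i * u j := by
  rw [Omega.permExponent, pairing]
  simp only [lt_and_swap_lt_iff hij]
  rw [Finset.sum_eq_single i, Finset.sum_eq_single j]
  · simp
  · intro b _ hb; simp [hb]
  · simp
  · intro a _ ha; simp [ha]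
  · simp

theorem sum_filter_lt_swap {i j : Fin m} (hij : (i : ℕ) + 1 = j) (k : Fin m → ℕ) {b : Fin m} (hi : b ≠ i)
    (hj : b ≠ j) : ∑ c ∈ Finset.univ.filter (fun c => b < c), k (Equiv.swap i j c) =
      ∑ c ∈ Finset.univ.filter (fun c => b < c), k c := by
  rw [Finset.sum_filter, Finset.sum_filter, ← Equiv.sum_comp (Equiv.swap i j) fun c => if b < c then k c else 0]
  simp only [lt_swap_iff hij hi hj]

theorem sum_filter_lt_swap_right {i j : Fin m} (hij : (i : ℕ) + 1 = j) (k : Fin m → ℕ) :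
    ∑ c ∈ Finset.univ.filter (fun c => j < c), k (Equiv.swap i j c) =
      ∑ c ∈ Finset.univ.filter (fun c => j < c), k c := by
  refine Finset.sum_congr rfl fun c hc => ?_
  have hc : j < c := by simpa using hc
  rw [Equiv.swap_apply_of_ne_of_ne]
  · rintro rfl; simp only [Fin.lt_def] at hc; omega
  · exact hc.ne'

theorem sum_filter_lt_left {i j : Fin m} (hij : (i : ℕ) + 1 = j) (k : Fin m → ℕ) :
    ∑ c ∈ Finset.univ.filter (fun c => i < c), k c =
      k j + ∑ c ∈ Finset.univ.filter (fun c => j < c), k c := by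
  have : Finset.univ.filter (fun c => i < c) = insert j (Finset.univ.filter (fun c => j < c)) := by
    ext c
    simp only [Finset.mem_filter, Finset.mem_univ, true_and, Finset.mem_insert, Fin.ext_iff, Fin.lt_def]
    omega
  rw [this, Finset.sum_insert (by simp)]

end Swap

section SymRelation

open GradedBundle

variable {d m : ℕ} {M : Type*} [TopologicalSpace M] [ChartedSpace (EuclideanSpace ℝ (Fin d)) M]
  {E : GradedBundle M}

theorem gradedTensor_sub_swap_mem (hE : E.IsVectorBundle (d := d)) {x y : M}
    {φ : Fin m → E.Fiber x →ₗ[ℝ] E.Fiber y} {k : Fin m → ℕ} {i j : Fin m} (hij : (i : ℕ) + 1 = j)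
    {p q a b : ℤ} {v : Fin m → E.Fiber x} (hi : v i ∈ E.grading x p) (hj : v j ∈ E.grading x q)
    (hφi : ∀ w ∈ E.grading x p, φ i w ∈ E.grading y (p + a))
    (hφj : ∀ w ∈ E.grading x q, φ j w ∈ E.grading y (q + b))
    (ha : (a : ZMod 2) = k i) (hb : (b : ZMod 2) = k j) :
    gradedTensor (fun _ => E.parity x) φ k (PiTensorProduct.tprod ℝ v) -
      signChar (p * q + k i * k j) • gradedTensor (fun _ => E.parity x)
        (fun c => φ (Equiv.swap i j c)) (fun c => k (Equiv.swap i j c))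
        (PiTensorProduct.tprod ℝ fun c => v (Equiv.swap i j c)) ∈ E.symRelations m y := by
  have hne : i ≠ j := fun h => by subst h; omega
  let S : Fin m → ℕ := fun b => ∑ c ∈ Finset.univ.filter (fun c => b < c), k c
  let u : Fin m → E.Fiber y := fun c => φ c ((E.parity x ^ S c) (v c))
  have e1 : gradedTensor (fun _ => E.parity x) φ k (PiTensorProduct.tprod ℝ v) =
      PiTensorProduct.tprod ℝ u := PiTensorProduct.map_tprod _ _
  have e2 : gradedTensor (fun _ => E.parity x) (fun c => φ (Equiv.swap i j c))
      (fun c => k (Equiv.swap i j c)) (PiTensorProduct.tprod ℝ fun c => v (Equiv.swap i j c)) =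
      signChar (k i * q + k j * p) • PiTensorProduct.tprod ℝ fun c => u (Equiv.swap i j c) := by
    have hs : ∀ c, φ (Equiv.swap i j c) ((E.parity x ^ (∑ c' ∈ Finset.univ.filter (fun c' => c < c'),
        k (Equiv.swap i j c'))) (v (Equiv.swap i j c))) =
        ((if c = i then signChar (k i * q) else 1) * (if c = j then signChar (k j * p) else 1)) •
          u (Equiv.swap i j c) := by
      intro c
      by_cases hci : c = i
      · subst hci
        rw [if_pos rfl, if_neg hne, mul_one, Equiv.swap_apply_left,
          sum_filter_lt_left hij fun c' => k (Equiv.swap c j c'), sum_filter_lt_swap_right hij,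
          Equiv.swap_apply_right, pow_add, Module.End.mul_apply, hE.parity_pow_apply hj,
          map_smul, hE.parity_pow_apply hj, smul_smul, map_smul]
        simp only [u]
        rw [hE.parity_pow_apply hj, map_smul, smul_smul, ← signChar_add, ← signChar_add]
        congr 2
        ring
      · by_cases hcj : c = j
        · subst hcj
          rw [if_neg hci, if_pos rfl, one_mul, Equiv.swap_apply_right, sum_filter_lt_swap_right hij,
            hE.parity_pow_apply hi, map_smul]
          simp only [u, S]
          rw [sum_filter_lt_left hij, hE.parity_pow_apply hi, map_smul, smul_smul, ← signChar_add]
          congr 2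
          push_cast
          rw [add_mul, ← add_assoc, zmod_two_add_self, zero_add]
        · rw [if_neg hci, if_neg hcj, one_mul, one_smul, sum_filter_lt_swap hij k hci hcj,
            Equiv.swap_apply_of_ne_of_ne hci hcj]
    refine (PiTensorProduct.map_tprod _ _).trans ?_
    refine (congrArg (PiTensorProduct.tprod ℝ) (funext hs)).trans ?_
    rw [MultilinearMap.map_smul_univ, Finset.prod_mul_distrib, Finset.prod_ite_eq', Finset.prod_ite_eq',
      if_pos (Finset.mem_univ i), if_pos (Finset.mem_univ j), signChar_add]
  have hui : u i ∈ E.grading y (p + a) := by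
    simp only [u]
    rw [hE.parity_pow_apply hi, map_smul]
    exact Submodule.smul_mem _ _ (hφi _ hi)
  have huj : u j ∈ E.grading y (q + b) := by
    simp only [u]
    rw [hE.parity_pow_apply hj, map_smul]
    exact Submodule.smul_mem _ _ (hφj _ hj)
  rw [e1, e2, smul_smul, ← signChar_add]
  refine Submodule.subset_span ⟨i, j, p + a, q + b, u, hij, hui, huj, ?_⟩
  rw [neg_one_zpow_eq_signChar]
  congr 3
  push_cast
  rw [ha, hb]
  ring

end SymRelation
end RuthTensor

namespace RuthTensor

/-! ## Symmetric powers of representations up to homotopy -/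

section Descends

open GradedBundle

variable {dM dG : ℕ}
  {M : Type*} [TopologicalSpace M] [ChartedSpace (EuclideanSpace ℝ (Fin dM)) M]
  [IsManifold (𝓡 dM) ∞ M]
  {G : Type*} [TopologicalSpace G] [ChartedSpace (EuclideanSpace ℝ (Fin dG)) G]
  [IsManifold (𝓡 dG) ∞ G]
  {Γ : LieGroupoid dM dG M G} {m : ℕ} {E : GradedBundle M} {R : Operations G E E}

theorem tensorDiff_descends (hE : IsRepUpToHomotopy Γ E R) (x : M) :
    E.symRelations m x ≤ (E.symRelations m x).comap
      (tensorDiff (E := fun _ : Fin m => E) (fun _ => R) x) := by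
  refine Submodule.span_le.2 ?_
  rintro _ ⟨i, j, p, q, v, hij, hi, hj, rfl⟩
  have hne : i ≠ j := fun h => by subst h; omega
  rw [SetLike.mem_coe, Submodule.mem_comap, map_sub, map_smul, tensorDiff, LinearMap.sum_apply,
    LinearMap.sum_apply, ← Equiv.sum_comp (Equiv.swap i j) (fun a => diffTerm (fun _ => E.parity x)
      (fun _ => R [] x x) a (PiTensorProduct.tprod ℝ fun a => v (Equiv.swap i j a))),
    Finset.smul_sum, ← Finset.sum_sub_distrib]
  refine Submodule.sum_mem _ fun a _ => ?_
  let φ : Fin m → Module.End ℝ (E.Fiber x) := Function.update (fun _ => LinearMap.id) a (R [] x x)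
  have hφ : ∀ c n, ∀ w ∈ E.grading x n, φ c w ∈ E.grading x (n + (Pi.single a 1 : Fin m → ℤ) c) := by
    intro c n w hw
    by_cases hc : c = a
    · subst hc; simpa [φ] using hE.hasDegree [] x x rfl n w hw
    · simpa [φ, hc] using hw
  have hpar : ∀ c, (((Pi.single a 1 : Fin m → ℤ) c : ℤ) : ZMod 2) =
      ((Pi.single a 1 : Fin m → ℕ) c : ℕ) := by
    intro c
    by_cases hc : c = a
    · subst hc; simp
    · simp [hc]
  have key := gradedTensor_sub_swap_mem hE.isVectorBundle (φ := φ) (k := Pi.single a 1) hij hi hj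
    (hφ i p) (hφ j q) (hpar i) (hpar j)
  have e0 : (((Pi.single a 1 : Fin m → ℕ) i : ℕ) : ZMod 2) * ((Pi.single a 1 : Fin m → ℕ) j : ℕ) = 0 := by
    by_cases hia : i = a
    · subst hia; simp [hne.symm]
    · simp [hia]
  rw [e0, add_zero] at key
  have e1 : (-1 : ℝ) ^ (p * q) = signChar ((p : ZMod 2) * q) := by
    rw [neg_one_zpow_eq_signChar]; push_cast; rfl
  have e2 : (fun c => φ (Equiv.swap i j c)) =
      Function.update (fun _ => LinearMap.id) (Equiv.swap i j a) (R [] x x) := by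
    funext c
    by_cases hc : c = Equiv.swap i j a
    · subst hc; simp [φ]
    · rw [Function.update_of_ne hc]
      exact Function.update_of_ne (fun h => hc (by rw [← h, Equiv.swap_apply_self])) _ _
  have e3 : (fun c => (Pi.single a 1 : Fin m → ℕ) (Equiv.swap i j c)) =
      Pi.single (Equiv.swap i j a) 1 := by
    funext c
    by_cases hc : c = Equiv.swap i j a
    · subst hc; simp
    · rw [Pi.single_eq_of_ne hc]
      exact Pi.single_eq_of_ne (fun h => hc (by rw [← h, Equiv.swap_apply_self])) _
  rw [e2, e3, ← e1] at key
  exact key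

theorem tensorEval_descends (hE : IsRepUpToHomotopy Γ E R) {n : ℤ} {z : Completion m}
    (hz : z.HasDegree n) (hzs : z.IsSymmetric) {l : List G} {y x : M} (hs : Γ.IsString l y x) :
    E.symRelations m x ≤ (E.symRelations m y).comap
      (tensorEval (E := fun _ : Fin m => E) Γ (fun _ => R) l y x (z l.length)) := by
  refine Submodule.span_le.2 ?_
  rintro _ ⟨i, j, p, q, v, hij, hi, hj, rfl⟩
  rw [SetLike.mem_coe, Submodule.mem_comap, map_sub, map_smul]
  set T := tensorEval (E := fun _ : Fin m => E) Γ (fun _ => R) l y x with hT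
  set t := PiTensorProduct.tprod ℝ v with ht
  set t' := PiTensorProduct.tprod ℝ (fun a => v (Equiv.swap i j a)) with ht'
  have hmem := Omega.map_mem_of_mem_supported (f := T.flip t -
    ((-1 : ℝ) ^ (p * q)) • T.flip t' ∘ₗ Omega.perm (Equiv.swap i j)) (P := E.symRelations m y)
    (hz l.length) ?_
  · rw [LinearMap.sub_apply, LinearMap.smul_apply, LinearMap.comp_apply, LinearMap.flip_apply,
      LinearMap.flip_apply, hzs] at hmem
    exact hmem
  · rintro W ⟨hW, -⟩
    have hlen : l.length = (W.length + 1) := hW.symm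
    have hdeg : ∀ c n, ∀ w ∈ E.grading x n, wordOperation Γ R (W.factor c) l y x w ∈
        E.grading y (n + -(W.bCount c : ℤ)) := fun c n w hw =>
      wordOperation_hasDegree Γ R hE.hasDegree _ l y x hs (by rw [factor_length, hlen]) n w hw
    have hpar : ∀ c, ((-(W.bCount c : ℤ) : ℤ) : ZMod 2) = W.bCount c := fun c => by
      push_cast; rw [zmod_two_neg]
    have key := gradedTensor_sub_swap_mem hE.isVectorBundle
      (φ := fun c => wordOperation Γ R (W.factor c) l y x) (k := W.bCount) hij hi hj
      (hdeg i p) (hdeg j q) (hpar i) (hpar j)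
    rw [LinearMap.sub_apply, LinearMap.smul_apply, LinearMap.comp_apply, LinearMap.flip_apply,
      LinearMap.flip_apply, Omega.perm_single, permExponent_swap hij, map_smul, LinearMap.smul_apply,
      smul_smul, hT, tensorEval_single, tensorEval_single, neg_one_zpow_eq_signChar, ← signChar_add]
    have e1 : tensorWordMap (E := fun _ : Fin m => E) Γ (fun _ => R) (W.permute (Equiv.swap i j)) l y x =
        gradedTensor (fun _ => E.parity x)
          (fun c => wordOperation Γ R (W.factor (Equiv.swap i j c)) l y x)
          (fun c => W.bCount (Equiv.swap i j c)) := by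
      rw [tensorWordMap]
      congr 1
      · funext c; rw [Word.factor_permute, Equiv.symm_swap]
      · funext c; rw [Word.bCount_permute, Equiv.symm_swap]
    rw [e1]
    push_cast
    exact key

theorem Descends.extend {D : ∀ x, (tensor (d := dM) fun _ : Fin m => E).Fiber x →ₗ[ℝ]
      (tensor (d := dM) fun _ : Fin m => E).Fiber x}
    {c : Operations G (tensor (d := dM) fun _ : Fin m => E) (tensor (d := dM) fun _ : Fin m => E)}
    {l : List G} {y x : M} (hs : Γ.IsString l y x)
    (hD : E.symRelations m x ≤ (E.symRelations m x).comap (D x)) (hc : Descends c l y x) :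
    Descends (Operations.extend D c) l y x := by
  match l, hs with
  | [], hs =>
    obtain rfl : y = x := hs
    rw [Descends, Operations.extend_nil]
    exact hD
  | g :: l, hs => exact hc

theorem tensorOperations_descends (hE : IsRepUpToHomotopy Γ E R) {η : Completion m}
    (hη : η.IsUniversalMC) (hηs : η.IsSymmetric) {l : List G} {y x : M} (hs : Γ.IsString l y x) :
    Descends (tensorOperations Γ η (E := fun _ : Fin m => E) fun _ => R) l y x := by
  rw [tensorOperations_eq_extend]
  refine Descends.extend hs ?_ (tensorEval_descends hE hη.1.1 hηs hs)
  rw [tensorDifferential_eq]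
  exact tensorDiff_descends hE x

theorem gaugeOperations_descends (hE : IsRepUpToHomotopy Γ E R) {z : Completion m}
    (hz : z.HasDegree 0) (hzs : z.IsSymmetric) {l : List G} {y x : M} (hs : Γ.IsString l y x) :
    Descends (gaugeOperations (E := fun _ : Fin m => E) Γ (fun _ => R) z) l y x :=
  Descends.extend hs (fun _ h => h) (tensorEval_descends hE hz hzs hs)

theorem symOperations_induces
    {A : Operations G (tensor (d := dM) fun _ : Fin m => E) (tensor (d := dM) fun _ : Fin m => E)}
    (h : ∀ l y x, Γ.IsString l y x → Descends A l y x) :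
    Operations.Induces Γ (F := tensor (d := dM) fun _ : Fin m => E) (F' := E.sym (d := dM) m)
      (fun x => (E.symRelations m x).mkQ) A (symOperations A) := by
  intro l y x hs
  have e : symOperations A l y x = _ := dif_pos (h l y x hs)
  rw [e]
  rfl

theorem symOperations_isRepUpToHomotopy (hE : IsRepUpToHomotopy Γ E R) {η : Completion m}
    (hη : η.IsUniversalMC) (hηs : η.IsSymmetric) :
    IsRepUpToHomotopy Γ (E.sym (d := dM) m)
      (symOperations (tensorOperations Γ η (E := fun _ : Fin m => E) fun _ => R)) :=
  .of_induces (symOperations_induces fun _ _ _ => tensorOperations_descends hE hη hηs)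
    sym_isQuotient (sym_isVectorBundle hE.isVectorBundle)
    (tensorOperations_isRepUpToHomotopy (fun _ => hE) hη)

theorem symOperations_stronglyIsomorphic (hE : IsRepUpToHomotopy Γ E R) {η θ : Completion m}
    (hη : η.IsUniversalMC) (hηs : η.IsSymmetric) (hθ : θ.IsUniversalMC) (hθs : θ.IsSymmetric) :
    StronglyIsomorphic Γ
      (symOperations (tensorOperations Γ η (E := fun _ : Fin m => E) fun _ => R))
      (symOperations (tensorOperations Γ θ (E := fun _ : Fin m => E) fun _ => R)) := by
  obtain ⟨z, hz, hzs, h⟩ := Completion.exists_gauge True hη hθ fun _ => ⟨hηs, hθs⟩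
  have hA : Operations.Induces Γ _ _ _ :=
    symOperations_induces (Γ := Γ) fun _ _ _ => tensorOperations_descends hE hη hηs
  have hB : Operations.Induces Γ _ _ _ :=
    symOperations_induces (Γ := Γ) fun _ _ _ => tensorOperations_descends hE hθ hθs
  have hΦ : Operations.Induces Γ _ _ _ :=
    symOperations_induces (Γ := Γ) fun _ _ _ => gaugeOperations_descends hE hz (hzs trivial)
  refine ⟨fun x => ?_, _, .of_induces hA hB hΦ sym_isQuotient
    (gaugeOperations_isMorphism (fun _ => hE) hη.1.1 hθ.1.1 hz h), fun x => ?_⟩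
  · refine (LinearMap.cancel_right (sym_isQuotient (d := dM) (m := m) (E := E) |>.surjective x)).1 ?_
    exact (hA [] x x rfl).trans (hB [] x x rfl).symm
  · refine (LinearMap.cancel_right (sym_isQuotient (d := dM) (m := m) (E := E) |>.surjective x)).1 ?_
    refine (hΦ [] x x rfl).trans ?_
    rw [gaugeOperations_nil]
    rfl

end Descends
end RuthTensor

end

theorem mainTheorem2 (m : ℕ) (hm : 0 < m) :
    -- symmetric universal Maurer-Cartan elements of length `m` exist
    (∃ η : Completion m, η.IsUniversalMC ∧ η.IsSymmetric) ∧
    -- any two universal Maurer-Cartan elements are strongly gauge equivalent, and any two strong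
    -- gauge equivalences between them are homotopic
    (∀ η θ : Completion m, η.IsUniversalMC → θ.IsUniversalMC →
      (∃ u, UnitalCompletion.IsStrongGaugeEquivalence η θ u) ∧
      ∀ u v, UnitalCompletion.IsStrongGaugeEquivalence η θ u →
        UnitalCompletion.IsStrongGaugeEquivalence η θ v → UnitalCompletion.Homotopic η θ u v) ∧
    -- tensor products and symmetric powers of representations up to homotopy
    (∀ {dM dG : ℕ}
      {M : Type*} [TopologicalSpace M] [ChartedSpace (EuclideanSpace ℝ (Fin dM)) M]
      [IsManifold (𝓡 dM) ∞ M]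
      {G : Type*} [TopologicalSpace G] [ChartedSpace (EuclideanSpace ℝ (Fin dG)) G]
      [IsManifold (𝓡 dG) ∞ G] (Γ : LieGroupoid dM dG M G),
      -- each universal element defines a tensor product of `m` representations up to homotopy, and
      -- any two of these tensor products are strongly isomorphic
      (∀ (E : Fin m → GradedBundle M) (R : ∀ i, Operations G (E i) (E i)),
        (∀ i, IsRepUpToHomotopy Γ (E i) (R i)) →
        (∀ η : Completion m, η.IsUniversalMC →
          IsRepUpToHomotopy Γ (GradedBundle.tensor (d := dM) E) (tensorOperations Γ η R)) ∧
        ∀ η θ : Completion m, η.IsUniversalMC → θ.IsUniversalMC →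
          StronglyIsomorphic Γ (tensorOperations Γ η R) (tensorOperations Γ θ R)) ∧
      -- each symmetric universal element defines an `m`-th symmetric power of a representation up to
      -- homotopy, and any two of these symmetric powers are strongly isomorphic
      (∀ (E : GradedBundle M) (R : Operations G E E), IsRepUpToHomotopy Γ E R →
        (∀ η : Completion m, η.IsUniversalMC → η.IsSymmetric →
          (∀ l y x, Γ.IsString l y x →
            Descends (tensorOperations Γ η (E := fun _ : Fin m => E) fun _ => R) l y x) ∧
          IsRepUpToHomotopy Γ (E.sym (d := dM) m)
            (symOperations (tensorOperations Γ η (E := fun _ : Fin m => E) fun _ => R))) ∧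
        ∀ η θ : Completion m, η.IsUniversalMC → η.IsSymmetric →
          θ.IsUniversalMC → θ.IsSymmetric →
          StronglyIsomorphic Γ
            (symOperations (tensorOperations Γ η (E := fun _ : Fin m => E) fun _ => R))
            (symOperations (tensorOperations Γ θ (E := fun _ : Fin m => E) fun _ => R)))) := by
  refine ⟨Completion.exists_symmetric_universalMC, fun η θ hη hθ =>
    ⟨UnitalCompletion.exists_strongGaugeEquivalence hη hθ, fun u v hu hv => UnitalCompletion.IsStrongGaugeEquivalence.homotopic hη hθ hu hv⟩, ?_⟩
  intro dM dG M _ _ _ G _ _ _ Γ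
  refine ⟨fun E R hE => ⟨fun η hη => tensorOperations_isRepUpToHomotopy hE hη,
      fun η θ hη hθ => tensorOperations_stronglyIsomorphic hE hη hθ⟩,
    fun E R hE => ⟨fun η hη hηs => ⟨fun l y x hs => tensorOperations_descends hE hη hηs hs,
      symOperations_isRepUpToHomotopy hE hη hηs⟩,
      fun η θ hη hηs hθ hθs => symOperations_stronglyIsomorphic hE hη hηs hθ hθs⟩⟩
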